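/- Let $X,Y$ be (real or complex) Hilbert spaces and let $L$ be a densely defined, self-adjoint, strictly positive operator in $X$, i.e. $\|x\|^2\le\theta(Lx,x)$ on $D(L)$ for some $\theta>0$. For $r\in\mathbb R$ let $X_r$ be the Hilbert scale generated by $L$, with norm $\|h\|_r=\|L^rh\|$. Let $a\ge0$, $0\le b\le a$, $s>-a$, $0<m\le M<\infty$, $0<\beta\le1$, $K_0\ge0$, and put $r_\alpha(\lambda)=1-\lambda g_\alpha(\lambda)$. Let $\{\alpha_n\}_{n\ge0}$ satisfy $0<\alpha_n\le c_1$, and let $s_{-1}=0$, $s_n=\sum_{j=0}^n 1/\alpha_j$. Let $g_\alpha:[0,1]\to\mathbb R$, $\alpha>0$, be functions such that: (1) for each $\alpha>0$ the function $\varphi_\alpha(\lambda)=g_\alpha(\lambda)-\frac1{\alpha+\lambda}$ extends analytically to a domain $D_\alpha\supset[0,1]$ in $\mathbb C$, and there is a closed piecewise $C^1$ contour $\Gamma_\alpha\subset D_\alpha$, with winding number $1$ about every point of $[0,1]$ and $0$ about every point outside $D_\alpha$, such that $|z|\ge\alpha/2$ and $\frac{|z|+\lambda}{|z-\lambda|}\le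 b_0$ for all $z\in\Gamma_\alpha$, $\lambda\in[0,1]$; moreover $\int_{\Gamma_\alpha}|\varphi_\alpha(z)|\,|dz|\le b_1$ for $0<\alpha\le c_1$; (2) for all $0\le j\le n$, $0\le\nu\le1$, $0\le\lambda\le1$, $$0\le\lambda^\nu\prod_{k=j}^n r_{\alpha_k}(\lambda)\le(s_n-s_{j-1})^{-\nu},\qquad 0\le\lambda^\nu g_{\alpha_j}(\lambda)\prod_{k=j+1}^n r_{\alpha_k}(\lambda)\le \frac{b_2}{\alpha_j}(s_n-s_{j-1})^{-\nu}.$$ Let $F$ be a $Y$-valued map, Fréchet differentiable on the ball $B_\rho(x^\dagger)\subset X$, such that for all $x\in B_\rho(x^\dagger)$: (a) $m\|h\|_{-a}\le\|F'(x)h\|\le M\|h\|_{-a}$ for $h\in X$; (b) $\|F'(x)L^{-s}\|_{X\to Y}\le\min\{1,\sqrt{\alpha_0}\}$, where $F'(x)L^{-s}$ denotes the bounded operator on all of $X$ obtained by continuous extension; (c) $\|F'(x)^*-F'(x^\dagger)^*\|_{Y\to X_b}\le K_0\|x-x^\dagger\|^\beta$. Put $A=F'(x^\dagger)L^{-s}$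 and $A_x=F'(x)L^{-s}$. Then there is a constant $C$, depending only on $a,b,s,m,M,b_0,b_1,b_2$, such that for all $\nu$ with $-\frac{b+s}{2(a+s)}\le\nu\le\frac12$, all $x\in B_\rho(x^\dagger)$ and all $0\le j\le n$, the operator on the left below is defined on all of $Y$ and bounded, and $$\Big\|(A^*A)^\nu\prod_{k=j+1}^n r_{\alpha_k}(A^*A)\big[g_{\alpha_j}(A^*A)A^*-g_{\alpha_j}(A_x^*A_x)A_x^*\big]\Big\|_{Y\to X}\le \frac{C}{\alpha_j}(s_n-s_{j-1})^{-\nu-\frac{b+s}{2(a+s)}}K_0\|x-x^\dagger\|^\beta.$$ -/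

import Mathlib

open Set Filter Topology Polynomial

namespace InexactNewton

/-! ### Functions of bounded positive operators -/

/-- `p(T)` for a polynomial `p` with real coefficients and a bounded operator `T`. -/
noncomputable def polyOp {𝕜 H : Type*} [RCLike 𝕜] [NormedAddCommGroup H] [InnerProductSpace 𝕜 H]
    (T : H →L[𝕜] H) (p : ℝ[X]) : H →L[𝕜] H :=
  aeval T (p.map (algebraMap ℝ 𝕜))

/-- `S = f(T)` for a positive operator `T` (its spectrum lies in `[0, ‖T‖]`) and a continuous
function `f`: there are real polynomials `pₙ` with `pₙ → f` uniformly on `[0, ‖T‖]` and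
`pₙ(T) → S` in operator norm. -/
def IsFunctionOf {𝕜 H : Type*} [RCLike 𝕜] [NormedAddCommGroup H] [InnerProductSpace 𝕜 H]
    (T : H →L[𝕜] H) (f : ℝ → ℝ) (S : H →L[𝕜] H) : Prop :=
  ∃ p : ℕ → ℝ[X],
    TendstoUniformlyOn (fun n t => (p n).eval t) f atTop (Icc 0 ‖T‖) ∧
      Tendsto (fun n => polyOp T (p n)) atTop (𝓝 S)

open Classical in
/-- The continuous functional calculus `f(T)` of a positive operator `T`. It is well defined for
`f` continuous on `[0, ‖T‖]`, see `existsUnique_isFunctionOf`. -/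
noncomputable def fc {𝕜 H : Type*} [RCLike 𝕜] [NormedAddCommGroup H] [InnerProductSpace 𝕜 H]
    (T : H →L[𝕜] H) (f : ℝ → ℝ) : H →L[𝕜] H :=
  if h : ∃ S, IsFunctionOf T f S then h.choose else 0

section WellDefined

variable {𝕜 H : Type*} [RCLike 𝕜] [NormedAddCommGroup H] [InnerProductSpace 𝕜 H]

lemma polyOp_sub (T : H →L[𝕜] H) (p q : ℝ[X]) : polyOp T (p - q) = polyOp T p - polyOp T q := by
  simp [polyOp]

lemma polyOp_mul (T : H →L[𝕜] H) (p q : ℝ[X]) : polyOp T (p * q) = polyOp T p * polyOp T q := by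
  simp [polyOp]

lemma polyOp_C (T : H →L[𝕜] H) (c : ℝ) : polyOp T (C c) = algebraMap 𝕜 _ (c : 𝕜) := by
  simp [polyOp]

lemma isUnit_polyOp_C (T : H →L[𝕜] H) {c : ℝ} (hc : c ≠ 0) : IsUnit (polyOp T (C c)) := by
  rw [polyOp_C]
  exact (IsUnit.mk0 (c : 𝕜) (by exact_mod_cast hc)).map (algebraMap 𝕜 (H →L[𝕜] H))

variable [CompleteSpace H]

lemma polyOp_isSelfAdjoint (T : H →L[𝕜] H) (hT : T.IsPositive) (p : ℝ[X]) :
    IsSelfAdjoint (polyOp T p) := by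
  induction p using Polynomial.induction_on' with
  | add p q hp hq =>
    have : polyOp T (p + q) = polyOp T p + polyOp T q := by simp [polyOp]
    rw [this]; exact hp.add hq
  | monomial n c =>
    have : polyOp T (monomial n c) = (c : 𝕜) • T ^ n := by
      simp [polyOp, aeval_monomial, Algebra.smul_def]
    rw [this]
    refine IsSelfAdjoint.smul ?_ (hT.isSelfAdjoint.pow n)
    simp [IsSelfAdjoint]

lemma isUnit_of_re_le (S : H →L[𝕜] H) {c : ℝ} (hc : 0 < c)
    (h : ∀ x, c * ‖x‖ ^ 2 ≤ RCLike.re (inner 𝕜 (S x) x)) : IsUnit S := by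
  refine ContinuousLinearMap.isUnit_of_forall_le_norm_inner_map S (c := ⟨c, hc.le⟩) hc fun x => ?_
  calc ‖x‖ ^ 2 * c = c * ‖x‖ ^ 2 := mul_comm _ _
    _ ≤ _ := (h x).trans (RCLike.re_le_norm _)

lemma isUnit_polyOp_linear (T : H →L[𝕜] H) (hT : T.IsPositive) (b c : ℝ)
    (h0 : 0 < c) (h1 : 0 < b * ‖T‖ + c) : IsUnit (polyOp T (C b * X + C c)) := by
  refine isUnit_of_re_le _ (lt_min h0 h1) fun x => ?_
  have e : polyOp T (C b * X + C c) x = (b : 𝕜) • T x + (c : 𝕜) • x := by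
    simp [polyOp, Algebra.algebraMap_eq_smul_one]
  have hx : inner 𝕜 ((b : 𝕜) • T x + (c : 𝕜) • x) x
      = (b : 𝕜) * inner 𝕜 (T x) x + (c : 𝕜) * inner 𝕜 x x := by
    simp [inner_add_left, inner_smul_left]
  rw [e, hx, map_add, RCLike.re_ofReal_mul, RCLike.re_ofReal_mul, inner_self_eq_norm_sq]
  have p1 : 0 ≤ RCLike.re (inner 𝕜 (T x) x) := hT.re_inner_nonneg_left x
  have p2 : RCLike.re (inner 𝕜 (T x) x) ≤ ‖T‖ * ‖x‖ ^ 2 := by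
    calc RCLike.re (inner 𝕜 (T x) x) ≤ ‖T x‖ * ‖x‖ := re_inner_le_norm _ _
      _ ≤ (‖T‖ * ‖x‖) * ‖x‖ := by gcongr; exact T.le_opNorm x
      _ = ‖T‖ * ‖x‖ ^ 2 := by ring
  have hn := sq_nonneg ‖x‖
  rcases le_total 0 b with hb | hb
  · nlinarith [min_le_left c (b * ‖T‖ + c), mul_nonneg hb p1]
  · nlinarith [min_le_right c (b * ‖T‖ + c), mul_le_mul_of_nonpos_left p2 hb]

lemma isUnit_polyOp_quadratic (T : H →L[𝕜] H) (hT : T.IsPositive) (p : ℝ[X]) {d : ℝ}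
    (hd : 0 < d) : IsUnit (polyOp T (p * p + C d)) := by
  refine isUnit_of_re_le _ hd fun x => ?_
  have e : polyOp T (p * p + C d) x = polyOp T p (polyOp T p x) + (d : 𝕜) • x := by
    simp [polyOp, Algebra.algebraMap_eq_smul_one]
  have hs : inner 𝕜 (polyOp T p (polyOp T p x)) x = inner 𝕜 (polyOp T p x) (polyOp T p x) :=
    (polyOp_isSelfAdjoint T hT p).isSymmetric _ _
  have hx : inner 𝕜 (polyOp T p (polyOp T p x) + (d : 𝕜) • x) x
      = inner 𝕜 (polyOp T p x) (polyOp T p x) + (d : 𝕜) * inner 𝕜 x x := by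
    rw [inner_add_left, hs]; simp [inner_smul_left]
  rw [e, hx, map_add, RCLike.re_ofReal_mul, inner_self_eq_norm_sq, inner_self_eq_norm_sq]
  nlinarith [sq_nonneg ‖polyOp T p x‖]

lemma isUnit_polyOp (T : H →L[𝕜] H) (hT : T.IsPositive) (q : ℝ[X])
    (hq : ∀ t ∈ Icc 0 ‖T‖, q.eval t ≠ 0) : IsUnit (polyOp T q) := by
  induction q using WfDvdMonoid.induction_on_irreducible with
  | zero => exact absurd (by simp) (hq 0 ⟨le_rfl, norm_nonneg _⟩)
  | unit u hu =>
    obtain ⟨c, hc, rfl⟩ := Polynomial.isUnit_iff.1 hu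
    exact isUnit_polyOp_C T hc.ne_zero
  | mul q i hq0 hi ih =>
    rw [polyOp_mul]
    refine IsUnit.mul ?_ (ih fun t ht h => hq t ht (by simp [h]))
    replace hq : ∀ t ∈ Icc 0 ‖T‖, i.eval t ≠ 0 := fun t ht h => hq t ht (by simp [h])
    clear ih hq0
    have hdeg := hi.degree_le_two
    obtain ⟨a, b, c, rfl⟩ : ∃ a b c : ℝ, i = C a * X ^ 2 + C b * X + C c :=
      ⟨_, _, _, eq_quadratic_of_degree_le_two hdeg⟩
    by_cases ha : a = 0
    · subst ha
      simp only [map_zero, zero_mul, zero_add] at hq ⊢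
      have h0 := hq 0 ⟨le_rfl, norm_nonneg _⟩
      simp only [eval_add, eval_mul, eval_C, eval_X, mul_zero, zero_add] at h0 hq
      have key : ∀ b c : ℝ, (∀ t ∈ Icc 0 ‖T‖, b * t + c ≠ 0) → 0 < c → 0 < b * ‖T‖ + c := by
        intro b c hq h0
        by_contra! hn
        have hb : b < 0 := by
          by_contra! hb
          nlinarith [norm_nonneg T, mul_nonneg hb (norm_nonneg T)]
        have hb' : b ≠ 0 := hb.ne
        refine hq (c / -b) ⟨by apply div_nonneg <;> linarith, ?_⟩ (by field_simp; ring)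
        rw [div_le_iff₀ (by linarith)]; linarith
      rcases lt_or_gt_of_ne h0 with h0 | h0
      · have := isUnit_polyOp_linear T hT (-b) (-c) (by linarith)
          (key (-b) (-c) (fun t ht h => hq t ht (by linarith)) (by linarith))
        have e : polyOp T (C (-b) * X + C (-c)) = - polyOp T (C b * X + C c) := by
          simp [polyOp, add_comm]
        rw [e] at this
        exact (IsUnit.neg_iff _).1 this
      · exact isUnit_polyOp_linear T hT b c h0 (key b c hq h0)
    · have hnr : ∀ t : ℝ, (C a * X ^ 2 + C b * X + C c : ℝ[X]).eval t ≠ 0 := by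
        intro t ht
        have h1 := degree_eq_one_of_irreducible_of_root hi ht
        rw [degree_quadratic ha] at h1
        exact absurd h1 (by decide)
      have hd : 0 < 4 * a * c - b ^ 2 := by
        by_contra! hn
        have hr := Real.sq_sqrt (show 0 ≤ b ^ 2 - 4 * a * c by linarith)
        generalize √(b ^ 2 - 4 * a * c) = r at hr
        apply hnr ((-b + r) / (2 * a))
        simp only [eval_add, eval_mul, eval_C, eval_X, eval_pow]
        have e : a * ((-b + r) / (2 * a)) ^ 2 + b * ((-b + r) / (2 * a)) + c
            = (r ^ 2 - (b ^ 2 - 4 * a * c)) / (4 * a) := by field_simp; ring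
        rw [e, hr, sub_self, zero_div]
      have e : (C a * X ^ 2 + C b * X + C c : ℝ[X]) = C (1 / (4 * a)) *
          ((C (2 * a) * X + C b) * (C (2 * a) * X + C b) + C (4 * a * c - b ^ 2)) := by
        apply Polynomial.funext
        intro t
        simp only [eval_add, eval_mul, eval_C, eval_X, eval_pow]
        field_simp
        ring
      rw [e, polyOp_mul]
      exact (isUnit_polyOp_C T (by positivity)).mul (isUnit_polyOp_quadratic T hT _ hd)

lemma norm_polyOp_le (T : H →L[𝕜] H) (hT : T.IsPositive) (p : ℝ[X]) {K : ℝ}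
    (hK : 0 ≤ K) (h : ∀ t ∈ Icc 0 ‖T‖, |p.eval t| ≤ K) : ‖polyOp T p‖ ≤ K := by
  cases subsingleton_or_nontrivial H
  · rw [Subsingleton.elim (polyOp T p) 0, norm_zero]; exact hK
  by_contra! hlt
  set S := polyOp T p with hS
  have h1 : algebraMap ℝ 𝕜 ‖S‖ ∈ resolventSet 𝕜 S := by
    rw [spectrum.mem_resolventSet_iff]
    have := isUnit_polyOp T hT (C ‖S‖ - p) (fun t ht => by
      have := abs_le.1 (h t ht); simp only [eval_sub, eval_C]; linarith)
    rwa [polyOp_sub, polyOp_C] at this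
  have h2 : -algebraMap ℝ 𝕜 ‖S‖ ∈ resolventSet 𝕜 S := by
    rw [spectrum.mem_resolventSet_iff]
    have := isUnit_polyOp T hT (C (-‖S‖) - p) (fun t ht => by
      have := abs_le.1 (h t ht); simp only [eval_sub, eval_C]; linarith)
    rw [polyOp_sub, polyOp_C] at this
    simpa using this
  obtain ⟨c, hc0, hc⟩ := S.abs_rayleighQuotient_le_of_norm_mem_resolventSet h1 h2
  have := S.norm_eq_iSup_rayleighQuotient (polyOp_isSelfAdjoint T hT p).isSymmetric
  have := ciSup_le hc
  linarith

/-- The functional calculus is well defined. -/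
theorem existsUnique_isFunctionOf (T : H →L[𝕜] H) (hT : T.IsPositive) (f : ℝ → ℝ)
    (hf : ContinuousOn f (Icc 0 ‖T‖)) : ∃! S, IsFunctionOf T f S := by
  have close : ∀ p q : ℝ[X], ∀ K : ℝ, 0 ≤ K → (∀ t ∈ Icc 0 ‖T‖, |p.eval t - q.eval t| ≤ K) →
      ‖polyOp T p - polyOp T q‖ ≤ K := fun p q K hK h => by
    rw [← polyOp_sub]
    exact norm_polyOp_le T hT _ hK (by simpa using h)
  have near : ∀ p : ℕ → ℝ[X],
      TendstoUniformlyOn (fun n t => (p n).eval t) f atTop (Icc 0 ‖T‖) → ∀ ε > 0,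
      ∃ N, ∀ n ≥ N, ∀ t ∈ Icc 0 ‖T‖, |(p n).eval t - f t| ≤ ε := by
    intro p hp ε hε
    obtain ⟨N, hN⟩ := eventually_atTop.1 (Metric.tendstoUniformlyOn_iff.1 hp ε hε)
    refine ⟨N, fun n hn t ht => ?_⟩
    have := hN n hn t ht
    rw [dist_comm, Real.dist_eq] at this
    exact this.le
  have hex : ∀ n : ℕ, ∃ p : ℝ[X], ∀ t ∈ Icc 0 ‖T‖, |p.eval t - f t| < 1 / ((n : ℝ) + 1) :=
    fun n => exists_polynomial_near_of_continuousOn 0 ‖T‖ f hf _ (by positivity)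
  choose p hp using hex
  have hpu : TendstoUniformlyOn (fun n t => (p n).eval t) f atTop (Icc 0 ‖T‖) := by
    rw [Metric.tendstoUniformlyOn_iff]
    intro ε hε
    have := tendsto_one_div_add_atTop_nhds_zero_nat (𝕜 := ℝ)
    filter_upwards [this.eventually (gt_mem_nhds hε)] with n hn t ht
    rw [dist_comm, Real.dist_eq]
    exact (hp n t ht).trans hn
  have hc : CauchySeq fun n => polyOp T (p n) := by
    rw [Metric.cauchySeq_iff']
    intro ε hε
    obtain ⟨N, hN⟩ := near p hpu (ε / 4) (by positivity)
    refine ⟨N, fun n hn => ?_⟩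
    rw [dist_eq_norm]
    refine (close _ _ (ε / 2) (by positivity) fun t ht => ?_).trans_lt (by linarith)
    have h1 := abs_le.1 (hN n hn t ht)
    have h2 := abs_le.1 (hN N le_rfl t ht)
    rw [abs_le]; constructor <;> linarith [h1.1, h1.2, h2.1, h2.2]
  obtain ⟨S, hS⟩ := cauchySeq_tendsto_of_complete hc
  refine ⟨S, ⟨p, hpu, hS⟩, ?_⟩
  rintro S' ⟨q, hqu, hS'⟩
  have hz : Tendsto (fun n => polyOp T (q n) - polyOp T (p n)) atTop (𝓝 0) := by
    rw [NormedAddGroup.tendsto_nhds_zero]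
    intro ε hε
    obtain ⟨N, hN⟩ := near p hpu (ε / 4) (by positivity)
    obtain ⟨N', hN'⟩ := near q hqu (ε / 4) (by positivity)
    filter_upwards [eventually_ge_atTop N, eventually_ge_atTop N'] with n hn hn'
    refine (close _ _ (ε / 2) (by positivity) fun t ht => ?_).trans_lt (by linarith)
    have h1 := abs_le.1 (hN n hn t ht)
    have h2 := abs_le.1 (hN' n hn' t ht)
    rw [abs_le]; constructor <;> linarith [h1.1, h1.2, h2.1, h2.2]
  exact sub_eq_zero.1 (tendsto_nhds_unique (hS'.sub hS) hz)

end WellDefined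

/-- The bounded operator `P ^ r` for a positive operator `P` and `r ≥ 0`. -/
noncomputable def posPow {𝕜 H : Type*} [RCLike 𝕜] [NormedAddCommGroup H] [InnerProductSpace 𝕜 H]
    (P : H →L[𝕜] H) (r : ℝ) : H →L[𝕜] H :=
  fc P fun t => t ^ r

open Classical in
/-- The power `P ^ r`, `r ∈ ℝ`, of an injective positive operator `P`: for `r ≥ 0` it is bounded and
everywhere defined, for `r < 0` it is the inverse of `P ^ (-r)`, with domain the range of
`P ^ (-r)`. -/
noncomputable def opPow {𝕜 H : Type*} [RCLike 𝕜] [NormedAddCommGroup H] [InnerProductSpace 𝕜 H]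
    (P : H →L[𝕜] H) (r : ℝ) : H →ₗ.[𝕜] H :=
  if 0 ≤ r then (posPow P r).toLinearMap.toPMap ⊤
  else ((posPow P (-r)).toLinearMap.toPMap ⊤).inverse

/-! ### Hilbert scales -/

/-- `L` is a densely defined, self-adjoint and strictly positive operator:
`‖x‖² ≤ θ (L x, x)` on the domain of `L`, for some `θ > 0`. -/
structure IsScaleGenerator {𝕜 X : Type*} [RCLike 𝕜] [NormedAddCommGroup X] [InnerProductSpace 𝕜 X]
    [CompleteSpace X] (L : X →ₗ.[𝕜] X) : Prop where
  dense : Dense (L.domain : Set X)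
  selfAdjoint : IsSelfAdjoint L
  strictlyPositive : ∃ θ : ℝ, 0 < θ ∧
    ∀ x : L.domain, ‖(x : X)‖ ^ 2 ≤ θ * RCLike.re (inner 𝕜 (L x) (x : X))

/-- The bounded inverse `L⁻¹ : X → X` of `L`, i.e. the bounded operator with `L⁻¹ (L x) = x`. -/
noncomputable def boundedInverse {𝕜 X : Type*} [RCLike 𝕜] [NormedAddCommGroup X]
    [InnerProductSpace 𝕜 X] [CompleteSpace X] (L : X →ₗ.[𝕜] X) : X →L[𝕜] X :=
  L.domain.subtype.extendOfNorm L.toFun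

/-- The bounded operator `L ^ (-r)` for `r ≥ 0`. In particular `‖h‖_{-r} = ‖scaleNegPow L r h‖` for
`h ∈ X`. -/
noncomputable def scaleNegPow {𝕜 X : Type*} [RCLike 𝕜] [NormedAddCommGroup X]
    [InnerProductSpace 𝕜 X] [CompleteSpace X] (L : X →ₗ.[𝕜] X) (r : ℝ) : X →L[𝕜] X :=
  posPow (boundedInverse L) r

/-- The operator `L ^ r = (L⁻¹) ^ (-r)` in `X`, for `r ∈ ℝ`. For `r ≥ 0` its domain is the space
`X_r` of the Hilbert scale, with norm `‖h‖_r = ‖L ^ r h‖`. -/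
noncomputable def scalePow {𝕜 X : Type*} [RCLike 𝕜] [NormedAddCommGroup X]
    [InnerProductSpace 𝕜 X] [CompleteSpace X] (L : X →ₗ.[𝕜] X) (r : ℝ) : X →ₗ.[𝕜] X :=
  opPow (boundedInverse L) (-r)

section Inverse

variable {𝕜 X : Type*} [RCLike 𝕜] [NormedAddCommGroup X] [InnerProductSpace 𝕜 X] [CompleteSpace X]

lemma IsScaleGenerator.exists_norm_le {L : X →ₗ.[𝕜] X} (hL : IsScaleGenerator L) :
    ∃ θ, ∀ x : L.domain, ‖(x : X)‖ ≤ θ * ‖L x‖ := by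
  obtain ⟨θ, hθ, h⟩ := hL.strictlyPositive
  refine ⟨θ, fun x => ?_⟩
  have h1 : RCLike.re (inner 𝕜 (L x) (x : X)) ≤ ‖L x‖ * ‖(x : X)‖ := re_inner_le_norm _ _
  have h2 := h x
  rcases (norm_nonneg (x : X)).eq_or_lt with h0 | h0
  · rw [← h0]; positivity
  · nlinarith

lemma IsScaleGenerator.denseRange {L : X →ₗ.[𝕜] X} (hL : IsScaleGenerator L) :
    DenseRange L.toFun := by
  have : (LinearMap.range L.toFun).topologicalClosure = ⊤ := by
    rw [Submodule.topologicalClosure_eq_top_iff, Submodule.eq_bot_iff]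
    intro y hy
    have h0 : ∀ x : L.domain, inner 𝕜 (0 : X) (x : X) = inner 𝕜 y (L x) := fun x => by
      rw [inner_zero_left]
      exact (Submodule.inner_left_of_mem_orthogonal (LinearMap.mem_range_self L.toFun x) hy).symm
    have hy' : y ∈ L.adjoint.domain := LinearPMap.mem_adjoint_domain_of_exists y ⟨0, h0⟩
    have hz : L.adjoint ⟨y, hy'⟩ = 0 := LinearPMap.adjoint_apply_eq hL.dense _ h0
    have hsa : L.adjoint = L := hL.selfAdjoint
    obtain ⟨θ, hθ⟩ := hL.exists_norm_le
    have : ∀ A : X →ₗ.[𝕜] X, A = L → ∀ h : y ∈ A.domain, A ⟨y, h⟩ = 0 → y = 0 := by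
      rintro A rfl h hA
      have := hθ ⟨y, h⟩
      rw [hA, norm_zero, mul_zero] at this
      exact norm_le_zero_iff.1 this
    exact this _ hsa hy' hz
  have h2 := (Submodule.dense_iff_topologicalClosure_eq_top).2 this
  exact h2

theorem IsScaleGenerator.boundedInverse_apply {L : X →ₗ.[𝕜] X} (hL : IsScaleGenerator L)
    (x : L.domain) : boundedInverse L (L x) = x :=
  LinearMap.extendOfNorm_eq hL.denseRange hL.exists_norm_le x

end Inverse

/-- `U ∘ V` is defined on all of `Y` and is bounded, with operator norm at most `c`, where `V` is
bounded and `U` is possibly unbounded. -/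
def CompNormLE {𝕜 X Y : Type*} [RCLike 𝕜] [NormedAddCommGroup X] [InnerProductSpace 𝕜 X]
    [NormedAddCommGroup Y] [InnerProductSpace 𝕜 Y] (U : X →ₗ.[𝕜] X) (V : Y →L[𝕜] X) (c : ℝ) :
    Prop :=
  ∀ w : Y, ∃ hw : V w ∈ U.domain, ‖U ⟨V w, hw⟩‖ ≤ c * ‖w‖

/-- The bounded operator `T L ^ (-s) : X → Y`, i.e. the continuous extension to `X` of
`h ↦ T (L ^ (-s) h)`, `h ∈ D(L ^ (-s))`. (An extension is needed only for `s < 0`.) -/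
noncomputable def scaledOperator {𝕜 X Y : Type*} [RCLike 𝕜] [NormedAddCommGroup X]
    [InnerProductSpace 𝕜 X] [CompleteSpace X] [NormedAddCommGroup Y] [InnerProductSpace 𝕜 Y]
    [CompleteSpace Y] (L : X →ₗ.[𝕜] X) (s : ℝ) (T : X →L[𝕜] Y) : X →L[𝕜] Y :=
  (T.toLinearMap ∘ₗ (scalePow L (-s)).toFun).extendOfNorm (scalePow L (-s)).domain.subtype

/-! ### Conditions on the filter functions -/

/-- A closed contour: a closed piecewise `C¹` curve `γ : [0, 1] → ℂ`. -/
def IsClosedContour (γ : ℝ → ℂ) : Prop :=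
  γ 0 = γ 1 ∧ ∃ (N : ℕ) (t : ℕ → ℝ), Monotone t ∧ t 0 = 0 ∧ t N = 1 ∧
    ∀ i < N, ContDiffOn ℝ 1 γ (Icc (t i) (t (i + 1)))

/-- The winding number of the closed contour `γ` about `w`. -/
noncomputable def windingNumber (γ : ℝ → ℂ) (w : ℂ) : ℂ :=
  (2 * Real.pi * Complex.I)⁻¹ * ∫ t in (0 : ℝ)..1, deriv γ t / (γ t - w)

/-- The residual function `r_α(λ) = 1 - λ g_α(λ)`. -/
def residual (g : ℝ → ℝ → ℝ) (α : ℝ) (t : ℝ) : ℝ :=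
  1 - t * g α t

/-- The analyticity condition on `g_α`: for each `α > 0`, `φ_α(λ) = g_α(λ) - 1 / (α + λ)` extends
from `[0, 1]` to an analytic function `Φ` on a domain `D ⊇ [0, 1]`, and `D` contains a closed contour
`γ`, which encloses `[0, 1]` (once, and no point outside `D`), with `|z| ≥ α / 2` and
`(|z| + λ) / |z - λ| ≤ b₀` for `z` on `γ` and `λ ∈ [0, 1]`, and with `∫_γ |φ_α(z)| |dz| ≤ b₁` for
`α ≤ c₁`. -/
def AnalyticFilter (g : ℝ → ℝ → ℝ) (c₁ b₀ b₁ : ℝ) : Prop :=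
  ∀ α : ℝ, 0 < α → ∃ (D : Set ℂ) (Φ : ℂ → ℂ) (γ : ℝ → ℂ),
    IsOpen D ∧ IsConnected D ∧ (∀ l ∈ Icc (0 : ℝ) 1, (l : ℂ) ∈ D) ∧
    DifferentiableOn ℂ Φ D ∧
    (∀ l ∈ Icc (0 : ℝ) 1, Φ (l : ℂ) = ((g α l - 1 / (α + l) : ℝ) : ℂ)) ∧
    IsClosedContour γ ∧ (∀ t ∈ Icc (0 : ℝ) 1, γ t ∈ D) ∧
    (∀ l ∈ Icc (0 : ℝ) 1, windingNumber γ (l : ℂ) = 1) ∧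
    (∀ w ∉ D, windingNumber γ w = 0) ∧
    (∀ t ∈ Icc (0 : ℝ) 1, α / 2 ≤ ‖γ t‖ ∧
      ∀ l ∈ Icc (0 : ℝ) 1, ‖γ t‖ + l ≤ b₀ * ‖γ t - (l : ℂ)‖) ∧
    (α ≤ c₁ → ∫ t in (0 : ℝ)..1, ‖Φ (γ t)‖ * ‖deriv γ t‖ ≤ b₁)

/-- `stepSum α n = ∑_{i < n} 1 / α_i`, which is `s_{n-1}`; so `s_n - s_{j-1}` is
`stepSum α (n + 1) - stepSum α j`. -/
noncomputable def stepSum (α : ℕ → ℝ) (n : ℕ) : ℝ :=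
  ∑ i ∈ Finset.range n, 1 / α i

/-- The condition on `g_α` along the sequence `α_0, α_1, …`. -/
def FilterDecay (g : ℝ → ℝ → ℝ) (α : ℕ → ℝ) (b₂ : ℝ) : Prop :=
  ∀ n j : ℕ, j ≤ n → ∀ ν ∈ Icc (0 : ℝ) 1, ∀ l ∈ Icc (0 : ℝ) 1,
    (0 ≤ l ^ ν * ∏ k ∈ Finset.Icc j n, residual g (α k) l ∧
      l ^ ν * ∏ k ∈ Finset.Icc j n, residual g (α k) l
        ≤ (stepSum α (n + 1) - stepSum α j) ^ (-ν)) ∧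
    (0 ≤ l ^ ν * g (α j) l * ∏ k ∈ Finset.Icc (j + 1) n, residual g (α k) l ∧
      l ^ ν * g (α j) l * ∏ k ∈ Finset.Icc (j + 1) n, residual g (α k) l
        ≤ b₂ * (1 / α j) * (stepSum α (n + 1) - stepSum α j) ^ (-ν))

/-! ### The condition on the nonlinear operator -/

/-- The structure condition on `F` in the ball `B_ρ(x†)`, where `F'(x)` is the Fréchet derivative:
`F` is differentiable there, and for all `x` in the ball
(a) `m ‖h‖_{-a} ≤ ‖F'(x) h‖ ≤ M ‖h‖_{-a}` for `h ∈ X`;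
(b) `‖F'(x) L ^ (-s)‖ ≤ min {1, √α₀}`;
(c) `‖F'(x)* - F'(x†)*‖_{Y → X_b} ≤ K₀ ‖x - x†‖ ^ β`. -/
structure OperatorCondition {𝕜 X Y : Type*} [RCLike 𝕜] [NormedAddCommGroup X]
    [InnerProductSpace 𝕜 X] [CompleteSpace X] [NormedAddCommGroup Y] [InnerProductSpace 𝕜 Y]
    [CompleteSpace Y] (L : X →ₗ.[𝕜] X) (F : X → Y) (xd : X) (ρ a b s m M β K₀ α₀ : ℝ) : Prop where
  differentiable : ∀ x ∈ Metric.ball xd ρ, DifferentiableAt 𝕜 F x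
  lower : ∀ x ∈ Metric.ball xd ρ, ∀ h : X, m * ‖scaleNegPow L a h‖ ≤ ‖fderiv 𝕜 F x h‖
  upper : ∀ x ∈ Metric.ball xd ρ, ∀ h : X, ‖fderiv 𝕜 F x h‖ ≤ M * ‖scaleNegPow L a h‖
  scaled : ∀ x ∈ Metric.ball xd ρ, ‖scaledOperator L s (fderiv 𝕜 F x)‖ ≤ min 1 √α₀
  holder : ∀ x ∈ Metric.ball xd ρ,
    CompNormLE (scalePow L b) ((fderiv 𝕜 F x).adjoint - (fderiv 𝕜 F xd).adjoint)
      (K₀ * ‖x - xd‖ ^ β)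

/-- The product `∏_{k=j+1}^n r_{α_k}(P)` of (commuting) functions of the positive operator `P`. -/
noncomputable def residualProd {𝕜 X : Type*} [RCLike 𝕜] [NormedAddCommGroup X]
    [InnerProductSpace 𝕜 X] (g : ℝ → ℝ → ℝ) (α : ℕ → ℝ) (j n : ℕ) (P : X →L[𝕜] X) : X →L[𝕜] X :=
  ((List.Ico (j + 1) (n + 1)).map fun k => fc P (residual g (α k))).prod

/-- The term `∏_{k=j+1}^n r_{α_k}(A*A) [g_{α_j}(A*A) A* - g_{α_j}(B*B) B*]`. -/
noncomputable def perturbation {𝕜 X Y : Type*} [RCLike 𝕜] [NormedAddCommGroup X]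
    [InnerProductSpace 𝕜 X] [CompleteSpace X] [NormedAddCommGroup Y] [InnerProductSpace 𝕜 Y]
    [CompleteSpace Y] (g : ℝ → ℝ → ℝ) (α : ℕ → ℝ) (j n : ℕ) (A B : X →L[𝕜] Y) : Y →L[𝕜] X :=
  residualProd g α j n (A.adjoint ∘L A) ∘L
    (fc (A.adjoint ∘L A) (g (α j)) ∘L A.adjoint - fc (B.adjoint ∘L B) (g (α j)) ∘L B.adjoint)

end InexactNewton

/-! Write S = A*A, B = A_x, D = A - B, μ = (b+s)/(2(a+s)), σ = s_n - s_{j-1}, α = α_j, and R for the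
product of the residual functions.

Condition (a) makes ‖S^{1/2} x‖ = ‖Ax‖ equivalent to ‖L^{-(a+s)} x‖. By the Löwner-Heinz inequality
(`norm_fc_rpow_le`) powers of S are then comparable with powers of L, and the same holds for B*B.
Condition (c) thereby becomes ‖D S^{-μ}‖ ≤ κ and ‖D (B*B)^{-μ}‖ ≤ κ, with κ a constant times K₀‖x -
x†‖^β (`weightedBound_scaledOperator_sub`).

The operator is estimated through its adjoint (A g(S) - g(BB*) B) R(S) S^ν. If g is the resolvent
function 1/(z - λ), the bracket equals (z - BB*)⁻¹ (z D + B D* A) (z - S)⁻¹. In the term with zD,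
the resolvent of BB* absorbs |z| and D is traded for S^μ, leaving S^{ν+μ} R(S) (z - S)⁻¹ = O(α⁻¹
σ^{-(ν+μ)}). In the term with B D* A, the outer factors supply half powers: the left part is
O(α^{μ-1/2}), hence O(σ^{1/2-μ}), and the right part is O(α⁻¹ σ^{-(ν+1/2)}), so the product has the
same order. These bounds are uniform in z on the contour (`norm_resolvent_difference_le`).

Finally g_α = 1/(α+λ) + φ_α. The first summand is minus the resolvent function at z = -α; the second
is, by Cauchy's formula (`IsClosedContour.integral_div_sub`), a superposition of resolvent functions
whose total weight is at most b₁/(2π) (`abs_apply_le_of_contour`).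

Two devices shape the statements. Negative powers are avoided: bounds are written with positive and
negative parts of exponents, and Douglas' lemma (`exists_eq_apply_of_norm_adjoint_le`) recovers the
unbounded power at the end. Since the scalars may be real, a complex resolvent is represented by its
real and imaginary parts. -/

namespace InexactNewton

/-! ### Algebra, norm bounds and monotonicity of the continuous functional calculus. -/

section FunctionalCalculus

variable {𝕜 H : Type*} [RCLike 𝕜] [NormedAddCommGroup H] [InnerProductSpace 𝕜 H]

lemma polyOp_add (T : H →L[𝕜] H) (p q : ℝ[X]) : polyOp T (p + q) = polyOp T p + polyOp T q := by
  simp [polyOp]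

lemma polyOp_X (T : H →L[𝕜] H) : polyOp T X = T := by
  simp [polyOp]

lemma polyOp_one (T : H →L[𝕜] H) : polyOp T 1 = 1 := by
  simp [polyOp]

lemma polyOp_C_mul (T : H →L[𝕜] H) (c : ℝ) (p : ℝ[X]) :
    polyOp T (C c * p) = (c : 𝕜) • polyOp T p := by
  rw [polyOp_mul, polyOp_C, Algebra.smul_def]

lemma IsFunctionOf.congr {T S : H →L[𝕜] H} {f g : ℝ → ℝ} (h : IsFunctionOf T f S)
    (hfg : EqOn f g (Icc 0 ‖T‖)) : IsFunctionOf T g S := by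
  obtain ⟨p, hp, hS⟩ := h
  exact ⟨p, hp.congr_right hfg, hS⟩

lemma isFunctionOf_polyOp (T : H →L[𝕜] H) (p : ℝ[X]) :
    IsFunctionOf T (fun t => p.eval t) (polyOp T p) :=
  ⟨fun _ => p, fun _ hu => Eventually.of_forall fun _ _ _ => refl_mem_uniformity hu,
    tendsto_const_nhds⟩

lemma IsFunctionOf.add {T S R : H →L[𝕜] H} {f g : ℝ → ℝ} (hf : IsFunctionOf T f S)
    (hg : IsFunctionOf T g R) : IsFunctionOf T (fun t => f t + g t) (S + R) := by
  obtain ⟨p, hp, hS⟩ := hf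
  obtain ⟨q, hq, hR⟩ := hg
  refine ⟨fun n => p n + q n, ?_, ?_⟩
  · have := hp.add hq
    refine this.congr (Eventually.of_forall fun n t _ => ?_)
    simp
  · simpa only [polyOp_add] using hS.add hR

lemma IsFunctionOf.const_mul {T S : H →L[𝕜] H} {f : ℝ → ℝ} (hf : IsFunctionOf T f S) (c : ℝ) :
    IsFunctionOf T (fun t => c * f t) ((c : 𝕜) • S) := by
  obtain ⟨p, hp, hS⟩ := hf
  refine ⟨fun n => C c * p n, ?_, ?_⟩
  · have := (uniformContinuous_const_smul c).comp_tendstoUniformlyOn hp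
    refine this.congr (Eventually.of_forall fun n t _ => ?_)
    simp
  · simpa only [polyOp_C_mul] using hS.const_smul (c : 𝕜)

lemma tendstoUniformlyOn_mul_of_bounded {β : Type*} {u v : ℕ → β → ℝ} {f g : β → ℝ} {s : Set β}
    {M : ℝ} (hf : ∀ t ∈ s, |f t| ≤ M) (hg : ∀ t ∈ s, |g t| ≤ M)
    (hu : TendstoUniformlyOn u f atTop s) (hv : TendstoUniformlyOn v g atTop s) :
    TendstoUniformlyOn (fun n t => u n t * v n t) (fun t => f t * g t) atTop s := by
  rcases s.eq_empty_or_nonempty with rfl | ⟨t₀, ht₀⟩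
  · exact tendstoUniformlyOn_empty
  have hM : 0 ≤ M := (abs_nonneg _).trans (hf t₀ ht₀)
  rw [Metric.tendstoUniformlyOn_iff] at hu hv ⊢
  intro ε hε
  -- The error is at most M δ + δ (M + 1) < δ (2M + 2); δ ≤ 1 is what gives |v n t| ≤ M + 1.
  have hδ : 0 < min 1 (ε / (2 * M + 2)) := lt_min one_pos (by positivity)
  filter_upwards [hu _ hδ, hv _ hδ] with n hun hvn t ht
  have h1 := hun t ht
  have h2 := hvn t ht
  rw [Real.dist_eq] at h1 h2 ⊢
  set δ := min 1 (ε / (2 * M + 2)) with hδd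
  have h3 : δ * (2 * M + 2) ≤ ε := by
    rw [← le_div_iff₀ (by positivity)]; exact min_le_right _ _
  have h4 : δ ≤ 1 := min_le_left _ _
  have hv' : |v n t| ≤ M + 1 := by
    have := abs_sub_abs_le_abs_sub (v n t) (g t)
    rw [abs_sub_comm] at this
    linarith [hg t ht]
  calc |f t * g t - u n t * v n t| = |f t * (g t - v n t) + (f t - u n t) * v n t| := by ring_nf
    _ ≤ |f t| * |g t - v n t| + |f t - u n t| * |v n t| := by
        rw [← abs_mul, ← abs_mul]; exact abs_add_le _ _
    _ ≤ M * δ + δ * (M + 1) := by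
        gcongr
        exact hf t ht
    _ < ε := by nlinarith

lemma IsFunctionOf.mul {T S R : H →L[𝕜] H} {f g : ℝ → ℝ}
    (hfc : ContinuousOn f (Icc 0 ‖T‖)) (hgc : ContinuousOn g (Icc 0 ‖T‖))
    (hf : IsFunctionOf T f S) (hg : IsFunctionOf T g R) :
    IsFunctionOf T (fun t => f t * g t) (S * R) := by
  obtain ⟨p, hp, hS⟩ := hf
  obtain ⟨q, hq, hR⟩ := hg
  obtain ⟨M₁, hM₁⟩ := isCompact_Icc.exists_bound_of_continuousOn hfc
  obtain ⟨M₂, hM₂⟩ := isCompact_Icc.exists_bound_of_continuousOn hgc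
  refine ⟨fun n => p n * q n, ?_, ?_⟩
  · have := tendstoUniformlyOn_mul_of_bounded (M := max M₁ M₂)
      (fun t ht => (hM₁ t ht).trans (le_max_left _ _))
      (fun t ht => (hM₂ t ht).trans (le_max_right _ _)) hp hq
    refine this.congr (Eventually.of_forall fun n t _ => ?_)
    simp
  · simpa only [polyOp_mul] using hS.mul hR

lemma fc_congr {T : H →L[𝕜] H} {f g : ℝ → ℝ} (h : EqOn f g (Icc 0 ‖T‖)) : fc T f = fc T g := by
  have hS : ∀ S, IsFunctionOf T f S ↔ IsFunctionOf T g S := fun S =>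
    ⟨fun hS => hS.congr h, fun hS => hS.congr h.symm⟩
  have : IsFunctionOf T f = IsFunctionOf T g := funext fun S => propext (hS S)
  unfold fc
  rw [this]

variable [CompleteSpace H] {T : H →L[𝕜] H} {f g : ℝ → ℝ}

lemma isFunctionOf_fc (hT : T.IsPositive) (hf : ContinuousOn f (Icc 0 ‖T‖)) :
    IsFunctionOf T f (fc T f) := by
  have h := (existsUnique_isFunctionOf T hT f hf).exists
  rw [fc, dif_pos h]
  exact h.choose_spec

lemma IsFunctionOf.fc_eq {S : H →L[𝕜] H} (h : IsFunctionOf T f S) (hT : T.IsPositive)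
    (hf : ContinuousOn f (Icc 0 ‖T‖)) : fc T f = S :=
  (existsUnique_isFunctionOf T hT f hf).unique (isFunctionOf_fc hT hf) h

lemma fc_add (hT : T.IsPositive) (hf : ContinuousOn f (Icc 0 ‖T‖))
    (hg : ContinuousOn g (Icc 0 ‖T‖)) : fc T (fun t => f t + g t) = fc T f + fc T g :=
  ((isFunctionOf_fc hT hf).add (isFunctionOf_fc hT hg)).fc_eq hT (hf.add hg)

lemma fc_mul (hT : T.IsPositive) (hf : ContinuousOn f (Icc 0 ‖T‖))
    (hg : ContinuousOn g (Icc 0 ‖T‖)) : fc T (fun t => f t * g t) = fc T f * fc T g :=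
  ((isFunctionOf_fc hT hf).mul hf hg (isFunctionOf_fc hT hg)).fc_eq hT (hf.mul hg)

lemma fc_mul_apply (hT : T.IsPositive) (hf : ContinuousOn f (Icc 0 ‖T‖))
    (hg : ContinuousOn g (Icc 0 ‖T‖)) (x : H) :
    fc T (fun t => f t * g t) x = fc T f (fc T g x) := by
  rw [fc_mul hT hf hg]; rfl

lemma fc_const_mul (hT : T.IsPositive) (c : ℝ) (hf : ContinuousOn f (Icc 0 ‖T‖)) :
    fc T (fun t => c * f t) = (c : 𝕜) • fc T f :=
  ((isFunctionOf_fc hT hf).const_mul c).fc_eq hT (continuousOn_const.mul hf)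

lemma fc_neg (hT : T.IsPositive) (hf : ContinuousOn f (Icc 0 ‖T‖)) :
    fc T (fun t => -f t) = -fc T f := by
  simpa using fc_const_mul hT (-1) hf

lemma fc_sub (hT : T.IsPositive) (hf : ContinuousOn f (Icc 0 ‖T‖))
    (hg : ContinuousOn g (Icc 0 ‖T‖)) : fc T (fun t => f t - g t) = fc T f - fc T g := by
  rw [sub_eq_add_neg, ← fc_neg hT hg]
  exact fc_add hT hf hg.neg

lemma fc_eval (hT : T.IsPositive) (p : ℝ[X]) : fc T (fun t => p.eval t) = polyOp T p :=
  (isFunctionOf_polyOp T p).fc_eq hT p.continuousOn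

lemma fc_one (hT : T.IsPositive) : fc T (fun _ => 1) = 1 := by
  simpa [polyOp_one] using fc_eval hT 1

lemma fc_id (hT : T.IsPositive) : fc T (fun t => t) = T := by
  simpa [polyOp_X] using fc_eval hT X

lemma fc_pow (hT : T.IsPositive) (n : ℕ) : fc T (fun t => t ^ n) = T ^ n := by
  simpa [polyOp, Polynomial.map_pow] using fc_eval hT (X ^ n)

lemma norm_fc_le (hT : T.IsPositive) (hf : ContinuousOn f (Icc 0 ‖T‖)) {K : ℝ} (hK : 0 ≤ K)
    (h : ∀ t ∈ Icc 0 ‖T‖, |f t| ≤ K) : ‖fc T f‖ ≤ K := by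
  obtain ⟨p, hp, hS⟩ := isFunctionOf_fc hT hf
  refine le_of_forall_pos_le_add fun ε hε => ?_
  refine le_of_tendsto hS.norm ?_
  filter_upwards [Metric.tendstoUniformlyOn_iff.1 hp ε hε] with n hn
  refine norm_polyOp_le T hT (p n) (by positivity) fun t ht => ?_
  have h1 := hn t ht
  rw [dist_comm, Real.dist_eq] at h1
  have := abs_sub_abs_le_abs_sub ((p n).eval t) (f t)
  linarith [h t ht]

lemma isSelfAdjoint_fc (hT : T.IsPositive) (f : ℝ → ℝ) : IsSelfAdjoint (fc T f) := by
  by_cases h : ∃ S, IsFunctionOf T f S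
  · obtain ⟨p, -, hS⟩ : IsFunctionOf T f (fc T f) := by rw [fc, dif_pos h]; exact h.choose_spec
    have : Tendsto (fun n => star (polyOp T (p n))) atTop (𝓝 (star (fc T f))) := hS.star
    refine tendsto_nhds_unique this ?_
    simpa only [(polyOp_isSelfAdjoint T hT _).star_eq] using hS
  · rw [fc, dif_neg h]; exact IsSelfAdjoint.zero _

lemma adjoint_fc (hT : T.IsPositive) (f : ℝ → ℝ) : (fc T f).adjoint = fc T f :=
  isSelfAdjoint_fc hT f

lemma inner_fc_left (hT : T.IsPositive) (f : ℝ → ℝ) (x y : H) :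
    inner 𝕜 (fc T f x) y = inner 𝕜 x (fc T f y) :=
  (isSelfAdjoint_fc hT f).isSymmetric x y

lemma tendsto_fc (hT : T.IsPositive) {ι : Type*} {l : Filter ι} {u : ι → ℝ → ℝ}
    (hu : ∀ᶠ i in l, ContinuousOn (u i) (Icc 0 ‖T‖)) (hf : ContinuousOn f (Icc 0 ‖T‖))
    (h : TendstoUniformlyOn u f l (Icc 0 ‖T‖)) : Tendsto (fun i => fc T (u i)) l (𝓝 (fc T f)) := by
  rw [Metric.tendsto_nhds]
  intro ε hε
  filter_upwards [hu, Metric.tendstoUniformlyOn_iff.1 h (ε / 2) (by positivity)] with i hi hn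
  rw [dist_eq_norm, ← fc_sub hT hi hf]
  refine (norm_fc_le hT (hi.sub hf) (by positivity) fun t ht => ?_).trans_lt (half_lt_self hε)
  have h1 := hn t ht
  rw [dist_comm, Real.dist_eq] at h1
  exact h1.le

lemma norm_fc_apply_sq (hT : T.IsPositive) (hf : ContinuousOn f (Icc 0 ‖T‖)) (x : H) :
    ‖fc T f x‖ ^ 2 = RCLike.re (inner 𝕜 (fc T (fun t => f t * f t) x) x) := by
  rw [fc_mul_apply hT hf hf, inner_fc_left hT, inner_self_eq_norm_sq]

/-- The functional calculus is monotone in the modulus of the function. -/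
lemma norm_fc_apply_le (hT : T.IsPositive) (hf : ContinuousOn f (Icc 0 ‖T‖))
    (hg : ContinuousOn g (Icc 0 ‖T‖)) (h : ∀ t ∈ Icc 0 ‖T‖, |f t| ≤ |g t|) (x : H) :
    ‖fc T f x‖ ≤ ‖fc T g x‖ := by
  -- With h = √(g² - f²), the difference ‖g(T)x‖² - ‖f(T)x‖² equals ‖h(T)x‖², hence is nonnegative.
  have hk : ContinuousOn (fun t => √(g t * g t - f t * f t)) (Icc 0 ‖T‖) :=
    ((hg.mul hg).sub (hf.mul hf)).sqrt
  have h1 := norm_fc_apply_sq hT hk x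
  have h2 : fc T (fun t => √(g t * g t - f t * f t) * √(g t * g t - f t * f t))
      = fc T (fun t => g t * g t) - fc T (fun t => f t * f t) := by
    rw [← fc_sub (f := fun t => g t * g t) (g := fun t => f t * f t) hT (hg.mul hg) (hf.mul hf)]
    refine fc_congr fun t ht => Real.mul_self_sqrt ?_
    have := sq_le_sq.2 (h t ht)
    nlinarith
  rw [h2, sub_apply, inner_sub_left, map_sub, ← norm_fc_apply_sq hT hf,
    ← norm_fc_apply_sq hT hg] at h1
  have h3 : ‖fc T f x‖ ^ 2 ≤ ‖fc T g x‖ ^ 2 := by nlinarith [sq_nonneg ‖fc T (fun t => √(g t * g t - f t * f t)) x‖]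
  exact le_of_sq_le_sq h3 (norm_nonneg _)

lemma norm_fc_apply_le_mul (hT : T.IsPositive) (hf : ContinuousOn f (Icc 0 ‖T‖))
    (hg : ContinuousOn g (Icc 0 ‖T‖)) {c : ℝ} (hc : 0 ≤ c)
    (h : ∀ t ∈ Icc 0 ‖T‖, |f t| ≤ c * |g t|) (x : H) :
    ‖fc T f x‖ ≤ c * ‖fc T g x‖ := by
  have := norm_fc_apply_le hT hf (continuousOn_const.mul hg)
    (fun t ht => by rw [abs_mul, abs_of_nonneg hc]; exact h t ht) x (g := fun t => c * g t)
  rwa [fc_const_mul hT c hg, smul_apply, norm_smul, RCLike.norm_ofReal,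
    abs_of_nonneg hc] at this

end FunctionalCalculus

/-! ### Passing between A*A and AA*. -/

section Intertwining

variable {𝕜 X Y : Type*} [RCLike 𝕜] [NormedAddCommGroup X] [InnerProductSpace 𝕜 X]
  [CompleteSpace X] [NormedAddCommGroup Y] [InnerProductSpace 𝕜 Y] [CompleteSpace Y]

lemma norm_adjoint_comp_self (A : X →L[𝕜] Y) : ‖A.adjoint ∘L A‖ = ‖A‖ ^ 2 := by
  rw [ContinuousLinearMap.norm_adjoint_comp_self, sq]

lemma norm_self_comp_adjoint (A : X →L[𝕜] Y) : ‖A ∘L A.adjoint‖ = ‖A‖ ^ 2 := by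
  simpa using norm_adjoint_comp_self A.adjoint

lemma isPositive_adjoint_comp_self (A : X →L[𝕜] Y) : (A.adjoint ∘L A).IsPositive :=
  ContinuousLinearMap.isPositive_adjoint_comp_self A

lemma isPositive_self_comp_adjoint (A : X →L[𝕜] Y) : (A ∘L A.adjoint).IsPositive :=
  ContinuousLinearMap.isPositive_self_comp_adjoint A

lemma comp_polyOp_adjoint_comp_self (A : X →L[𝕜] Y) (p : ℝ[X]) :
    A ∘L polyOp (A.adjoint ∘L A) p = polyOp (A ∘L A.adjoint) p ∘L A := by
  induction p using Polynomial.induction_on' with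
  | add p q hp hq => rw [polyOp_add, polyOp_add, ContinuousLinearMap.comp_add, hp, hq,
      ContinuousLinearMap.add_comp]
  | monomial n c =>
    have hp : A ∘L ((A.adjoint ∘L A) ^ n) = ((A ∘L A.adjoint) ^ n) ∘L A := by
      induction n with
      | zero => rfl
      | succ n ih =>
        rw [pow_succ, pow_succ, ContinuousLinearMap.mul_def, ContinuousLinearMap.mul_def,
          ← ContinuousLinearMap.comp_assoc, ih]
        rfl
    rw [← C_mul_X_pow_eq_monomial, polyOp_C_mul, polyOp_C_mul, ContinuousLinearMap.comp_smul,
      ContinuousLinearMap.smul_comp]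
    simpa [polyOp] using congrArg ((c : 𝕜) • ·) hp

/-- `A f(A*A) = f(AA*) A`. -/
lemma comp_fc_adjoint_comp_self (A : X →L[𝕜] Y) {f : ℝ → ℝ}
    (hf : ContinuousOn f (Icc 0 (‖A‖ ^ 2))) :
    A ∘L fc (A.adjoint ∘L A) f = fc (A ∘L A.adjoint) f ∘L A := by
  have hf1 : ContinuousOn f (Icc 0 ‖A.adjoint ∘L A‖) := by rwa [norm_adjoint_comp_self]
  obtain ⟨p, hp, hS⟩ := isFunctionOf_fc (isPositive_adjoint_comp_self A) hf1
  -- Since ‖A*A‖ = ‖A‖² = ‖AA*‖, the same polynomials approximate f on both intervals.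
  rw [norm_adjoint_comp_self, ← norm_self_comp_adjoint] at hp hf1
  have h2 : Tendsto (fun n => polyOp (A ∘L A.adjoint) (p n)) atTop
      (𝓝 (fc (A ∘L A.adjoint) f)) := by
    have := tendsto_fc (isPositive_self_comp_adjoint A)
      (Eventually.of_forall fun n => (p n).continuousOn) hf1 hp
    simpa only [fc_eval (isPositive_self_comp_adjoint A)] using this
  have h3 := ((ContinuousLinearMap.compL 𝕜 X X Y A).continuous.tendsto _).comp hS
  have h4 := (((ContinuousLinearMap.compL 𝕜 X Y Y).flip A).continuous.tendsto _).comp h2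
  refine tendsto_nhds_unique h3 (h4.congr fun n => ?_)
  simp [comp_polyOp_adjoint_comp_self]

/-- The norm form of the polar decomposition: both squares equal ⟨A*A x, x⟩. It lets A be replaced
by a function of A*A whenever only norms matter. -/
lemma norm_fc_sqrt_apply (A : X →L[𝕜] Y) (x : X) :
    ‖fc (A.adjoint ∘L A) (fun t => √t) x‖ = ‖A x‖ := by
  have hT := isPositive_adjoint_comp_self A
  have h1 := norm_fc_apply_sq hT Real.continuous_sqrt.continuousOn x
  have h2 : fc (A.adjoint ∘L A) (fun t => √t * √t) = A.adjoint ∘L A := by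
    conv_rhs => rw [← fc_id hT]
    exact fc_congr fun t ht => Real.mul_self_sqrt ht.1
  rw [h2, ContinuousLinearMap.comp_apply, ContinuousLinearMap.adjoint_inner_left,
    inner_self_eq_norm_sq] at h1
  exact (sq_eq_sq₀ (norm_nonneg _) (norm_nonneg _)).1 h1

/-- `‖A f(A*A) x‖ = ‖(A*A)^{1/2} f(A*A) x‖`. -/
lemma norm_apply_fc (A : X →L[𝕜] Y) {f : ℝ → ℝ} (hf : ContinuousOn f (Icc 0 (‖A‖ ^ 2))) (x : X) :
    ‖A (fc (A.adjoint ∘L A) f x)‖ = ‖fc (A.adjoint ∘L A) (fun t => √t * f t) x‖ := by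
  rw [← norm_fc_sqrt_apply, fc_mul_apply (isPositive_adjoint_comp_self A)
    Real.continuous_sqrt.continuousOn (by rwa [norm_adjoint_comp_self])]

end Intertwining

/-! ### The Löwner-Heinz inequality. -/

section Heinz

/-- Take the points a ≤ p ≤ b of s nearest to p on either side. Their midpoint lies in s, and on
whichever side of p it falls, being nearest forces a = b. -/
lemma Icc_subset_of_isClosed_of_midpoint {s : Set ℝ} (hs : IsClosed s) (h0 : (0 : ℝ) ∈ s)
    (h1 : (1 : ℝ) ∈ s) (hm : ∀ p ∈ s, ∀ q ∈ s, (p + q) / 2 ∈ s) : Icc 0 1 ⊆ s := by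
  intro p hp
  have hb1 : BddAbove (s ∩ Iic p) := ⟨p, fun x hx => hx.2⟩
  have hb2 : BddBelow (s ∩ Ici p) := ⟨p, fun x hx => hx.2⟩
  have ha := (hs.inter isClosed_Iic).csSup_mem ⟨0, h0, hp.1⟩ hb1
  have hb := (hs.inter isClosed_Ici).csInf_mem ⟨1, h1, hp.2⟩ hb2
  set a := sSup (s ∩ Iic p)
  set b := sInf (s ∩ Ici p)
  have hm' := hm a ha.1 b hb.1
  have hap : a ≤ p := ha.2
  have hpb : p ≤ b := hb.2
  rcases le_total ((a + b) / 2) p with h | h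
  · have := le_csSup hb1 ⟨hm', h⟩
    have : p = a := by linarith
    rw [this]; exact ha.1
  · have := csInf_le hb2 ⟨hm', h⟩
    have : p = b := by linarith
    rw [this]; exact hb.1

/-- The midpoint step of Pedersen's proof of the Löwner-Heinz inequality. -/
lemma norm_mul_midpoint_le_one {E : Type*} [NormedRing E] [StarRing E] [CStarRing E]
    {X Y : ℝ → E} (hXs : ∀ p, star (X p) = X p) (hYs : ∀ p, star (Y p) = Y p)
    (hX : ∀ p q, 0 ≤ p → 0 ≤ q → X (p + q) = X p * X q) (hY : ∀ p q, Y (p + q) = Y p * Y q)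
    (hY0 : Y 0 = 1) {p q : ℝ} (hp : 0 ≤ p) (hq : 0 ≤ q) (h1 : ‖X p * Y (-p)‖ ≤ 1)
    (h2 : ‖X q * Y (-q)‖ ≤ 1) : ‖X ((p + q) / 2) * Y (-((p + q) / 2))‖ ≤ 1 := by
  set r := (p + q) / 2 with hr
  have h2' : ‖Y (-q) * X q‖ ≤ 1 := by
    rw [← norm_star, star_mul, hXs, hYs]; exact h2
  -- M is a contraction, and conjugating it by Y^{q-r} gives the self-adjoint K = Y^{-r} X^{2r}
  -- Y^{-r}, because p + q = 2r.
  set M := Y (-q) * X q * (X p * Y (-p)) with hM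
  have hM1 : ‖M‖ ≤ 1 := (norm_mul_le _ _).trans (mul_le_one₀ h2' (norm_nonneg _) h1)
  let c : Eˣ := ⟨Y (q - r), Y (-(q - r)), by rw [← hY, add_neg_cancel, hY0],
    by rw [← hY, neg_add_cancel, hY0]⟩
  set K := star (X r * Y (-r)) * (X r * Y (-r)) with hK
  have hKM : K = ↑c * M * ↑c⁻¹ := by
    have e1 : K = Y (-r) * X (r + r) * Y (-r) := by
      rw [hK, star_mul, hXs, hYs, hX r r (by positivity) (by positivity)]
      simp only [mul_assoc]
    have e2 : (↑c : E) * M * ↑c⁻¹ = Y ((q - r) + -q) * X (q + p) * Y (-p + -(q - r)) := by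
      rw [hY, hY, hX q p hq hp]
      simp only [hM, mul_assoc]
      rfl
    rw [e1, e2, show q - r + -q = -r by ring, show -p + -(q - r) = -r by linarith [hr],
      show q + p = r + r by linarith [hr]]
  have hKs : IsSelfAdjoint K := IsSelfAdjoint.star_mul_self _
  -- A spectral radius argument by hand: for self-adjoint K the norm of K^(2^n) is ‖K‖^(2^n), and
  -- similarity to the contraction M keeps it bounded in n. Hence ‖K‖ ≤ 1.
  have hbound : ∀ n : ℕ, ‖K‖ ^ 2 ^ n ≤ ‖(c : E)‖ * ‖((c⁻¹ : Eˣ) : E)‖ := by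
    intro n
    rw [← hKs.norm_pow_two_pow, hKM, Units.conj_pow]
    have hMn : ‖M ^ 2 ^ n‖ ≤ 1 :=
      (norm_pow_le' M (by positivity)).trans (pow_le_one₀ (norm_nonneg _) hM1)
    calc ‖(c : E) * M ^ 2 ^ n * ((c⁻¹ : Eˣ) : E)‖
        ≤ ‖(c : E)‖ * ‖M ^ 2 ^ n‖ * ‖((c⁻¹ : Eˣ) : E)‖ := norm_mul₃_le
      _ ≤ ‖(c : E)‖ * 1 * ‖((c⁻¹ : Eˣ) : E)‖ := by gcongr
      _ = _ := by rw [mul_one]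
  have hK1 : ‖K‖ ≤ 1 := by
    by_contra! hlt
    obtain ⟨n, hn⟩ := pow_unbounded_of_one_lt (‖(c : E)‖ * ‖((c⁻¹ : Eˣ) : E)‖) hlt
    have := pow_le_pow_right₀ hlt.le (Nat.lt_two_pow_self (n := n)).le
    linarith [hbound n]
  rw [hK, CStarRing.norm_star_mul_self] at hK1
  nlinarith [norm_nonneg (X r * Y (-r))]

/-- Joint continuity of (q, t) ↦ f(t)^q, made uniform by compactness of k. The alternative in `h`
excludes the discontinuity of the power at base 0 and exponent 0. -/
lemma tendstoUniformlyOn_rpow {f : ℝ → ℝ} {k : Set ℝ} (hk : IsCompact k) (hf : ContinuousOn f k)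
    {p : ℝ} {s : Set ℝ} (hs : s ∈ 𝓝 p) (h : ∀ q ∈ s, ∀ t ∈ k, f t ≠ 0 ∨ 0 < q) :
    TendstoUniformlyOn (fun (q t : ℝ) => f t ^ q) (fun t => f t ^ p) (𝓝 p) k := by
  intro u hu
  obtain ⟨v, hv, hvk⟩ := hk.mem_uniformity_of_prod (f := fun (q t : ℝ) => f t ^ q) (s := s)
    (q := p) (ContinuousOn.rpow (hf.comp continuousOn_snd fun x hx => hx.2) continuousOn_fst
      (fun x hx => h x.1 hx.1 x.2 hx.2)) (mem_of_mem_nhds hs) (symm_le_uniformity hu)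
  rw [nhdsWithin_eq_nhds.2 hs] at hv
  filter_upwards [hv] with q hq t ht using hvk q hq t ht

variable {𝕜 H : Type*} [RCLike 𝕜] [NormedAddCommGroup H] [InnerProductSpace 𝕜 H]
  [CompleteSpace H] {T₁ T₂ : H →L[𝕜] H} {f g : ℝ → ℝ}

/-- Strict positivity of g makes the powers Y p invertible, so the inequality at exponent p becomes
‖X p Y(-p)‖ ≤ 1. The set of such p contains 0 and 1, is closed, and is stable under midpoints. -/
lemma norm_fc_rpow_le_of_pos (h₁ : T₁.IsPositive) (h₂ : T₂.IsPositive)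
    (hf : ContinuousOn f (Icc 0 ‖T₁‖)) (hg : ContinuousOn g (Icc 0 ‖T₂‖))
    (hf0 : ∀ t ∈ Icc 0 ‖T₁‖, 0 ≤ f t) (hg0 : ∀ t ∈ Icc 0 ‖T₂‖, 0 < g t)
    (hfg : ∀ x, ‖fc T₁ f x‖ ≤ ‖fc T₂ g x‖) {p : ℝ} (hp : p ∈ Icc (0 : ℝ) 1) (x : H) :
    ‖fc T₁ (fun t => f t ^ p) x‖ ≤ ‖fc T₂ (fun t => g t ^ p) x‖ := by
  set X : ℝ → H →L[𝕜] H := fun p => fc T₁ (fun t => f t ^ p) with hXd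
  set Y : ℝ → H →L[𝕜] H := fun p => fc T₂ (fun t => g t ^ p) with hYd
  have cX : ∀ p : ℝ, 0 ≤ p → ContinuousOn (fun t => f t ^ p) (Icc 0 ‖T₁‖) := fun p hp =>
    hf.rpow_const fun t _ => Or.inr hp
  have cY : ∀ p : ℝ, ContinuousOn (fun t => g t ^ p) (Icc 0 ‖T₂‖) := fun p =>
    hg.rpow_const fun t ht => Or.inl (hg0 t ht).ne'
  have hX : ∀ p q, 0 ≤ p → 0 ≤ q → X (p + q) = X p * X q := fun p q hp hq => by
    rw [hXd]; dsimp only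
    rw [← fc_mul h₁ (cX p hp) (cX q hq)]
    exact fc_congr fun t ht => Real.rpow_add_of_nonneg (hf0 t ht) hp hq
  have hY : ∀ p q, Y (p + q) = Y p * Y q := fun p q => by
    rw [hYd]; dsimp only
    rw [← fc_mul h₂ (cY p) (cY q)]
    exact fc_congr fun t ht => Real.rpow_add (hg0 t ht) p q
  have hY0 : Y 0 = 1 := by
    rw [hYd, ← fc_one h₂]; simp
  have key : ∀ p, ‖X p * Y (-p)‖ ≤ 1 ↔ ∀ x, ‖X p x‖ ≤ ‖Y p x‖ := by
    intro p
    constructor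
    · intro h x
      have e : X p x = (X p * Y (-p)) (Y p x) := by
        change X p x = X p ((Y (-p) * Y p) x)
        rw [← hY, neg_add_cancel, hY0]; rfl
      rw [e]
      exact ((X p * Y (-p)).le_opNorm _).trans (mul_le_of_le_one_left (norm_nonneg _) h)
    · intro h
      refine ContinuousLinearMap.opNorm_le_bound _ zero_le_one fun x => ?_
      have e : Y p (Y (-p) x) = x := by
        change (Y p * Y (-p)) x = x
        rw [← hY, add_neg_cancel, hY0]; rfl
      rw [one_mul]
      conv_rhs => rw [← e]
      exact h _
  set s : Set ℝ := {p | p ∈ Icc (0 : ℝ) 1 ∧ ‖X p * Y (-p)‖ ≤ 1} with hs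
  have hs0 : (0 : ℝ) ∈ s := by
    refine ⟨by simp, (key 0).2 fun x => ?_⟩
    have : X 0 = 1 := by rw [hXd, ← fc_one h₁]; simp
    rw [this, hY0]
  have hs1 : (1 : ℝ) ∈ s := by
    refine ⟨by simp, (key 1).2 fun x => ?_⟩
    simpa [hXd, hYd] using hfg x
  have hclosed : IsClosed s := by
    refine isClosed_of_closure_subset fun p hp => ?_
    have hpI : p ∈ Icc (0 : ℝ) 1 := closure_minimal (fun _ h => h.1) isClosed_Icc hp
    -- The exponent 0 is treated apart because q ↦ f^q need not be continuous there when f vanishes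
    -- somewhere.
    rcases hpI.1.eq_or_lt with h | h
    · rw [← h]; exact hs0
    have hX' : Tendsto X (𝓝 p) (𝓝 (X p)) := by
      refine tendsto_fc h₁ ?_ (cX p h.le) (tendstoUniformlyOn_rpow isCompact_Icc hf
        (Ioi_mem_nhds h) fun q hq t ht => Or.inr hq)
      filter_upwards [Ioi_mem_nhds h] with q hq using cX q (le_of_lt hq)
    have hY' : Tendsto (fun p => Y (-p)) (𝓝 p) (𝓝 (Y (-p))) := by
      have : Tendsto Y (𝓝 (-p)) (𝓝 (Y (-p))) :=
        tendsto_fc h₂ (Eventually.of_forall cY) (cY _) (tendstoUniformlyOn_rpow isCompact_Icc hg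
          univ_mem fun q hq t ht => Or.inl (hg0 t ht).ne')
      exact this.comp (continuous_neg.tendsto p)
    obtain ⟨u, hus, hu⟩ := mem_closure_iff_seq_limit.1 hp
    refine ⟨hpI, le_of_tendsto ((hX'.mul hY').norm.comp hu) (Eventually.of_forall fun n => ?_)⟩
    exact (hus n).2
  have hmid : ∀ p ∈ s, ∀ q ∈ s, (p + q) / 2 ∈ s := by
    rintro p ⟨hp, hp'⟩ q ⟨hq, hq'⟩
    refine ⟨⟨by linarith [hp.1, hq.1], by linarith [hp.2, hq.2]⟩, ?_⟩
    exact norm_mul_midpoint_le_one (X := X) (Y := Y) (fun p => (isSelfAdjoint_fc h₁ _).star_eq)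
      (fun p => (isSelfAdjoint_fc h₂ _).star_eq) hX hY hY0 hp.1 hq.1 hp' hq'
  exact (key p).1 (Icc_subset_of_isClosed_of_midpoint hclosed hs0 hs1 hmid hp).2 x

/-- The Löwner-Heinz inequality. -/
theorem norm_fc_rpow_le (h₁ : T₁.IsPositive) (h₂ : T₂.IsPositive)
    (hf : ContinuousOn f (Icc 0 ‖T₁‖)) (hg : ContinuousOn g (Icc 0 ‖T₂‖))
    (hf0 : ∀ t ∈ Icc 0 ‖T₁‖, 0 ≤ f t) (hg0 : ∀ t ∈ Icc 0 ‖T₂‖, 0 ≤ g t)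
    (hfg : ∀ x, ‖fc T₁ f x‖ ≤ ‖fc T₂ g x‖) {p : ℝ} (hp : p ∈ Icc (0 : ℝ) 1) (x : H) :
    ‖fc T₁ (fun t => f t ^ p) x‖ ≤ ‖fc T₂ (fun t => g t ^ p) x‖ := by
  have hc : ∀ ε : ℝ, ContinuousOn (fun t => (g t + ε) ^ p) (Icc 0 ‖T₂‖) := fun ε =>
    (hg.add continuousOn_const).rpow_const fun t _ => Or.inr hp.1
  -- The shift g + ε is strictly positive and still dominates; afterwards ε tends to 0 from the
  -- right.
  have hε : ∀ ε > 0, ‖fc T₁ (fun t => f t ^ p) x‖ ≤ ‖fc T₂ (fun t => (g t + ε) ^ p) x‖ := by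
    intro ε hε
    refine norm_fc_rpow_le_of_pos h₁ h₂ hf (g := fun t => g t + ε) (hg.add continuousOn_const) hf0
      (fun t ht => by linarith [hg0 t ht]) (fun x => (hfg x).trans ?_) hp x
    refine norm_fc_apply_le (g := fun t => g t + ε) h₂ hg (hg.add continuousOn_const)
      (fun t ht => ?_) x
    have := hg0 t ht
    rw [abs_of_nonneg this, abs_of_nonneg (by linarith)]
    linarith
  have hu : TendstoUniformlyOn (fun ε t => (g t + ε) ^ p) (fun t => g t ^ p) (𝓝 0)
      (Icc 0 ‖T₂‖) := by
    intro u hu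
    obtain ⟨v, hv, hvk⟩ := isCompact_Icc.mem_uniformity_of_prod (k := Icc 0 ‖T₂‖)
      (f := fun (ε t : ℝ) => (g t + ε) ^ p) (s := univ) (q := 0)
      (ContinuousOn.rpow_const ((hg.comp continuousOn_snd fun x hx => hx.2).add continuousOn_fst)
      (fun x hx => Or.inr hp.1)) (mem_univ _) (symm_le_uniformity hu)
    rw [nhdsWithin_univ] at hv
    filter_upwards [hv] with q hq t ht
    simpa using hvk q hq t ht
  have := tendsto_fc h₂ (Eventually.of_forall hc) (by simpa using hc 0) hu
  have h3 := ((ContinuousLinearMap.apply 𝕜 H x).continuous.tendsto _).comp this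
  refine ge_of_tendsto (h3.norm.mono_left nhdsWithin_le_nhds : Tendsto _ (𝓝[>] (0 : ℝ)) _) ?_
  filter_upwards [self_mem_nhdsWithin] with ε h using hε ε h

end Heinz

/-! ### Resolvent differences under weighted bounds on A - B. -/

section Resolvent

variable {𝕜 X Y : Type*} [RCLike 𝕜] [NormedAddCommGroup X] [InnerProductSpace 𝕜 X]
  [CompleteSpace X] [NormedAddCommGroup Y] [InnerProductSpace 𝕜 Y] [CompleteSpace Y]

lemma continuousOn_rpow {r : ℝ} (hr : 0 ≤ r) (s : Set ℝ) : ContinuousOn (fun t : ℝ => t ^ r) s :=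
  (Real.continuous_rpow_const hr).continuousOn

/-- This is c₊ = c + c₋ for both exponents. Every exponent that occurs is nonnegative, so the
identity also holds at t = 0; it stands in for t^a t^b = t^(a+b). -/
lemma rpow_max_mul_rpow_max {t : ℝ} (ht : 0 ≤ t) {a b : ℝ} (hab : 0 ≤ a + b) :
    t ^ max a 0 * t ^ max b 0 = t ^ (a + b) * (t ^ max (-a) 0 * t ^ max (-b) 0) := by
  have h : ∀ c : ℝ, max c 0 = c + max (-c) 0 := fun c => by
    rcases le_total c 0 with hc | hc
    · rw [max_eq_right hc, max_eq_left (by linarith)]; ring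
    · rw [max_eq_left hc, max_eq_right (by linarith)]; ring
  have n : ∀ c : ℝ, 0 ≤ max c 0 := fun c => le_max_right _ _
  rw [← Real.rpow_add_of_nonneg ht (n _) (n _), ← Real.rpow_add_of_nonneg ht (n _) (n _),
    ← Real.rpow_add_of_nonneg ht hab (add_nonneg (n _) (n _)), h a, h b]
  congr 1
  ring

/-- Young's inequality: t^θ α^(1-θ) ≤ θ t + (1-θ) α ≤ α + t. -/
lemma rpow_mul_inv_add_le {t α θ : ℝ} (ht : 0 ≤ t) (hα : 0 < α) (hθ : θ ∈ Icc (0 : ℝ) 1) :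
    t ^ θ * (α + t)⁻¹ ≤ α ^ (θ - 1) := by
  have h := Real.geom_mean_le_arith_mean2_weighted hθ.1 (sub_nonneg.2 hθ.2) ht hα.le (by ring)
  have h1 : t ^ θ * α ^ (1 - θ) ≤ α + t := by
    nlinarith [hθ.1, hθ.2, mul_nonneg (sub_nonneg.2 hθ.2) ht, mul_nonneg hθ.1 hα.le]
  have h2 : α ^ (θ - 1) * α ^ (1 - θ) = 1 := by
    rw [← Real.rpow_add hα]; simp
  have h3 : 0 < α ^ (1 - θ) := Real.rpow_pos_of_pos hα _
  rw [← div_eq_mul_inv, div_le_iff₀ (by positivity)]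
  have h4 : 0 < α ^ (θ - 1) := Real.rpow_pos_of_pos hα _
  nlinarith

lemma norm_adjoint_apply_le {V : X →L[𝕜] Y} {c : ℝ} (hc : 0 ≤ c) (h : ∀ x, ‖V x‖ ≤ c * ‖x‖)
    (y : Y) : ‖V.adjoint y‖ ≤ c * ‖y‖ := by
  refine (V.adjoint.le_opNorm y).trans ?_
  gcongr
  rw [LinearIsometryEquiv.norm_map]
  exact V.opNorm_le_bound hc h

/-- `‖D T ^ (-μ)‖ ≤ κ` for an injective positive operator `T`, without negative powers of `T`. -/
def WeightedBound (T : X →L[𝕜] X) (D : X →L[𝕜] Y) (μ κ : ℝ) : Prop :=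
  (0 ≤ μ → ∀ x, ‖D x‖ ≤ κ * ‖fc T (fun t => t ^ μ) x‖) ∧
    (μ < 0 → ∀ y, ‖fc T (fun t => t ^ (-μ)) (D.adjoint y)‖ ≤ κ * ‖y‖)

/-- For μ ≥ 0, D is traded for T^μ and monotonicity of the calculus applies. For μ < 0 the bound
passes through the adjoint w(T) D*, which is an operator norm estimate and leaves no weight on x;
therefore e = 0 in that case. -/
lemma WeightedBound.norm_apply_le {T : X →L[𝕜] X} {D : X →L[𝕜] Y} {μ κ c e : ℝ}
    (h : WeightedBound T D μ κ) (hT : T.IsPositive) (hκ : 0 ≤ κ) (hc : 0 ≤ c) (he : 0 ≤ e)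
    (hμe : μ < 0 → e = 0) {w : ℝ → ℝ} (hw : ContinuousOn w (Icc 0 ‖T‖))
    (hwc : ∀ t ∈ Icc 0 ‖T‖, t ^ max μ 0 * |w t| ≤ c * (t ^ max (-μ) 0 * t ^ e)) (x : X) :
    ‖D (fc T w x)‖ ≤ κ * c * ‖fc T (fun t => t ^ e) x‖ := by
  rcases le_or_gt 0 μ with hμ | hμ
  · have h1 := h.1 hμ (fc T w x)
    rw [← fc_mul_apply hT (continuousOn_rpow hμ _) hw] at h1
    refine h1.trans ?_
    rw [mul_assoc]
    gcongr
    refine norm_fc_apply_le_mul hT ((continuousOn_rpow hμ _).mul hw) (continuousOn_rpow he _) hc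
      (fun t ht => ?_) x
    have := hwc t ht
    rw [max_eq_left hμ, max_eq_right (by linarith), Real.rpow_zero, one_mul] at this
    rwa [Pi.mul_apply, abs_mul, abs_of_nonneg (Real.rpow_nonneg ht.1 _), abs_of_nonneg (Real.rpow_nonneg ht.1 _)]
  · have he0 := hμe hμ
    subst he0
    have h1 : ∀ y, ‖(fc T w ∘L D.adjoint) y‖ ≤ κ * c * ‖y‖ := by
      intro y
      rw [ContinuousLinearMap.comp_apply]
      refine (norm_fc_apply_le_mul hT hw (continuousOn_rpow (neg_nonneg.2 hμ.le) _) hc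
        (fun t ht => ?_) (D.adjoint y)).trans ?_
      · have := hwc t ht
        rw [max_eq_right hμ.le, max_eq_left (by linarith), Real.rpow_zero, one_mul,
          mul_one] at this
        rwa [abs_of_nonneg (Real.rpow_nonneg ht.1 _)]
      · calc _ ≤ c * (κ * ‖y‖) := by gcongr; exact h.2 hμ y
          _ = _ := by ring
    have h2 := norm_adjoint_apply_le (mul_nonneg hκ hc) h1 x
    rw [ContinuousLinearMap.adjoint_comp, ContinuousLinearMap.adjoint_adjoint, adjoint_fc hT] at h2
    simpa [fc_one hT] using h2

lemma WeightedBound.norm_apply_adjoint_le {T : X →L[𝕜] X} {D : X →L[𝕜] Y} {μ κ c : ℝ}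
    (h : WeightedBound T D μ κ) (hT : T.IsPositive) (hκ : 0 ≤ κ) (hc : 0 ≤ c)
    {w : ℝ → ℝ} (hw : ContinuousOn w (Icc 0 ‖T‖))
    (hwc : ∀ t ∈ Icc 0 ‖T‖, t ^ max μ 0 * |w t| ≤ c * t ^ max (-μ) 0) (y : Y) :
    ‖fc T w (D.adjoint y)‖ ≤ κ * c * ‖y‖ := by
  have h1 : ∀ x, ‖(D ∘L fc T w) x‖ ≤ κ * c * ‖x‖ := fun x => by
    simpa [fc_one hT] using h.norm_apply_le hT hκ hc le_rfl (fun _ => rfl) hw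
      (fun t ht => by simpa using hwc t ht) x
  have h2 := norm_adjoint_apply_le (mul_nonneg hκ hc) h1 y
  rwa [ContinuousLinearMap.adjoint_comp, adjoint_fc hT] at h2

/-- Real and imaginary part of `A r(A*A) - r(BB*) B = r(BB*) (z D + B D* A) r(A*A)`, `D = A - B`, for
the resolvent function `r(t) = 1 / (z - t)`, `z = p + i q`. -/
lemma resolvent_difference {A B : X →L[𝕜] Y} {U' V' : Y →L[𝕜] Y} {p q : 𝕜} {x u v : X}
    (hu : p • u - A.adjoint (A u) = x + q • v) (hv : p • v - A.adjoint (A v) = -(q • u))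
    (hU : ∀ y, U' (p • y - B (B.adjoint y)) = y + q • V' y)
    (hV : ∀ y, V' (p • y - B (B.adjoint y)) = -(q • U' y)) :
    (A u - U' (B x) = p • U' ((A - B) u) + U' (B ((A - B).adjoint (A u)))
      - (p • V' ((A - B) v) + V' (B ((A - B).adjoint (A v))))
      - q • U' ((A - B) v) - q • V' ((A - B) u)) ∧
    (A v - V' (B x) = p • U' ((A - B) v) + U' (B ((A - B).adjoint (A v)))
      + (p • V' ((A - B) u) + V' (B ((A - B).adjoint (A u))))
      + q • U' ((A - B) u) - q • V' ((A - B) v)) := by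
  -- The cancellation behind the identity, for the real part p of z: p D + B D* A = (p - BB*) A - B
  -- (p - A*A).
  have hG : ∀ w : X, ∀ W : Y →L[𝕜] Y, p • W ((A - B) w) + W (B ((A - B).adjoint (A w)))
      = W (p • A w - B (B.adjoint (A w))) - W (B (p • w - A.adjoint (A w))) := fun w W => by
    simp only [map_sub, map_smul, sub_apply]
    module
  simp only [hG, hu, hv, hU, hV]
  simp only [map_sub, map_smul, sub_apply, map_add, map_neg]
  constructor <;> module

variable {A B : X →L[𝕜] Y} {R u v : ℝ → ℝ} {α σ ν μ κ b₀ r : ℝ}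

lemma le_two_mul_inv_add {t : ℝ} (hα : 0 < α) (hr : α / 2 ≤ r) (ht : 0 ≤ t) :
    (r + t)⁻¹ ≤ 2 * (α + t)⁻¹ := by
  rw [← div_eq_mul_inv, inv_eq_one_div, div_le_div_iff₀ (by linarith) (by linarith)]
  linarith

lemma Icc_zero_sq_subset {E : Type*} [SeminormedAddGroup E] {A : E} (hA : ‖A‖ ≤ 1) : Icc 0 (‖A‖ ^ 2) ⊆ Icc (0 : ℝ) 1 :=
  Icc_subset_Icc_right (pow_le_one₀ (norm_nonneg _) hA)

lemma Icc_zero_norm_subset {A : X →L[𝕜] Y} (hA : ‖A‖ ≤ 1) :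
    Icc 0 ‖A.adjoint ∘L A‖ ⊆ Icc (0 : ℝ) 1 := by
  rw [norm_adjoint_comp_self]; exact Icc_zero_sq_subset hA

lemma Icc_zero_norm_subset' {A : X →L[𝕜] Y} (hA : ‖A‖ ≤ 1) :
    Icc 0 ‖A ∘L A.adjoint‖ ⊆ Icc (0 : ℝ) 1 := by
  rw [norm_self_comp_adjoint]; exact Icc_zero_sq_subset hA

/-- The term with z D. The left factor has norm at most b₀/r, which cancels the factor r; on the
right D costs a power μ, so the decay of R is used with exponent ν + μ. If μ < 0, then ν > 0 and the
weight on x is trivial, as `WeightedBound.norm_apply_le` requires. -/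
lemma norm_sandwich_le (hA : ‖A‖ ≤ 1) (hB : ‖B‖ ≤ 1) {D : X →L[𝕜] Y} (hα : 0 < α) (hσ : 0 < σ)
    (hr : α / 2 ≤ r) (hb₀ : 0 ≤ b₀) (hκ : 0 ≤ κ) (hμ : μ ∈ Icc (-(1 / 2) : ℝ) (1 / 2))
    (hν : ν ∈ Icc (-μ) (1 / 2)) (hD : WeightedBound (A.adjoint ∘L A) D μ κ)
    (hRc : ContinuousOn R (Icc 0 1)) (hR0 : ∀ t ∈ Icc (0 : ℝ) 1, 0 ≤ R t)
    (hR : ∀ θ ∈ Icc (0 : ℝ) 1, ∀ t ∈ Icc (0 : ℝ) 1,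
      t ^ θ * R t * (α + t)⁻¹ ≤ 2 * α⁻¹ * σ ^ (-θ))
    (hu : ContinuousOn u (Icc 0 1)) (hv : ContinuousOn v (Icc 0 1))
    (hub : ∀ t ∈ Icc (0 : ℝ) 1, |u t| ≤ b₀ * (r + t)⁻¹)
    (hvb : ∀ t ∈ Icc (0 : ℝ) 1, |v t| ≤ b₀ * (r + t)⁻¹) (x : X) :
    r * ‖fc (B ∘L B.adjoint) v (D (fc (A.adjoint ∘L A) (fun t => u t * (R t * t ^ max ν 0)) x))‖
      ≤ 4 * (b₀ ^ 2 * κ * α⁻¹ * σ ^ (-(ν + μ)) *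
        ‖fc (A.adjoint ∘L A) (fun t => t ^ max (-ν) 0) x‖) := by
  have hr0 : 0 < r := by linarith
  have hS := isPositive_adjoint_comp_self A
  have hsA := Icc_zero_norm_subset hA
  have hsB := Icc_zero_norm_subset' hB
  have hvn : ‖fc (B ∘L B.adjoint) v‖ ≤ b₀ * r⁻¹ := by
    refine norm_fc_le (isPositive_self_comp_adjoint B) (hv.mono hsB) (by positivity) fun t ht => ?_
    refine (hvb t (hsB ht)).trans ?_
    have := ht.1
    gcongr
    linarith
  have hw : ContinuousOn (fun t => u t * (R t * t ^ max ν 0)) (Icc 0 ‖A.adjoint ∘L A‖) :=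
    (hu.mul (hRc.mul (continuousOn_rpow (le_max_right _ _) _))).mono hsA
  have h1 := hD.norm_apply_le hS hκ (c := 4 * b₀ * α⁻¹ * σ ^ (-(ν + μ))) (by positivity)
    (le_max_right (-ν) 0) (fun h => max_eq_right (by linarith [hν.1])) hw (fun t ht => ?_) x
  · calc _ ≤ r * (b₀ * r⁻¹ * (κ * (4 * b₀ * α⁻¹ * σ ^ (-(ν + μ))) *
          ‖fc (A.adjoint ∘L A) (fun t => t ^ max (-ν) 0) x‖)) := by
          gcongr
          exact (ContinuousLinearMap.le_opNorm _ _).trans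
            (mul_le_mul hvn h1 (norm_nonneg _) (by positivity))
      _ = _ := by field_simp
  · have ht' := hsA ht
    have ht0 := ht'.1
    have hR0t := hR0 t ht'
    have hp := rpow_max_mul_rpow_max ht0 (a := μ) (b := ν) (by linarith [hν.1])
    have hθ := hR (ν + μ) ⟨by linarith [hν.1], by linarith [hν.2, hμ.2]⟩ t ht'
    rw [abs_mul, abs_of_nonneg (by positivity : 0 ≤ R t * t ^ max ν 0)]
    calc t ^ max μ 0 * (|u t| * (R t * t ^ max ν 0))
        ≤ t ^ max μ 0 * (b₀ * (2 * (α + t)⁻¹) * (R t * t ^ max ν 0)) := by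
          gcongr
          exact (hub t ht').trans (by gcongr; exact le_two_mul_inv_add hα hr ht0)
      _ = 2 * b₀ * (t ^ max μ 0 * t ^ max ν 0) * (R t * (α + t)⁻¹) := by ring
      _ = 2 * b₀ * (t ^ (ν + μ) * R t * (α + t)⁻¹) * (t ^ max (-μ) 0 * t ^ max (-ν) 0) := by
          rw [hp, add_comm μ ν]; ring
      _ ≤ 2 * b₀ * (2 * α⁻¹ * σ ^ (-(ν + μ))) * (t ^ max (-μ) 0 * t ^ max (-ν) 0) := by
          gcongr
      _ = _ := by ring

/-- The term with B D* A, split at the vector y after A. Each of A and B contributes a half power,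
and the exponents 1/2 - μ and -(ν + 1/2) of σ add up to -(ν + μ). -/
lemma norm_double_sandwich_le (hA : ‖A‖ ≤ 1) (hB : ‖B‖ ≤ 1) {D : X →L[𝕜] Y} (hα : 0 < α)
    (hσ : α⁻¹ ≤ σ)
    (hr : α / 2 ≤ r) (hb₀ : 0 ≤ b₀) (hκ : 0 ≤ κ) (hμ : μ ∈ Icc (-(1 / 2) : ℝ) (1 / 2))
    (hν : ν ∈ Icc (-μ) (1 / 2)) (hD : WeightedBound (B.adjoint ∘L B) D μ κ)
    (hRc : ContinuousOn R (Icc 0 1)) (hR0 : ∀ t ∈ Icc (0 : ℝ) 1, 0 ≤ R t)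
    (hR : ∀ θ ∈ Icc (0 : ℝ) 1, ∀ t ∈ Icc (0 : ℝ) 1,
      t ^ θ * R t * (α + t)⁻¹ ≤ 2 * α⁻¹ * σ ^ (-θ))
    (hu : ContinuousOn u (Icc 0 1)) (hv : ContinuousOn v (Icc 0 1))
    (hub : ∀ t ∈ Icc (0 : ℝ) 1, |u t| ≤ b₀ * (r + t)⁻¹)
    (hvb : ∀ t ∈ Icc (0 : ℝ) 1, |v t| ≤ b₀ * (r + t)⁻¹) (x : X) :
    ‖fc (B ∘L B.adjoint) v (B (D.adjoint
        (A (fc (A.adjoint ∘L A) (fun t => u t * (R t * t ^ max ν 0)) x))))‖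
      ≤ 8 * (b₀ ^ 2 * κ * α⁻¹ * σ ^ (-(ν + μ)) *
        ‖fc (A.adjoint ∘L A) (fun t => t ^ max (-ν) 0) x‖) := by
  have hr0 : 0 < r := by linarith
  have hσ0 : 0 < σ := (inv_pos.2 hα).trans_le hσ
  have hsA := Icc_zero_norm_subset hA
  have hsB := Icc_zero_norm_subset hB
  have hw : ContinuousOn (fun t => u t * (R t * t ^ max ν 0)) (Icc 0 1) :=
    hu.mul (hRc.mul (continuousOn_rpow (le_max_right _ _) _))
  have half : ∀ t : ℝ, √t = t ^ max (1 / 2 : ℝ) 0 := fun t => by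
    rw [max_eq_left (by norm_num), Real.sqrt_eq_rpow]
  have half' : max (-(1 / 2) : ℝ) 0 = 0 := max_eq_right (by norm_num)
  have inner : ‖A (fc (A.adjoint ∘L A) (fun t => u t * (R t * t ^ max ν 0)) x)‖
      ≤ 4 * b₀ * α⁻¹ * σ ^ (-(ν + 1 / 2)) *
        ‖fc (A.adjoint ∘L A) (fun t => t ^ max (-ν) 0) x‖ := by
    rw [norm_apply_fc A (hw.mono (Icc_zero_sq_subset hA))]
    refine norm_fc_apply_le_mul (isPositive_adjoint_comp_self A)
      (Real.continuous_sqrt.continuousOn.mul (hw.mono hsA))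
      (continuousOn_rpow (le_max_right _ _) _) (by positivity) (fun t ht => ?_) x
    have ht' := hsA ht
    have ht0 := ht'.1
    have hR0t := hR0 t ht'
    have hp := rpow_max_mul_rpow_max ht0 (a := 1 / 2) (b := ν) (by linarith [hν.1, hμ.2])
    rw [half', Real.rpow_zero, one_mul] at hp
    have hθ := hR (ν + 1 / 2) ⟨by linarith [hν.1, hμ.2], by linarith [hν.2]⟩ t ht'
    rw [Pi.mul_apply, abs_mul, abs_mul, abs_of_nonneg (by positivity : 0 ≤ R t * t ^ max ν 0),
      abs_of_nonneg (Real.sqrt_nonneg t), abs_of_nonneg (by positivity : 0 ≤ t ^ max (-ν) 0), half]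
    calc t ^ max (1 / 2 : ℝ) 0 * (|u t| * (R t * t ^ max ν 0))
        ≤ t ^ max (1 / 2 : ℝ) 0 * (b₀ * (2 * (α + t)⁻¹) * (R t * t ^ max ν 0)) := by
          gcongr
          exact (hub t ht').trans (by gcongr; exact le_two_mul_inv_add hα hr ht0)
      _ = 2 * b₀ * (t ^ max (1 / 2 : ℝ) 0 * t ^ max ν 0) * (R t * (α + t)⁻¹) := by ring
      _ = 2 * b₀ * (t ^ (ν + 1 / 2) * R t * (α + t)⁻¹) * t ^ max (-ν) 0 := by
          rw [hp, add_comm ν (1 / 2)]; ring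
      _ ≤ 2 * b₀ * (2 * α⁻¹ * σ ^ (-(ν + 1 / 2))) * t ^ max (-ν) 0 := by gcongr
      _ = _ := by ring
  set y := A (fc (A.adjoint ∘L A) (fun t => u t * (R t * t ^ max ν 0)) x) with hy
  -- Moving B to the left turns v(BB*) into v(B*B), next to D*, where the weighted bound for B*B
  -- applies.
  have outer : ‖fc (B ∘L B.adjoint) v (B (D.adjoint y))‖ ≤ κ * (2 * b₀ * σ ^ (1 / 2 - μ)) * ‖y‖ := by
    have e : fc (B ∘L B.adjoint) v (B (D.adjoint y)) = B (fc (B.adjoint ∘L B) v (D.adjoint y)) :=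
      (congrArg (fun W => W (D.adjoint y))
        (comp_fc_adjoint_comp_self B (hv.mono (Icc_zero_sq_subset hB)))).symm
    rw [e, norm_apply_fc B (hv.mono (Icc_zero_sq_subset hB))]
    refine hD.norm_apply_adjoint_le (isPositive_adjoint_comp_self B) hκ (by positivity)
      (Real.continuous_sqrt.continuousOn.mul (hv.mono hsB)) (fun t ht => ?_) y
    have ht' := hsB ht
    have ht0 := ht'.1
    have hp := rpow_max_mul_rpow_max ht0 (a := 1 / 2) (b := μ) (by linarith [hμ.1])
    rw [half', Real.rpow_zero, one_mul] at hp
    have hα' := rpow_mul_inv_add_le ht0 hα (θ := 1 / 2 + μ)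
      ⟨by linarith [hμ.1], by linarith [hμ.2]⟩
    -- Here μ ≤ 1/2 is essential: only a nonnegative power of α⁻¹ ≤ σ may be enlarged.
    have hασ : α ^ (1 / 2 + μ - 1) ≤ σ ^ (1 / 2 - μ) := by
      calc α ^ (1 / 2 + μ - 1) = α⁻¹ ^ (1 / 2 - μ) := by
            rw [Real.inv_rpow hα.le, ← Real.rpow_neg hα.le]; congr 1; ring
        _ ≤ _ := Real.rpow_le_rpow (by positivity) hσ (by linarith [hμ.2])
    rw [Pi.mul_apply, abs_mul, abs_of_nonneg (Real.sqrt_nonneg t), half]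
    calc t ^ max μ 0 * (t ^ max (1 / 2 : ℝ) 0 * |v t|)
        ≤ t ^ max μ 0 * (t ^ max (1 / 2 : ℝ) 0 * (b₀ * (2 * (α + t)⁻¹))) := by
          gcongr
          exact (hvb t ht').trans (by gcongr; exact le_two_mul_inv_add hα hr ht0)
      _ = 2 * b₀ * (α + t)⁻¹ * (t ^ max (1 / 2 : ℝ) 0 * t ^ max μ 0) := by ring
      _ = 2 * b₀ * (t ^ (1 / 2 + μ) * (α + t)⁻¹) * t ^ max (-μ) 0 := by rw [hp]; ring
      _ ≤ 2 * b₀ * σ ^ (1 / 2 - μ) * t ^ max (-μ) 0 := by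
          gcongr
          exact hα'.trans hασ
  calc _ ≤ κ * (2 * b₀ * σ ^ (1 / 2 - μ)) * ‖y‖ := outer
    _ ≤ κ * (2 * b₀ * σ ^ (1 / 2 - μ)) * (4 * b₀ * α⁻¹ * σ ^ (-(ν + 1 / 2)) *
        ‖fc (A.adjoint ∘L A) (fun t => t ^ max (-ν) 0) x‖) := by gcongr
    _ = 8 * (b₀ ^ 2 * κ * α⁻¹ * (σ ^ (1 / 2 - μ) * σ ^ (-(ν + 1 / 2))) *
        ‖fc (A.adjoint ∘L A) (fun t => t ^ max (-ν) 0) x‖) := by ring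
    _ = _ := by
        rw [← Real.rpow_add hσ0]
        congr 5
        ring

/-- Real and imaginary parts of (z - T)(u + iv)(T) = 1 with z = p + iq, stated without complex
scalars. -/
lemma fc_resolvent_apply {T : X →L[𝕜] X} (hT : T.IsPositive) {u v : ℝ → ℝ} {p q : ℝ}
    (hu : ContinuousOn u (Icc 0 ‖T‖)) (hv : ContinuousOn v (Icc 0 ‖T‖))
    (h1 : ∀ t ∈ Icc 0 ‖T‖, (p - t) * u t - q * v t = 1)
    (h2 : ∀ t ∈ Icc 0 ‖T‖, (p - t) * v t + q * u t = 0) (z : X) :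
    ((p : 𝕜) • fc T u z - T (fc T u z) = z + (q : 𝕜) • fc T v z) ∧
      ((p : 𝕜) • fc T v z - T (fc T v z) = -((q : 𝕜) • fc T u z)) := by
  have ht : ContinuousOn (fun t : ℝ => t) (Icc 0 ‖T‖) := continuousOn_id
  have e : ∀ f : ℝ → ℝ, ContinuousOn f (Icc 0 ‖T‖) →
      (p : 𝕜) • fc T f z - T (fc T f z) = fc T (fun t => p * f t - t * f t) z := by
    intro f hf
    rw [fc_sub (f := fun t => p * f t) (g := fun t => t * f t) hT (continuousOn_const.mul hf)
      (ht.mul hf), fc_const_mul hT p hf, sub_apply, smul_apply, fc_mul_apply hT ht hf, fc_id hT]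
  constructor
  · rw [e u hu]
    have : fc T (fun t => p * u t - t * u t) = fc T (fun t => 1 + q * v t) :=
      fc_congr fun t ht => by linarith [h1 t ht]
    rw [this, fc_add (f := fun _ => 1) (g := fun t => q * v t) hT continuousOn_const
      (continuousOn_const.mul hv), fc_one hT, fc_const_mul hT q hv]
    rfl
  · rw [e v hv]
    have : fc T (fun t => p * v t - t * v t) = fc T (fun t => -(q * u t)) :=
      fc_congr fun t ht => by linarith [h2 t ht]
    rw [this, fc_neg (f := fun t => q * u t) hT (continuousOn_const.mul hu),
      fc_const_mul hT q hu]
    rfl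

/-- The analytic core: `resolvent_difference` expands each part into six terms, and each is of one
of the two sandwich types. -/
lemma norm_resolvent_difference_le (hA : ‖A‖ ≤ 1) (hB : ‖B‖ ≤ 1) (hα : 0 < α) (hσ : α⁻¹ ≤ σ)
    (hr : α / 2 ≤ r) (hb₀ : 0 ≤ b₀) (hκ : 0 ≤ κ) (hμ : μ ∈ Icc (-(1 / 2) : ℝ) (1 / 2))
    (hν : ν ∈ Icc (-μ) (1 / 2)) (hDA : WeightedBound (A.adjoint ∘L A) (A - B) μ κ)
    (hDB : WeightedBound (B.adjoint ∘L B) (A - B) μ κ)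
    (hRc : ContinuousOn R (Icc 0 1)) (hR0 : ∀ t ∈ Icc (0 : ℝ) 1, 0 ≤ R t)
    (hR : ∀ θ ∈ Icc (0 : ℝ) 1, ∀ t ∈ Icc (0 : ℝ) 1,
      t ^ θ * R t * (α + t)⁻¹ ≤ 2 * α⁻¹ * σ ^ (-θ))
    (hu : ContinuousOn u (Icc 0 1)) (hv : ContinuousOn v (Icc 0 1))
    (hub : ∀ t ∈ Icc (0 : ℝ) 1, |u t| ≤ b₀ * (r + t)⁻¹)
    (hvb : ∀ t ∈ Icc (0 : ℝ) 1, |v t| ≤ b₀ * (r + t)⁻¹) {p q : ℝ} (hp : |p| ≤ r) (hq : |q| ≤ r)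
    (h1 : ∀ t ∈ Icc (0 : ℝ) 1, (p - t) * u t - q * v t = 1)
    (h2 : ∀ t ∈ Icc (0 : ℝ) 1, (p - t) * v t + q * u t = 0) (x : X) :
    let x' := fc (A.adjoint ∘L A) (fun t => R t * t ^ max ν 0) x
    let c := 32 * (b₀ ^ 2 * κ * α⁻¹ * σ ^ (-(ν + μ)) *
        ‖fc (A.adjoint ∘L A) (fun t => t ^ max (-ν) 0) x‖)
    ‖A (fc (A.adjoint ∘L A) u x') - fc (B ∘L B.adjoint) u (B x')‖ ≤ c ∧
      ‖A (fc (A.adjoint ∘L A) v x') - fc (B ∘L B.adjoint) v (B x')‖ ≤ c := by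
  intro x' c
  set S := A.adjoint ∘L A with hSd
  set S' := B ∘L B.adjoint with hSd'
  have hS : S.IsPositive := isPositive_adjoint_comp_self A
  have hS' : S'.IsPositive := isPositive_self_comp_adjoint B
  have hsA : Icc 0 ‖S‖ ⊆ Icc (0 : ℝ) 1 := Icc_zero_norm_subset hA
  have hsB : Icc 0 ‖S'‖ ⊆ Icc (0 : ℝ) 1 := Icc_zero_norm_subset' hB
  have hr0 : 0 ≤ r := by linarith
  have hw : ContinuousOn (fun t => R t * t ^ max ν 0) (Icc 0 ‖S‖) :=
    (hRc.mul (continuousOn_rpow (le_max_right _ _) _)).mono hsA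
  have mulx : ∀ {f : ℝ → ℝ}, ContinuousOn f (Icc 0 1) →
      fc S (fun t => f t * (R t * t ^ max ν 0)) x = fc S f x' := fun hf =>
    fc_mul_apply hS (hf.mono hsA) hw x
  have res := fun z => fc_resolvent_apply hS (hu.mono hsA) (hv.mono hsA)
    (fun t ht => h1 t (hsA ht)) (fun t ht => h2 t (hsA ht)) z
  have res' := fun z => fc_resolvent_apply hS' (hu.mono hsB) (hv.mono hsB)
    (fun t ht => h1 t (hsB ht)) (fun t ht => h2 t (hsB ht)) z
  have comm : ∀ f : ℝ → ℝ, ContinuousOn f (Icc 0 1) → ∀ y,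
      fc S' f ((p : 𝕜) • y - B (B.adjoint y)) = (p : 𝕜) • fc S' f y - S' (fc S' f y) := by
    intro f hf y
    have ht : ContinuousOn (fun t : ℝ => t) (Icc 0 ‖S'‖) := continuousOn_id
    have e : fc S' f (S' y) = S' (fc S' f y) := by
      have h3 := fc_mul_apply hS' (hf.mono hsB) ht y
      have h4 := fc_mul_apply hS' ht (hf.mono hsB) y
      rw [fc_id hS'] at h3 h4
      rw [← h3, ← h4]
      simp only [mul_comm]
    rw [map_sub, map_smul, ← e]
    rfl
  have key := resolvent_difference (A := A) (B := B) (U' := fc S' u) (V' := fc S' v)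
    (p := (p : 𝕜)) (q := (q : 𝕜)) (x := x') (u := fc S u x') (v := fc S v x')
    (res x').1 (res x').2
    (fun y => by rw [comm u hu]; exact (res' y).1)
    (fun y => by rw [comm v hv]; exact (res' y).2)
  set E := b₀ ^ 2 * κ * α⁻¹ * σ ^ (-(ν + μ)) * ‖fc S (fun t => t ^ max (-ν) 0) x‖ with hE
  have hσ0 : 0 < σ := (inv_pos.2 hα).trans_le hσ
  have single : ∀ f h : ℝ → ℝ, ContinuousOn f (Icc 0 1) → ContinuousOn h (Icc 0 1) →
      (∀ t ∈ Icc (0 : ℝ) 1, |f t| ≤ b₀ * (r + t)⁻¹) →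
      (∀ t ∈ Icc (0 : ℝ) 1, |h t| ≤ b₀ * (r + t)⁻¹) → ∀ s : ℝ, |s| ≤ r →
      ‖(s : 𝕜) • fc S' h ((A - B) (fc S f x'))‖ ≤ 4 * E := by
    intro f h hf hh hfb hhb s hs
    have := norm_sandwich_le hA hB hα hσ0 hr hb₀ hκ hμ hν hDA hRc hR0 hR hf hh hfb hhb x
    rw [mulx hf] at this
    refine le_trans ?_ this
    rw [norm_smul, RCLike.norm_ofReal]
    gcongr
  have double : ∀ f h : ℝ → ℝ, ContinuousOn f (Icc 0 1) → ContinuousOn h (Icc 0 1) →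
      (∀ t ∈ Icc (0 : ℝ) 1, |f t| ≤ b₀ * (r + t)⁻¹) →
      (∀ t ∈ Icc (0 : ℝ) 1, |h t| ≤ b₀ * (r + t)⁻¹) →
      ‖fc S' h (B ((A - B).adjoint (A (fc S f x'))))‖ ≤ 8 * E := by
    intro f h hf hh hfb hhb
    have := norm_double_sandwich_le hA hB hα hσ hr hb₀ hκ hμ hν hDB hRc hR0 hR hf hh hfb hhb x
    rwa [mulx hf] at this
  -- Four single and two double sandwiches: 4·4 + 2·8 = 32.
  have six : ∀ a b c d e f : Y, ‖a‖ ≤ 4 * E → ‖b‖ ≤ 8 * E → ‖c‖ ≤ 4 * E → ‖d‖ ≤ 8 * E →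
      ‖e‖ ≤ 4 * E → ‖f‖ ≤ 4 * E → ‖a + b - (c + d) - e - f‖ ≤ 32 * E ∧
        ‖a + b + (c + d) + e - f‖ ≤ 32 * E := by
    intro a b c d e f ha hb hc hd he hf
    have h1 := norm_add_le a b
    have h2 := norm_add_le c d
    constructor
    · linarith [norm_sub_le (a + b - (c + d) - e) f, norm_sub_le (a + b - (c + d)) e,
        norm_sub_le (a + b) (c + d)]
    · linarith [norm_sub_le (a + b + (c + d) + e) f, norm_add_le (a + b + (c + d)) e,
        norm_add_le (a + b) (c + d)]
  rw [key.1, key.2]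
  exact ⟨(six _ _ _ _ _ _ (single u u hu hu hub hub p hp) (double u u hu hu hub hub)
      (single v v hv hv hvb hvb p hp) (double v v hv hv hvb hvb)
      (single v u hv hu hvb hub q hq) (single u v hu hv hub hvb q hq)).1,
    (six _ _ _ _ _ _ (single v u hv hu hvb hub p hp) (double v u hv hu hvb hub)
      (single u v hu hv hub hvb p hp) (double u v hu hv hub hvb)
      (single u u hu hu hub hub q hq) (single v v hv hv hvb hvb q hq)).2⟩

end Resolvent

/-! ### Winding numbers and Cauchy's integral formula for piecewise C¹ contours. -/

section Contour

open MeasureTheory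

/-- On the interior of each piece `deriv γ` agrees with the one-sided notion `derivWithin`, which is
continuous up to the endpoints and hence integrable. Differentiability can fail only at the break
points. -/
lemma IsClosedContour.regular {γ : ℝ → ℂ} (hγ : IsClosedContour γ) :
    ContinuousOn γ (Icc 0 1) ∧ IntervalIntegrable (deriv γ) volume 0 1 ∧
      ∃ s : Set ℝ, s.Countable ∧ ∀ t ∈ Ioo (0 : ℝ) 1 \ s, DifferentiableAt ℝ γ t := by
  obtain ⟨-, N, t, hmono, h0, h1, hd⟩ := hγ
  refine ⟨?_, ?_, range t, countable_range t, ?_⟩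
  · have : ∀ n ≤ N, ContinuousOn γ (Icc (t 0) (t n)) := by
      intro n
      induction n with
      | zero => intro _; rw [Icc_self]; exact continuousOn_singleton _ _
      | succ n ih =>
        intro hn
        rw [← Icc_union_Icc_eq_Icc (hmono (Nat.zero_le n)) (hmono (Nat.le_succ n))]
        exact (ih (by omega)).union_of_isClosed (hd n (by omega)).continuousOn isClosed_Icc
          isClosed_Icc
    rw [← h0, ← h1]
    exact this N le_rfl
  · rw [← h0, ← h1]
    refine IntervalIntegrable.trans_iterate fun k hk => ?_
    rcases (hmono (Nat.le_succ k)).eq_or_lt with h | h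
    · rw [← Nat.succ_eq_add_one, ← h]
    have hc : ContinuousOn (derivWithin γ (Icc (t k) (t (k + 1)))) (Icc (t k) (t (k + 1))) :=
      (hd k hk).continuousOn_derivWithin (uniqueDiffOn_Icc h) le_rfl
    have hi : IntervalIntegrable (derivWithin γ (Icc (t k) (t (k + 1)))) volume (t k)
        (t (k + 1)) := ContinuousOn.intervalIntegrable (by rwa [uIcc_of_le h.le])
    rw [intervalIntegrable_iff_integrableOn_Ioo_of_le h.le] at hi ⊢
    refine hi.congr_fun (fun x hx => ?_) measurableSet_Ioo
    exact derivWithin_of_mem_nhds (Icc_mem_nhds hx.1 hx.2)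
  · rintro x ⟨hx, hxr⟩
    obtain ⟨n, hn, hn'⟩ : ∃ n < N, x ∈ Ioo (t n) (t (n + 1)) := by
      have hex : ∃ n, x < t n := ⟨N, by rw [h1]; exact hx.2⟩
      classical
      have hspec := Nat.find_spec hex
      have hpos : Nat.find hex ≠ 0 := fun h => by
        rw [h, h0] at hspec; exact absurd hx.1 (not_lt.2 hspec.le)
      obtain ⟨k, hk⟩ := Nat.exists_eq_succ_of_ne_zero hpos
      have hkx : t k ≤ x := not_lt.1 (Nat.find_min hex (by omega))
      refine ⟨k, ?_, lt_of_le_of_ne hkx fun h => hxr ⟨k, h⟩, by rwa [hk] at hspec⟩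
      have := Nat.find_min' hex (by rw [h1]; exact hx.2 : x < t N)
      omega
    exact ((hd n hn).differentiableOn one_ne_zero x (Ioo_subset_Icc_self hn')).differentiableAt
      (Icc_mem_nhds hn'.1 hn'.2)

lemma IsClosedContour.integral_deriv_comp {γ : ℝ → ℂ} (hγ : IsClosedContour γ) {G G' : ℂ → ℂ}
    (hG : ∀ t ∈ Icc (0 : ℝ) 1, HasDerivAt G (G' (γ t)) (γ t))
    (hG' : ContinuousOn (fun t => G' (γ t)) (Icc 0 1)) :
    ∫ t in (0 : ℝ)..1, deriv γ t * G' (γ t) = 0 := by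
  obtain ⟨hc, hi, s, hs, hd⟩ := hγ.regular
  have := integral_eq_of_hasDerivAt_off_countable_of_le (fun t => G (γ t))
    (fun t => deriv γ t * G' (γ t)) zero_le_one hs
    (fun t ht => (hG t ht).continuousAt.comp_continuousWithinAt (hc t ht))
    (fun t ht => by
      have h := (hG t (Ioo_subset_Icc_self ht.1)).scomp t (hd t ht).hasDerivAt
      simpa [Function.comp_def] using h)
    (hi.mul_continuousOn (by rwa [uIcc_of_le zero_le_one]))
  rw [this, hγ.1, sub_self]

/-- The unnormalised winding number of a closed contour about `w`. -/
noncomputable def windingIntegral (γ : ℝ → ℂ) (w : ℂ) : ℂ :=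
  ∫ t in (0 : ℝ)..1, deriv γ t * (γ t - w)⁻¹

lemma windingIntegral_eq (γ : ℝ → ℂ) (w : ℂ) :
    windingIntegral γ w = 2 * Real.pi * Complex.I * windingNumber γ w := by
  rw [windingNumber, windingIntegral, ← mul_assoc, mul_inv_cancel₀ Complex.two_pi_I_ne_zero,
    one_mul]
  rfl

lemma continuousOn_inv_sub {γ : ℝ → ℂ} (hc : ContinuousOn γ (Icc 0 1)) {w : ℂ}
    (hw : w ∉ γ '' Icc 0 1) : ContinuousOn (fun t => (γ t - w)⁻¹) (Icc 0 1) :=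
  (hc.sub continuousOn_const).inv₀ fun t ht h => hw ⟨t, ht, sub_eq_zero.1 h⟩

/-- Local constancy of the winding number without integrality: log(1 - (w - w₀)/(z - w₀)) is a
primitive of the difference of the integrands, and the principal branch is holomorphic there because
the quotient has modulus below 1. -/
lemma IsClosedContour.windingIntegral_eq_of_near {γ : ℝ → ℂ} (hγ : IsClosedContour γ) {w₀ w : ℂ}
    (h : ∀ t ∈ Icc (0 : ℝ) 1, ‖w - w₀‖ < ‖γ t - w₀‖) :
    windingIntegral γ w = windingIntegral γ w₀ := by
  obtain ⟨hc, hi, -⟩ := hγ.regular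
  have hw₀ : w₀ ∉ γ '' Icc 0 1 := by
    rintro ⟨t, ht, he⟩
    have := h t ht
    rw [he, sub_self, norm_zero] at this
    exact absurd this (not_lt.2 (norm_nonneg _))
  have hw : w ∉ γ '' Icc 0 1 := by
    rintro ⟨t, ht, he⟩
    have := h t ht
    rw [he] at this
    exact lt_irrefl _ this
  have hc1 := continuousOn_inv_sub hc hw
  have hc0 := continuousOn_inv_sub hc hw₀
  have key := hγ.integral_deriv_comp (G := fun z => Complex.log (1 - (w - w₀) / (z - w₀)))
    (G' := fun z => (z - w)⁻¹ - (z - w₀)⁻¹) (fun t ht => ?_) (hc1.sub hc0)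
  · rw [← sub_eq_zero, windingIntegral, windingIntegral, ← intervalIntegral.integral_sub
      (hi.mul_continuousOn (by rwa [uIcc_of_le zero_le_one]))
      (hi.mul_continuousOn (by rwa [uIcc_of_le zero_le_one])), ← key]
    simp only [mul_sub]
  · have hz := h t ht
    have h0 : γ t - w₀ ≠ 0 := fun h0 => hw₀ ⟨t, ht, sub_eq_zero.1 h0⟩
    have h1 : γ t - w ≠ 0 := fun h0 => hw ⟨t, ht, sub_eq_zero.1 h0⟩
    have hn : ‖(w - w₀) / (γ t - w₀)‖ < 1 := by
      rw [norm_div, div_lt_one (norm_pos_iff.2 h0)]; exact hz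
    have hslit : 1 - (w - w₀) / (γ t - w₀) ∈ Complex.slitPlane := by
      rw [sub_eq_add_neg]
      exact Complex.mem_slitPlane_of_norm_lt_one (by rwa [norm_neg])
    have hd : HasDerivAt (fun z => 1 - (w - w₀) / (z - w₀))
        ((w - w₀) / (γ t - w₀) ^ 2) (γ t) := by
      have := (((hasDerivAt_id (γ t)).sub_const w₀).inv h0).const_mul (w - w₀) |>.const_sub 1
      convert! this using 1
      simp only [id]
      ring
    convert! hd.clog hslit using 1
    have h2 : (1 - (w - w₀) / (γ t - w₀)) = (γ t - w) / (γ t - w₀) := by field_simp; ring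
    rw [h2]
    field_simp
    ring

/-- Far from the curve, log(1 - z/w) is a primitive of 1/(z - w). -/
lemma IsClosedContour.windingIntegral_eq_zero {γ : ℝ → ℂ} (hγ : IsClosedContour γ) {w : ℂ}
    (h : ∀ t ∈ Icc (0 : ℝ) 1, ‖γ t‖ < ‖w‖) : windingIntegral γ w = 0 := by
  obtain ⟨hc, hi, -⟩ := hγ.regular
  have hw : w ∉ γ '' Icc 0 1 := by
    rintro ⟨t, ht, he⟩
    have := h t ht
    rw [he] at this
    exact lt_irrefl _ this
  have hw0 : w ≠ 0 := norm_pos_iff.1 ((norm_nonneg _).trans_lt (h 0 (by simp)))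
  refine hγ.integral_deriv_comp (G := fun z => Complex.log (1 - z / w))
    (G' := fun z => (z - w)⁻¹) (fun t ht => ?_) (continuousOn_inv_sub hc hw)
  have hz := h t ht
  have h1 : γ t - w ≠ 0 := fun h0 => hw ⟨t, ht, sub_eq_zero.1 h0⟩
  have hn : ‖γ t / w‖ < 1 := by
    rw [norm_div, div_lt_one (norm_pos_iff.2 hw0)]; exact hz
  have hslit : 1 - γ t / w ∈ Complex.slitPlane := by
    rw [sub_eq_add_neg]
    exact Complex.mem_slitPlane_of_norm_lt_one (by rwa [norm_neg])
  have hd : HasDerivAt (fun z => 1 - z / w) (-(1 / w)) (γ t) :=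
    ((hasDerivAt_id (γ t)).div_const w).const_sub 1
  convert! hd.clog hslit using 1
  have h2 : 1 - γ t / w = -(γ t - w) / w := by field_simp; ring
  rw [h2]
  field_simp

/-- Holomorphy of integrals depending on a parameter. -/
lemma differentiableOn_integral {F : ℂ → ℝ → ℂ} {η : ℝ → ℂ} {U : Set ℂ}
    (hη : IntervalIntegrable η volume 0 1)
    (hF : ∀ t ∈ Icc (0 : ℝ) 1, DifferentiableOn ℂ (fun z => F z t) U)
    (hFc : ∀ z ∈ U, ContinuousOn (F z) (Icc 0 1))
    (hFb : ∀ z ∈ U, ∃ r > 0, ∃ K, Metric.ball z r ⊆ U ∧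
      ∀ w ∈ Metric.ball z r, ∀ t ∈ Icc (0 : ℝ) 1, ‖F w t‖ ≤ K) :
    DifferentiableOn ℂ (fun z => ∫ t in (0 : ℝ)..1, η t * F z t) U := by
  intro z hz
  obtain ⟨r, hr, K, hrU, hK⟩ := hFb z hz
  have hsub : ∀ t ∈ uIoc (0 : ℝ) 1, t ∈ Icc (0 : ℝ) 1 := fun t ht => by
    rw [uIoc_of_le zero_le_one] at ht; exact Ioc_subset_Icc_self ht
  have hint : ∀ w ∈ U, IntervalIntegrable (fun t => η t * F w t) volume 0 1 := fun w hw =>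
    hη.mul_continuousOn (by rw [uIcc_of_le zero_le_one]; exact hFc w hw)
  have hmeas : ∀ w ∈ U, AEStronglyMeasurable (fun t => η t * F w t)
      (volume.restrict (uIoc (0 : ℝ) 1)) := fun w hw => (intervalIntegrable_iff.1 (hint w hw)).aestronglyMeasurable
  have hball : ∀ w ∈ Metric.ball z r, ∀ t ∈ Icc (0 : ℝ) 1,
      HasDerivAt (fun z => η t * F z t) (η t * deriv (fun z => F z t) w) w := fun w hw t ht =>
    (((hF t ht).mono hrU).differentiableAt (Metric.isOpen_ball.mem_nhds hw)).hasDerivAt.const_mul _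
  -- Cauchy's estimate on circles of radius r/4, which stay inside the ball of radius r, gives the
  -- dominating function.
  have hder : ∀ w ∈ Metric.ball z (r / 2), ∀ t ∈ Icc (0 : ℝ) 1,
      ‖deriv (fun z => F z t) w‖ ≤ K / (r / 4) := by
    intro w hw t ht
    have hcl : Metric.closedBall w (r / 4) ⊆ Metric.ball z r := by
      refine Metric.closedBall_subset_ball' ?_
      rw [Metric.mem_ball] at hw
      linarith
    refine Complex.norm_deriv_le_of_forall_mem_sphere_norm_le (by positivity)
      (((hF t ht).mono (hcl.trans hrU)).diffContOnCl_ball Subset.rfl) fun u hu => ?_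
    exact hK u (hcl (Metric.sphere_subset_closedBall hu)) t ht
  have key := intervalIntegral.hasDerivAt_integral_of_dominated_loc_of_deriv_le (μ := volume)
    (a := 0) (b := 1) (F := fun z t => η t * F z t)
    (F' := fun z t => η t * deriv (fun z => F z t) z) (x₀ := z)
    (bound := fun t => ‖η t‖ * (K / (r / 4)))
    (Metric.ball_mem_nhds z (half_pos hr)) ?_ (hint z hz) ?_ ?_ (hη.norm.mul_const _) ?_
  · exact key.2.differentiableAt.differentiableWithinAt
  · filter_upwards [Metric.ball_mem_nhds z hr] with w hw using hmeas w (hrU hw)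
  -- Measurability of the t-dependent derivative: it is a limit of difference quotients. The step
  -- r/(n+2) keeps the point in the open ball even for n = 0.
  · have hε : ∀ n : ℕ, z + ((r / (n + 2) : ℝ) : ℂ) ∈ Metric.ball z r := fun n => by
      rw [Metric.mem_ball, dist_eq_norm, add_sub_cancel_left, Complex.norm_real,
        Real.norm_of_nonneg (by positivity), div_lt_iff₀ (by positivity)]
      have : (0 : ℝ) ≤ n := Nat.cast_nonneg n
      nlinarith
    have hlim : Tendsto (fun n : ℕ => z + ((r / (n + 2) : ℝ) : ℂ)) atTop (𝓝[≠] z) := by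
      rw [tendsto_nhdsWithin_iff]
      constructor
      · have h1 : Tendsto (fun n : ℕ => r / ((n : ℝ) + 2)) atTop (𝓝 0) :=
          tendsto_const_nhds.div_atTop
            (tendsto_atTop_add_const_right _ _ tendsto_natCast_atTop_atTop)
        have h2 := (Complex.continuous_ofReal.tendsto 0).comp h1
        simpa using h2.const_add z
      · refine Eventually.of_forall fun n h => ?_
        have h3 : ((r / (n + 2) : ℝ) : ℂ) = 0 := by simpa using h
        have : (0 : ℝ) < r / (n + 2) := by positivity
        exact this.ne' (by exact_mod_cast h3)
    refine aestronglyMeasurable_of_tendsto_ae atTop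
      (f := fun (n : ℕ) t => slope (fun z => η t * F z t) z (z + ((r / (n + 2) : ℝ) : ℂ))) ?_ ?_
    · intro n
      simp only [slope, vsub_eq_sub]
      have h4 := ((hmeas _ (hrU (hε n))).sub (hmeas z hz)).const_smul
        (z + ((r / (n + 2) : ℝ) : ℂ) - z)⁻¹
      exact h4
    · refine (ae_restrict_iff' measurableSet_uIoc).2 (Eventually.of_forall fun t ht => ?_)
      exact (hball z (Metric.mem_ball_self hr) t (hsub t ht)).tendsto_slope.comp hlim
  · refine Eventually.of_forall fun t ht w hw => ?_
    rw [norm_mul]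
    gcongr
    exact hder w hw t (hsub t ht)
  · exact Eventually.of_forall fun t ht w hw =>
      hball w (Metric.ball_subset_ball (by linarith) hw) t (hsub t ht)

/-- For u near z the mean value inequality bounds the difference quotient by a bound for the
derivative; for u outside the ball of radius r the denominator is at least r/2. -/
lemma exists_norm_dslope_le {D : Set ℂ} (hD : IsOpen D) {Φ : ℂ → ℂ} (hΦ : DifferentiableOn ℂ Φ D)
    {k : Set ℂ} (hk : IsCompact k) (hkD : k ⊆ D) {z : ℂ} (hz : z ∈ D) :
    ∃ r > 0, ∃ K, Metric.ball z r ⊆ D ∧ ∀ w ∈ Metric.ball z r, ∀ u ∈ k, ‖dslope Φ u w‖ ≤ K := by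
  obtain ⟨r, hr, hrD⟩ := Metric.nhds_basis_closedBall.mem_iff.1 (hD.mem_nhds hz)
  obtain ⟨K₁, hK₁⟩ := hk.exists_bound_of_continuousOn (hΦ.continuousOn.mono hkD)
  obtain ⟨K₂, hK₂⟩ := (isCompact_closedBall z r).exists_bound_of_continuousOn
    (hΦ.continuousOn.mono hrD)
  obtain ⟨K₃, hK₃⟩ := (isCompact_closedBall z r).exists_bound_of_continuousOn
    ((hΦ.deriv hD).continuousOn.mono hrD)
  refine ⟨r / 2, half_pos hr, max K₃ ((K₁ + K₂) / (r / 2)),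
    (Metric.ball_subset_closedBall.trans (Metric.closedBall_subset_closedBall (by linarith))).trans
      hrD, fun w hw u hu => ?_⟩
  have hw' : w ∈ Metric.closedBall z r := by
    rw [Metric.mem_ball] at hw; rw [Metric.mem_closedBall]; linarith
  rcases eq_or_ne w u with rfl | hne
  · rw [dslope_same]; exact (hK₃ w hw').trans (le_max_left _ _)
  rw [dslope_of_ne _ hne, slope_def_module, norm_smul, norm_inv]
  have hpos : 0 < ‖w - u‖ := norm_pos_iff.2 (sub_ne_zero.2 hne)
  rw [inv_mul_le_iff₀ hpos]
  by_cases hur : u ∈ Metric.closedBall z r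
  · refine ((convex_closedBall z r).norm_image_sub_le_of_norm_deriv_le (𝕜 := ℂ)
      (fun x hx => hΦ.differentiableAt (hD.mem_nhds (hrD hx))) hK₃ hur hw').trans ?_
    rw [mul_comm]
    gcongr
    exact le_max_left _ _
  · rw [Metric.mem_ball, dist_eq_norm] at hw
    rw [Metric.mem_closedBall, dist_eq_norm, not_le] at hur
    have h1 : r / 2 ≤ ‖w - u‖ := by
      have := norm_sub_norm_le (u - z) (w - z)
      rw [sub_sub_sub_cancel_right, norm_sub_rev u w] at this
      linarith
    have h2 : ‖Φ w - Φ u‖ ≤ K₁ + K₂ := by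
      linarith [norm_sub_le (Φ w) (Φ u), hK₁ u hu, hK₂ w hw']
    have h3 : 0 ≤ K₁ + K₂ := (norm_nonneg _).trans h2
    calc ‖Φ w - Φ u‖ ≤ r / 2 * ((K₁ + K₂) / (r / 2)) := by
          rw [mul_div_cancel₀ _ (by positivity)]; exact h2
      _ ≤ ‖w - u‖ * max K₃ ((K₁ + K₂) / (r / 2)) :=
          mul_le_mul h1 (le_max_right _ _) (by positivity) (norm_nonneg _)

/-- The Cauchy integral formula for a closed contour that is null-homologous in `D` (Dixon). -/
theorem IsClosedContour.integral_div_sub {γ : ℝ → ℂ} (hγ : IsClosedContour γ) {D : Set ℂ}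
    (hD : IsOpen D) {Φ : ℂ → ℂ} (hΦ : DifferentiableOn ℂ Φ D)
    (hγD : ∀ t ∈ Icc (0 : ℝ) 1, γ t ∈ D) (hw : ∀ w ∉ D, windingNumber γ w = 0) {z : ℂ} (hz : z ∈ D)
    (hzγ : z ∉ γ '' Icc 0 1) :
    ∫ t in (0 : ℝ)..1, deriv γ t * (Φ (γ t) * (γ t - z)⁻¹) = windingIntegral γ z * Φ z := by
  obtain ⟨hc, hi, -⟩ := hγ.regular
  set k := γ '' Icc 0 1 with hk
  have hkc : IsCompact k := isCompact_Icc.image_of_continuousOn hc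
  have hkD : k ⊆ D := by rintro _ ⟨t, ht, rfl⟩; exact hγD t ht
  have hΦc : ContinuousOn (fun t => Φ (γ t)) (Icc 0 1) :=
    hΦ.continuousOn.comp hc fun t ht => hγD t ht
  set h₁ : ℂ → ℂ := fun z => ∫ t in (0 : ℝ)..1, deriv γ t * dslope Φ (γ t) z with hh₁
  set h₂ : ℂ → ℂ := fun z => ∫ t in (0 : ℝ)..1, deriv γ t * (Φ (γ t) * (γ t - z)⁻¹) with hh₂
  have hd₁ : DifferentiableOn ℂ h₁ D := by
    refine differentiableOn_integral hi
      (fun t ht => (Complex.differentiableOn_dslope (hD.mem_nhds (hγD t ht))).2 hΦ)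
      (fun w hwD => ?_) fun w hwD => ?_
    · have : ContinuousOn (dslope Φ w) D :=
        ((Complex.differentiableOn_dslope (hD.mem_nhds hwD)).2 hΦ).continuousOn
      refine (this.comp hc fun t ht => hγD t ht).congr fun t _ => ?_
      rcases eq_or_ne (γ t) w with h | h
      · simp [h]
      · rw [Function.comp_apply, dslope_of_ne _ h.symm, dslope_of_ne _ h, slope_comm]
    · obtain ⟨r, hr, K, hrD, hK⟩ := exists_norm_dslope_le hD hΦ hkc hkD hwD
      exact ⟨r, hr, K, hrD, fun u hu t ht => hK u hu _ ⟨t, ht, rfl⟩⟩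
  obtain ⟨K, hK⟩ := isCompact_Icc.exists_bound_of_continuousOn hΦc
  have hK0 : 0 ≤ K := (norm_nonneg _).trans (hK 0 (by simp))
  have hd₂ : DifferentiableOn ℂ h₂ kᶜ := by
    refine differentiableOn_integral hi (fun t ht w hwk => ?_)
      (fun w hwk => hΦc.mul (continuousOn_inv_sub hc hwk)) fun w hwk => ?_
    · have : γ t - w ≠ 0 := fun h => hwk ⟨t, ht, sub_eq_zero.1 h⟩
      have hd : DifferentiableAt ℂ (fun w => Φ (γ t) * (γ t - w)⁻¹) w :=
        ((differentiableAt_const _).sub differentiableAt_id).inv this |>.const_mul _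
      exact hd.differentiableWithinAt
    · obtain ⟨r, hr, hrk⟩ := Metric.nhds_basis_ball.mem_iff.1 (hkc.isClosed.isOpen_compl.mem_nhds hwk)
      refine ⟨r / 2, half_pos hr, K * (r / 2)⁻¹,
        (Metric.ball_subset_ball (by linarith)).trans hrk, fun u hu t ht => ?_⟩
      rw [norm_mul, norm_inv]
      have h1 : r ≤ ‖γ t - w‖ := by
        by_contra! hlt
        exact hrk (by rwa [Metric.mem_ball, dist_eq_norm]) ⟨t, ht, rfl⟩
      rw [Metric.mem_ball, dist_eq_norm] at hu
      have h2 : r / 2 ≤ ‖γ t - u‖ := by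
        have := norm_sub_norm_le (γ t - w) (u - w)
        rw [sub_sub_sub_cancel_right] at this
        linarith
      gcongr
      exact hK t ht
  have hsplit : ∀ w ∈ D, w ∉ k → h₁ w = h₂ w - windingIntegral γ w * Φ w := by
    intro w hwD hwk
    have hc2 := continuousOn_inv_sub hc hwk
    have i1 : IntervalIntegrable (fun t => deriv γ t * (Φ (γ t) * (γ t - w)⁻¹)) volume 0 1 :=
      hi.mul_continuousOn (by rw [uIcc_of_le zero_le_one]; exact hΦc.mul hc2)
    have i2 : IntervalIntegrable (fun t => deriv γ t * (γ t - w)⁻¹) volume 0 1 :=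
      hi.mul_continuousOn (by rwa [uIcc_of_le zero_le_one])
    simp only [hh₁, hh₂, windingIntegral]
    rw [← intervalIntegral.integral_mul_const, ← intervalIntegral.integral_sub i1 (i2.mul_const _)]
    refine intervalIntegral.integral_congr fun t ht => ?_
    rw [uIcc_of_le zero_le_one] at ht
    have hne : w ≠ γ t := fun h => hwk ⟨t, ht, h.symm⟩
    rw [dslope_of_ne _ hne, slope_comm, slope_def_field]
    ring
  -- V is open, contains the complement of D, and h₁ = h₂ on its intersection with D. So the two
  -- functions glue to an entire function.
  set V : Set ℂ := {w | w ∉ k ∧ windingIntegral γ w = 0} with hV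
  have hVnhds : ∀ w ∈ V, V ∈ 𝓝 w := by
    rintro w ⟨hwk, hw0⟩
    obtain ⟨r, hr, hrk⟩ := Metric.nhds_basis_ball.mem_iff.1 (hkc.isClosed.isOpen_compl.mem_nhds hwk)
    filter_upwards [Metric.ball_mem_nhds w hr] with u hu
    refine ⟨hrk hu, ?_⟩
    rw [hγ.windingIntegral_eq_of_near (w₀ := w) fun t ht => ?_, hw0]
    rw [Metric.mem_ball, dist_eq_norm] at hu
    refine hu.trans_le ?_
    by_contra! hlt
    exact hrk (by rwa [Metric.mem_ball, dist_eq_norm]) ⟨t, ht, rfl⟩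
  have hDV : ∀ w ∉ D, w ∈ V := fun w hwD =>
    ⟨fun h => hwD (hkD h), by rw [windingIntegral_eq, hw w hwD, mul_zero]⟩
  classical
  set h : ℂ → ℂ := fun w => if w ∈ D then h₁ w else h₂ w with hh
  have hhV : ∀ w ∈ V, h w = h₂ w := by
    intro w hwV
    by_cases hwD : w ∈ D
    · rw [hh]; dsimp only
      rw [if_pos hwD, hsplit w hwD hwV.1, hwV.2, zero_mul, sub_zero]
    · rw [hh]; dsimp only
      rw [if_neg hwD]
  have hdiff : Differentiable ℂ h := by
    intro w
    by_cases hwD : w ∈ D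
    · refine (hd₁.differentiableAt (hD.mem_nhds hwD)).congr_of_eventuallyEq ?_
      filter_upwards [hD.mem_nhds hwD] with u hu
      simp [hh, hu]
    · have hwV := hDV w hwD
      refine (hd₂.differentiableAt
        (hkc.isClosed.isOpen_compl.mem_nhds hwV.1)).congr_of_eventuallyEq ?_
      filter_upwards [hVnhds w hwV] with u hu using hhV u hu
  obtain ⟨ρ, hρ⟩ := isCompact_Icc.exists_bound_of_continuousOn hc
  have hlim : Tendsto h (cocompact ℂ) (𝓝 0) := by
    have hn : Tendsto (fun w : ℂ => ‖w‖) (cocompact ℂ) atTop := tendsto_norm_cocompact_atTop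
    have hbound : Tendsto (fun w : ℂ => (K * ∫ t in (0 : ℝ)..1, ‖deriv γ t‖) / (‖w‖ - ρ))
        (cocompact ℂ) (𝓝 0) :=
      tendsto_const_nhds.div_atTop (tendsto_atTop_add_const_right _ (-ρ) hn)
    refine squeeze_zero_norm' ?_ hbound
    filter_upwards [hn.eventually_gt_atTop ρ] with w hwρ
    have hfar : ∀ t ∈ Icc (0 : ℝ) 1, ‖γ t‖ < ‖w‖ := fun t ht => (hρ t ht).trans_lt hwρ
    have hwV : w ∈ V := by
      refine ⟨?_, hγ.windingIntegral_eq_zero hfar⟩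
      rintro ⟨t, ht, he⟩
      have := hfar t ht
      rw [he] at this
      exact lt_irrefl _ this
    rw [hhV w hwV, hh₂]
    dsimp only
    have hpos : 0 < ‖w‖ - ρ := sub_pos.2 hwρ
    have hle : ∀ t ∈ Icc (0 : ℝ) 1, ‖deriv γ t * (Φ (γ t) * (γ t - w)⁻¹)‖
        ≤ ‖deriv γ t‖ * (K * (‖w‖ - ρ)⁻¹) := by
      intro t ht
      rw [norm_mul, norm_mul, norm_inv]
      have : ‖w‖ - ρ ≤ ‖γ t - w‖ := by
        have := norm_sub_norm_le w (γ t)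
        rw [norm_sub_rev] at this
        linarith [hρ t ht]
      gcongr
      exact hK t ht
    calc _ ≤ ∫ t in (0 : ℝ)..1, ‖deriv γ t‖ * (K * (‖w‖ - ρ)⁻¹) := by
          refine intervalIntegral.norm_integral_le_of_norm_le zero_le_one
            (Eventually.of_forall fun t ht => hle t (Ioc_subset_Icc_self ht)) (hi.norm.mul_const _)
      _ = _ := by
          rw [intervalIntegral.integral_mul_const]; ring
  -- Liouville: an entire function vanishing at infinity is zero.
  have hzero := hdiff.apply_eq_of_tendsto_cocompact z hlim
  rw [hh] at hzero
  dsimp only at hzero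
  rw [if_pos hz, hsplit z hz hzγ, sub_eq_zero] at hzero
  exact hzero

end Contour

/-! ### From resolvent functions to filter functions by integration along the contour. -/

section ContourFunctional

open MeasureTheory

/-- A functional that is bounded on the functions `Re (w / (γ(t) - ·))` is bounded on the functions
that Cauchy's formula represents by the contour `γ`. -/
lemma abs_apply_le_of_contour {γ : ℝ → ℂ} (hγ : IsClosedContour γ) {D : Set ℂ}
    (hD : IsOpen D) {Φ : ℂ → ℂ} (hΦ : DifferentiableOn ℂ Φ D)
    (hγD : ∀ t ∈ Icc (0 : ℝ) 1, γ t ∈ D) (hw : ∀ w ∉ D, windingNumber γ w = 0)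
    (hID : ∀ l ∈ Icc (0 : ℝ) 1, (l : ℂ) ∈ D)
    (hIγ : ∀ l ∈ Icc (0 : ℝ) 1, ∀ t ∈ Icc (0 : ℝ) 1, γ t ≠ (l : ℂ))
    (hw1 : ∀ l ∈ Icc (0 : ℝ) 1, windingNumber γ (l : ℂ) = 1)
    (ℓ : C(Icc (0 : ℝ) 1, ℝ) →L[ℝ] ℝ) {c : ℝ}
    (hℓ : ∀ t ∈ Icc (0 : ℝ) 1, ∀ w : ℂ, ∀ f : C(Icc (0 : ℝ) 1, ℝ),
      (∀ l, f l = (w * (γ t - ((l : ℝ) : ℂ))⁻¹).re) → |ℓ f| ≤ c * ‖w‖)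
    {f : C(Icc (0 : ℝ) 1, ℝ)} (hf : ∀ l : Icc (0 : ℝ) 1, Φ ((l : ℝ) : ℂ) = (f l : ℂ)) :
    |ℓ f| ≤ c / (2 * Real.pi) * ∫ t in (0 : ℝ)..1, ‖Φ (γ t)‖ * ‖deriv γ t‖ := by
  obtain ⟨hc, hi, -⟩ := hγ.regular
  have hΦc : ContinuousOn (fun t => Φ (γ t)) (Icc 0 1) :=
    hΦ.continuousOn.comp hc fun t ht => hγD t ht
  have hcI : Continuous fun t : Icc (0 : ℝ) 1 => γ t := continuousOn_iff_continuous_domRestrict.1 hc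
  -- Currying the jointly continuous kernel gives a continuous curve in C([0,1]). Thus f becomes a
  -- Bochner integral in C([0,1]), and ℓ may be taken under the integral sign.
  let k : C(Icc (0 : ℝ) 1 × Icc (0 : ℝ) 1, ℂ) :=
    ⟨fun p => (γ p.1 - ((p.2 : ℝ) : ℂ))⁻¹, by
      refine Continuous.inv₀ ?_ fun p => sub_ne_zero.2 (hIγ _ p.2.2 _ p.1.2)
      exact (hcI.comp continuous_fst).sub
        (Complex.continuous_ofReal.comp (continuous_subtype_val.comp continuous_snd))⟩
  let K : ℝ → C(Icc (0 : ℝ) 1, ℂ) := fun t => k.curry (projIcc 0 1 zero_le_one t)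
  have hKc : Continuous K := k.curry.continuous.comp continuous_projIcc
  have hK : ∀ t ∈ Icc (0 : ℝ) 1, ∀ l : Icc (0 : ℝ) 1, K t l = (γ t - ((l : ℝ) : ℂ))⁻¹ := by
    intro t ht l
    simp only [K, projIcc_of_mem zero_le_one ht]
    rfl
  let ω : ℝ → ℂ := fun t => (2 * Real.pi * Complex.I)⁻¹ * (deriv γ t * Φ (γ t))
  have hω : IntervalIntegrable ω volume 0 1 :=
    (hi.mul_continuousOn (by rwa [uIcc_of_le zero_le_one])).const_mul _
  let reL : C(Icc (0 : ℝ) 1, ℂ) →L[ℝ] C(Icc (0 : ℝ) 1, ℝ) :=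
    Complex.reCLM.compLeftContinuous ℝ (Icc (0 : ℝ) 1)
  let G : ℝ → C(Icc (0 : ℝ) 1, ℝ) := fun t => reL (ω t • K t)
  have hωK : IntervalIntegrable (fun t => ω t • K t) volume 0 1 :=
    hω.smul_continuousOn hKc.continuousOn
  have hG : IntervalIntegrable G volume 0 1 :=
    ⟨reL.integrable_comp hωK.1, reL.integrable_comp hωK.2⟩
  have hGapply : ∀ t ∈ Icc (0 : ℝ) 1, ∀ l, G t l = (ω t * (γ t - ((l : ℝ) : ℂ))⁻¹).re := by
    intro t ht l
    rw [← hK t ht l]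
    rfl
  have hfG : f = ∫ t in (0 : ℝ)..1, G t := by
    ext l
    have hzγ : ((l : ℝ) : ℂ) ∉ γ '' Icc 0 1 := by
      rintro ⟨t, ht, he⟩
      exact hIγ l l.2 t ht he
    have h1 := hγ.integral_div_sub hD hΦ hγD hw (hID l l.2) hzγ
    rw [windingIntegral_eq, hw1 l l.2, mul_one, hf l] at h1
    have h2 : (f l : ℂ) = ∫ t in (0 : ℝ)..1, ω t * (γ t - ((l : ℝ) : ℂ))⁻¹ := by
      have : ∀ t, ω t * (γ t - ((l : ℝ) : ℂ))⁻¹ = (2 * Real.pi * Complex.I)⁻¹ *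
          (deriv γ t * (Φ (γ t) * (γ t - ((l : ℝ) : ℂ))⁻¹)) := fun t => by simp only [ω]; ring
      simp only [this]
      rw [intervalIntegral.integral_const_mul, h1, inv_mul_cancel_left₀ Complex.two_pi_I_ne_zero]
    have h3 : IntervalIntegrable (fun t => ω t * (γ t - ((l : ℝ) : ℂ))⁻¹) volume 0 1 :=
      hω.mul_continuousOn (by
        rw [uIcc_of_le zero_le_one]; exact continuousOn_inv_sub hc hzγ)
    have h4 : f l = ∫ t in (0 : ℝ)..1, (ω t * (γ t - ((l : ℝ) : ℂ))⁻¹).re := by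
      have h5 := Complex.reCLM.intervalIntegral_comp_comm h3
      rw [← h2] at h5
      exact h5.symm
    have h6 := (ContinuousMap.evalCLM ℝ l).intervalIntegral_comp_comm hG
    rw [h4]
    refine Eq.trans ?_ h6
    refine intervalIntegral.integral_congr fun t ht => ?_
    rw [uIcc_of_le zero_le_one] at ht
    exact (hGapply t ht l).symm
  rw [hfG, ← ℓ.intervalIntegral_comp_comm hG, ← Real.norm_eq_abs]
  calc ‖∫ t in (0 : ℝ)..1, ℓ (G t)‖ ≤ ∫ t in (0 : ℝ)..1, c * ‖ω t‖ := by
        refine intervalIntegral.norm_integral_le_of_norm_le zero_le_one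
          (Eventually.of_forall fun t ht => ?_) (hω.norm.const_mul _)
        exact hℓ t (Ioc_subset_Icc_self ht) (ω t) (G t) (hGapply t (Ioc_subset_Icc_self ht))
    _ = ∫ t in (0 : ℝ)..1, c / (2 * Real.pi) * (‖Φ (γ t)‖ * ‖deriv γ t‖) := by
        refine intervalIntegral.integral_congr fun t _ => ?_
        simp only [ω, norm_mul, norm_inv, Complex.norm_ofNat, Complex.norm_real, Complex.norm_I,
          Real.norm_of_nonneg Real.pi_pos.le]
        ring
    _ = _ := intervalIntegral.integral_const_mul _ _

variable {𝕜 X Y : Type*} [RCLike 𝕜] [NormedAddCommGroup X] [InnerProductSpace 𝕜 X]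
  [CompleteSpace X] [NormedAddCommGroup Y] [InnerProductSpace 𝕜 Y] [CompleteSpace Y]

/-- The linear functional `f ↦ Re ⟨A f(A*A) x - f(BB*) B x, y⟩` on `C([0, 1])`. -/
lemma exists_difference_functional {A B : X →L[𝕜] Y} (hA : ‖A‖ ≤ 1) (hB : ‖B‖ ≤ 1) (x : X) (y : Y) :
    ∃ ℓ : C(Icc (0 : ℝ) 1, ℝ) →L[ℝ] ℝ, ∀ (f : C(Icc (0 : ℝ) 1, ℝ)) (h : ℝ → ℝ),
      (∀ l : Icc (0 : ℝ) 1, f l = h l) →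
      ℓ f = RCLike.re (inner 𝕜 (A (fc (A.adjoint ∘L A) h x) - fc (B ∘L B.adjoint) h (B x)) y) := by
  have hS := isPositive_adjoint_comp_self A
  have hS' := isPositive_self_comp_adjoint B
  have hsA := Icc_zero_norm_subset hA
  have hsB := Icc_zero_norm_subset' hB
  let e : C(Icc (0 : ℝ) 1, ℝ) → ℝ → ℝ := fun f => IccExtend zero_le_one f
  have he : ∀ f s, ContinuousOn (e f) s := fun f s =>
    (f.continuous.Icc_extend').continuousOn
  have hel : ∀ f (t : ℝ) (ht : t ∈ Icc (0 : ℝ) 1), e f t = f ⟨t, ht⟩ := fun f t ht =>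
    IccExtend_of_mem zero_le_one f ht
  let L : C(Icc (0 : ℝ) 1, ℝ) →ₗ[ℝ] ℝ :=
    { toFun := fun f => RCLike.re (inner 𝕜
        (A (fc (A.adjoint ∘L A) (e f) x) - fc (B ∘L B.adjoint) (e f) (B x)) y)
      map_add' := fun f g => by
        have h1 : e (f + g) = fun t => e f t + e g t := rfl
        rw [h1, fc_add hS (he f _) (he g _), fc_add hS' (he f _) (he g _)]
        simp only [add_apply, map_add, inner_add_left, inner_sub_left, map_sub]
        ring
      map_smul' := fun c f => by
        have h1 : e (c • f) = fun t => c * e f t := rfl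
        rw [h1, fc_const_mul hS c (he f _), fc_const_mul hS' c (he f _)]
        simp only [smul_apply, map_smul, ← smul_sub, inner_smul_left, RCLike.conj_ofReal,
          RCLike.re_ofReal_mul, smul_eq_mul, RingHom.id_apply] }
  refine ⟨L.mkContinuous ((‖A‖ * ‖x‖ + ‖B x‖) * ‖y‖) fun f => ?_, fun f h hfh => ?_⟩
  · have hb : ∀ t ∈ Icc (0 : ℝ) 1, |e f t| ≤ ‖f‖ := fun t ht => by
      rw [hel f t ht]; exact f.norm_coe_le_norm _
    have h1 : ‖fc (A.adjoint ∘L A) (e f)‖ ≤ ‖f‖ :=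
      norm_fc_le hS (he f _) (norm_nonneg _) fun t ht => hb t (hsA ht)
    have h2 : ‖fc (B ∘L B.adjoint) (e f)‖ ≤ ‖f‖ :=
      norm_fc_le hS' (he f _) (norm_nonneg _) fun t ht => hb t (hsB ht)
    change |RCLike.re (inner 𝕜 _ y)| ≤ _
    refine (RCLike.abs_re_le_norm _).trans ((norm_inner_le_norm _ _).trans ?_)
    calc _ ≤ (‖A‖ * (‖f‖ * ‖x‖) + ‖f‖ * ‖B x‖) * ‖y‖ := by
          gcongr
          refine (norm_sub_le _ _).trans (add_le_add ?_ ?_)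
          · refine (A.le_opNorm _).trans ?_
            gcongr
            exact (ContinuousLinearMap.le_opNorm _ _).trans (by gcongr)
          · exact (ContinuousLinearMap.le_opNorm _ _).trans (by gcongr)
      _ = _ := by ring
  · have h1 : EqOn (e f) h (Icc 0 1) := fun t ht => by rw [hel f t ht, hfh]
    change RCLike.re (inner 𝕜 (A (fc (A.adjoint ∘L A) (e f) x)
      - fc (B ∘L B.adjoint) (e f) (B x)) y) = _
    rw [fc_congr (h1.mono hsA), fc_congr (h1.mono hsB)]

lemma norm_le_of_forall_re_inner_le {v : Y} {c : ℝ} (hc : 0 ≤ c)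
    (h : ∀ y, |RCLike.re (inner 𝕜 v y)| ≤ c * ‖y‖) : ‖v‖ ≤ c := by
  have h1 := h v
  rw [inner_self_eq_norm_sq, abs_of_nonneg (by positivity), sq] at h1
  rcases (norm_nonneg v).eq_or_lt with h0 | h0
  · rw [← h0]; exact hc
  · exact le_of_mul_le_mul_right h1 h0

variable {A B : X →L[𝕜] Y} {R g : ℝ → ℝ} {α σ ν μ κ b₀ b₁ : ℝ}

lemma fc_mul_sub_mul {T : X →L[𝕜] X} (hT : T.IsPositive) {u v : ℝ → ℝ} (c d : ℝ)
    (hu : ContinuousOn u (Icc 0 ‖T‖)) (hv : ContinuousOn v (Icc 0 ‖T‖)) :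
    fc T (fun l => c * u l - d * v l) = (c : 𝕜) • fc T u - (d : 𝕜) • fc T v := by
  rw [fc_sub (f := fun l : ℝ => c * u l) (g := fun l : ℝ => d * v l) hT
    (continuousOn_const.mul hu) (continuousOn_const.mul hv), fc_const_mul hT _ hu,
    fc_const_mul hT _ hv]

/-- With u + iv = 1/(z - l), the function is Re w · u - Im w · v; each of the two parts costs 32‖w‖,
whence 64. -/
lemma norm_complex_resolvent_difference_le (hA : ‖A‖ ≤ 1) (hB : ‖B‖ ≤ 1) (hα : 0 < α)
    (hσ : α⁻¹ ≤ σ)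
    (hb₀ : 0 ≤ b₀) (hκ : 0 ≤ κ) (hμ : μ ∈ Icc (-(1 / 2) : ℝ) (1 / 2))
    (hν : ν ∈ Icc (-μ) (1 / 2)) (hDA : WeightedBound (A.adjoint ∘L A) (A - B) μ κ)
    (hDB : WeightedBound (B.adjoint ∘L B) (A - B) μ κ)
    (hRc : ContinuousOn R (Icc 0 1)) (hR0 : ∀ t ∈ Icc (0 : ℝ) 1, 0 ≤ R t)
    (hR : ∀ θ ∈ Icc (0 : ℝ) 1, ∀ t ∈ Icc (0 : ℝ) 1,
      t ^ θ * R t * (α + t)⁻¹ ≤ 2 * α⁻¹ * σ ^ (-θ)) {z : ℂ} (hz : α / 2 ≤ ‖z‖)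
    (hzl : ∀ l ∈ Icc (0 : ℝ) 1, ‖z‖ + l ≤ b₀ * ‖z - (l : ℂ)‖) (w : ℂ) (x : X) :
    ‖A (fc (A.adjoint ∘L A) (fun l => (w * (z - (l : ℂ))⁻¹).re)
        (fc (A.adjoint ∘L A) (fun t => R t * t ^ max ν 0) x))
      - fc (B ∘L B.adjoint) (fun l => (w * (z - (l : ℂ))⁻¹).re)
        (B (fc (A.adjoint ∘L A) (fun t => R t * t ^ max ν 0) x))‖ ≤
      64 * b₀ ^ 2 * (κ * α⁻¹ * σ ^ (-(ν + μ)) *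
        ‖fc (A.adjoint ∘L A) (fun t => t ^ max (-ν) 0) x‖) * ‖w‖ := by
  have hsA := Icc_zero_norm_subset hA
  have hsB := Icc_zero_norm_subset' hB
  have hS := isPositive_adjoint_comp_self A
  have hS' := isPositive_self_comp_adjoint B
  have hpos : ∀ l ∈ Icc (0 : ℝ) 1, 0 < ‖z - (l : ℂ)‖ := fun l hl => by
    by_contra! hneg
    have h := hzl l hl
    rw [le_antisymm hneg (norm_nonneg _), mul_zero] at h
    linarith [hl.1]
  have hne : ∀ l ∈ Icc (0 : ℝ) 1, z - (l : ℂ) ≠ 0 := fun l hl => norm_pos_iff.1 (hpos l hl)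
  have hrc : ContinuousOn (fun l : ℝ => (z - (l : ℂ))⁻¹) (Icc 0 1) :=
    ContinuousOn.inv₀ (by fun_prop) hne
  have huc : ContinuousOn (fun l : ℝ => ((z - (l : ℂ))⁻¹).re) (Icc 0 1) :=
    Complex.continuous_re.comp_continuousOn hrc
  have hvc : ContinuousOn (fun l : ℝ => ((z - (l : ℂ))⁻¹).im) (Icc 0 1) :=
    Complex.continuous_im.comp_continuousOn hrc
  have hnb : ∀ l ∈ Icc (0 : ℝ) 1, ‖(z - (l : ℂ))⁻¹‖ ≤ b₀ * (‖z‖ + l)⁻¹ := by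
    intro l hl
    have h2 : 0 < ‖z‖ + l := by linarith [hl.1]
    rw [norm_inv, ← div_eq_mul_inv, le_div_iff₀ h2, inv_mul_le_iff₀ (hpos l hl), mul_comm]
    exact hzl l hl
  have h := norm_resolvent_difference_le hA hB hα hσ hz hb₀ hκ hμ hν
    hDA hDB hRc hR0 hR huc hvc
    (fun l hl => (Complex.abs_re_le_norm _).trans (hnb l hl))
    (fun l hl => (Complex.abs_im_le_norm _).trans (hnb l hl))
    (Complex.abs_re_le_norm z) (Complex.abs_im_le_norm z)
    (fun l hl => by
      have := congrArg Complex.re (mul_inv_cancel₀ (hne l hl))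
      rw [Complex.mul_re] at this
      simpa using this)
    (fun l hl => by
      have := congrArg Complex.im (mul_inv_cancel₀ (hne l hl))
      rw [Complex.mul_im] at this
      simpa using this) x
  dsimp only at h
  generalize fc (A.adjoint ∘L A) (fun t => R t * t ^ max ν 0) x = x' at h ⊢
  simp only [Complex.mul_re]
  rw [fc_mul_sub_mul hS w.re w.im (huc.mono hsA) (hvc.mono hsA),
    fc_mul_sub_mul hS' w.re w.im (huc.mono hsB) (hvc.mono hsB)]
  have e1 : ∀ (a b : X →L[𝕜] X) (c d : Y →L[𝕜] Y),
      A (((w.re : 𝕜) • a - (w.im : 𝕜) • b) x') - ((w.re : 𝕜) • c - (w.im : 𝕜) • d) (B x')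
      = (w.re : 𝕜) • (A (a x') - c (B x')) - (w.im : 𝕜) • (A (b x') - d (B x')) := by
    intro a b c d
    simp only [sub_apply, smul_apply, map_sub, map_smul]
    module
  rw [e1]
  generalize ‖fc (A.adjoint ∘L A) (fun t => t ^ max (-ν) 0) x‖ = N at h ⊢
  refine (norm_sub_le _ _).trans ?_
  rw [norm_smul, norm_smul, RCLike.norm_ofReal, RCLike.norm_ofReal]
  have h1 := mul_le_mul (Complex.abs_re_le_norm w) h.1 (norm_nonneg _) (norm_nonneg _)
  have h2 := mul_le_mul (Complex.abs_im_le_norm w) h.2 (norm_nonneg _) (norm_nonneg _)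
  refine (add_le_add h1 h2).trans_eq ?_
  ring

/-- The splitting g = 1/(α + ·) + φ: one resolvent estimate at z = -α costs 32, and the contour
integral of φ costs 64 b₀² b₁. -/
lemma norm_filter_difference_le (hA : ‖A‖ ≤ 1) (hB : ‖B‖ ≤ 1) (hα : 0 < α) (hσ : α⁻¹ ≤ σ)
    (hκ : 0 ≤ κ) (hμ : μ ∈ Icc (-(1 / 2) : ℝ) (1 / 2))
    (hν : ν ∈ Icc (-μ) (1 / 2)) (hDA : WeightedBound (A.adjoint ∘L A) (A - B) μ κ)
    (hDB : WeightedBound (B.adjoint ∘L B) (A - B) μ κ)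
    (hRc : ContinuousOn R (Icc 0 1)) (hR0 : ∀ t ∈ Icc (0 : ℝ) 1, 0 ≤ R t)
    (hR : ∀ θ ∈ Icc (0 : ℝ) 1, ∀ t ∈ Icc (0 : ℝ) 1,
      t ^ θ * R t * (α + t)⁻¹ ≤ 2 * α⁻¹ * σ ^ (-θ))
    {γ : ℝ → ℂ} (hγ : IsClosedContour γ) {D : Set ℂ}
    (hD : IsOpen D) {Φ : ℂ → ℂ} (hΦ : DifferentiableOn ℂ Φ D)
    (hγD : ∀ t ∈ Icc (0 : ℝ) 1, γ t ∈ D) (hw : ∀ w ∉ D, windingNumber γ w = 0)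
    (hID : ∀ l ∈ Icc (0 : ℝ) 1, (l : ℂ) ∈ D)
    (hw1 : ∀ l ∈ Icc (0 : ℝ) 1, windingNumber γ (l : ℂ) = 1)
    (hΦg : ∀ l ∈ Icc (0 : ℝ) 1, Φ (l : ℂ) = ((g l - 1 / (α + l) : ℝ) : ℂ))
    (hγb : ∀ t ∈ Icc (0 : ℝ) 1, α / 2 ≤ ‖γ t‖ ∧
      ∀ l ∈ Icc (0 : ℝ) 1, ‖γ t‖ + l ≤ b₀ * ‖γ t - (l : ℂ)‖)
    (hb₁ : ∫ t in (0 : ℝ)..1, ‖Φ (γ t)‖ * ‖deriv γ t‖ ≤ b₁) (x : X) :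
    let x' := fc (A.adjoint ∘L A) (fun t => R t * t ^ max ν 0) x
    ‖A (fc (A.adjoint ∘L A) g x') - fc (B ∘L B.adjoint) g (B x')‖ ≤
      (32 + 64 * b₀ ^ 2 * b₁) * (κ * α⁻¹ * σ ^ (-(ν + μ)) *
        ‖fc (A.adjoint ∘L A) (fun t => t ^ max (-ν) 0) x‖) := by
  intro x'
  set E := κ * α⁻¹ * σ ^ (-(ν + μ)) * ‖fc (A.adjoint ∘L A) (fun t => t ^ max (-ν) 0) x‖ with hE
  have hσ0 : 0 < σ := (inv_pos.2 hα).trans_le hσ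
  have hE0 : 0 ≤ E := by positivity
  have hsA := Icc_zero_norm_subset hA
  have hsB := Icc_zero_norm_subset' hB
  have hS := isPositive_adjoint_comp_self A
  have hS' := isPositive_self_comp_adjoint B
  have hb₀ : 0 ≤ b₀ := by
    have h := hγb 0 (by simp)
    have h2 := h.2 0 (by simp)
    by_contra! hneg
    nlinarith [norm_nonneg (γ 0 - ((0 : ℝ) : ℂ))]
  have hb₁0 : 0 ≤ b₁ := le_trans
    (intervalIntegral.integral_nonneg zero_le_one fun t _ => by positivity) hb₁
  have hγne : ∀ l ∈ Icc (0 : ℝ) 1, ∀ t ∈ Icc (0 : ℝ) 1, γ t ≠ (l : ℂ) := by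
    intro l hl t ht h
    have h1 := (hγb t ht).1
    have h2 := (hγb t ht).2 l hl
    rw [h, sub_self, norm_zero, mul_zero, ← h] at h2
    linarith [hl.1]
  have hφc : ContinuousOn (fun l => g l - 1 / (α + l)) (Icc 0 1) := by
    have h1 : ContinuousOn (fun l : ℝ => (Φ (l : ℂ)).re) (Icc 0 1) :=
      Complex.continuous_re.comp_continuousOn
        (hΦ.continuousOn.comp Complex.continuous_ofReal.continuousOn hID)
    refine h1.congr fun l hl => ?_
    change _ = (Φ (l : ℂ)).re
    rw [hΦg l hl, Complex.ofReal_re]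
  have hic : ContinuousOn (fun l : ℝ => 1 / (α + l)) (Icc 0 1) :=
    continuousOn_const.div (continuousOn_const.add continuousOn_id) fun l hl => by
      have : 0 < α + l := by linarith [hl.1]
      exact this.ne'
  -- the resolvent part
  have part1 : ‖A (fc (A.adjoint ∘L A) (fun l => 1 / (α + l)) x')
      - fc (B ∘L B.adjoint) (fun l => 1 / (α + l)) (B x')‖ ≤ 32 * E := by
    -- Here z = -α, so r = α, the constant b₀ is 1, and the resolvent function is real: u = -1/(α +
    -- l), v = 0.
    have h := (norm_resolvent_difference_le hA hB hα hσ (half_le_self hα.le) zero_le_one hκ hμ hν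
      hDA hDB hRc hR0 hR (u := fun l => -(1 / (α + l))) (v := fun _ => 0) hic.neg continuousOn_const
      (fun t ht => by
        have : 0 < α + t := by linarith [ht.1]
        rw [abs_neg, abs_of_pos (by positivity), one_div, one_mul])
      (fun t ht => by
        have : 0 < α + t := by linarith [ht.1]
        rw [abs_zero]; positivity)
      (p := -α) (q := 0) (by rw [abs_neg, abs_of_pos hα]) (by rw [abs_zero]; exact hα.le)
      (fun t ht => by
        have : 0 < α + t := by linarith [ht.1]
        field_simp; ring)
      (fun t _ => by ring) x).1
    rw [fc_neg hS (hic.mono hsA), fc_neg hS' (hic.mono hsB)] at h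
    simp only [neg_apply, map_neg] at h
    rw [neg_sub_neg, norm_sub_rev] at h
    refine h.trans_eq ?_
    rw [hE]; ring
  have part2 : ‖A (fc (A.adjoint ∘L A) (fun l => g l - 1 / (α + l)) x')
      - fc (B ∘L B.adjoint) (fun l => g l - 1 / (α + l)) (B x')‖ ≤ 64 * b₀ ^ 2 * b₁ * E := by
    -- Testing against y reduces the contour integral of operators to a real functional on C([0,1]).
    refine norm_le_of_forall_re_inner_le (𝕜 := 𝕜) (by positivity) fun y => ?_
    obtain ⟨ℓ, hℓ⟩ := exists_difference_functional hA hB x' y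
    let f : C(Icc (0 : ℝ) 1, ℝ) :=
      ⟨(Icc (0 : ℝ) 1).domRestrict fun l => g l - 1 / (α + l),
        continuousOn_iff_continuous_domRestrict.1 hφc⟩
    rw [← hℓ f _ fun l => rfl]
    have hbound := abs_apply_le_of_contour hγ hD hΦ hγD hw hID hγne hw1 ℓ
      (c := 64 * b₀ ^ 2 * E * ‖y‖) (f := f) ?_ (fun l => hΦg l l.2)
    · refine hbound.trans ?_
      have hpi : 1 ≤ 2 * Real.pi := by linarith [Real.pi_gt_three]
      have hJ : 0 ≤ ∫ t in (0 : ℝ)..1, ‖Φ (γ t)‖ * ‖deriv γ t‖ :=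
        intervalIntegral.integral_nonneg zero_le_one fun t _ => by positivity
      calc _ ≤ 64 * b₀ ^ 2 * E * ‖y‖ / 1 * b₁ := by gcongr
        _ = _ := by ring
    · intro t ht w f' hf'
      rw [hℓ f' (fun l => (w * (γ t - (l : ℂ))⁻¹).re) hf']
      refine (RCLike.abs_re_le_norm _).trans ((norm_inner_le_norm _ _).trans ?_)
      have h := norm_complex_resolvent_difference_le hA hB hα hσ hb₀ hκ hμ hν hDA hDB hRc hR0 hR
        (hγb t ht).1 (hγb t ht).2 w x
      exact (mul_le_mul_of_nonneg_right h (norm_nonneg y)).trans_eq (by rw [hE]; ring)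
  have hg : ∀ t, g t = 1 / (α + t) + (g t - 1 / (α + t)) := fun t => by ring
  have eg1 : fc (A.adjoint ∘L A) g = fc (A.adjoint ∘L A) (fun l => 1 / (α + l))
      + fc (A.adjoint ∘L A) (fun l => g l - 1 / (α + l)) := by
    rw [← fc_add hS (hic.mono hsA) (hφc.mono hsA)]
    exact congrArg _ (funext hg)
  have eg2 : fc (B ∘L B.adjoint) g = fc (B ∘L B.adjoint) (fun l => 1 / (α + l))
      + fc (B ∘L B.adjoint) (fun l => g l - 1 / (α + l)) := by
    rw [← fc_add hS' (hic.mono hsB) (hφc.mono hsB)]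
    exact congrArg _ (funext hg)
  rw [eg1, eg2]
  simp only [add_apply, map_add]
  rw [add_sub_add_comm, add_mul]
  exact (norm_add_le _ _).trans (add_le_add part1 part2)

end ContourFunctional

/-! ### The Hilbert scale, range inclusion, and the weighted bound for the scaled derivatives. -/

section Scale

variable {𝕜 X Y : Type*} [RCLike 𝕜] [NormedAddCommGroup X] [InnerProductSpace 𝕜 X]
  [CompleteSpace X] [NormedAddCommGroup Y] [InnerProductSpace 𝕜 Y] [CompleteSpace Y]

lemma IsScaleGenerator.inner_apply_left {L : X →ₗ.[𝕜] X} (hL : IsScaleGenerator L)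
    (x y : L.domain) : inner 𝕜 (L x) (y : X) = inner 𝕜 (x : X) (L y) := by
  have h := LinearPMap.adjoint_isFormalAdjoint hL.dense
  rw [LinearPMap.isSelfAdjoint_def.1 hL.selfAdjoint] at h
  exact h x y

/-- The range of L is dense, and on vectors Lu symmetry and positivity of the inverse are those of
L. -/
lemma IsScaleGenerator.isPositive_boundedInverse {L : X →ₗ.[𝕜] X} (hL : IsScaleGenerator L) :
    (boundedInverse L).IsPositive := by
  have hd := hL.denseRange
  obtain ⟨θ, hθ, hpos⟩ := hL.strictlyPositive
  rw [ContinuousLinearMap.isPositive_def]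
  constructor
  · intro x y
    change inner 𝕜 (boundedInverse L x) y = inner 𝕜 x (boundedInverse L y)
    refine hd.induction_on₂ (p := fun x y =>
      inner 𝕜 (boundedInverse L x) y = inner 𝕜 x (boundedInverse L y)) ?_ (fun u v => ?_) x y
    · exact isClosed_eq (by fun_prop) (by fun_prop)
    · change inner 𝕜 (boundedInverse L (L u)) (L v) = inner 𝕜 (L u) (boundedInverse L (L v))
      rw [hL.boundedInverse_apply, hL.boundedInverse_apply, hL.inner_apply_left]
  · intro x
    refine hd.induction_on (p := fun x => 0 ≤ (boundedInverse L).reApplyInnerSelf x) x ?_ fun u => ?_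
    · exact isClosed_le continuous_const (boundedInverse L).reApplyInnerSelf_continuous
    · change 0 ≤ RCLike.re (inner 𝕜 (boundedInverse L (L u)) (L u))
      rw [hL.boundedInverse_apply, ← hL.inner_apply_left]
      have := hpos u
      exact nonneg_of_mul_nonneg_right ((sq_nonneg _).trans this) hθ

/-- The kernel of a self-adjoint operator is the orthogonal complement of its range. -/
lemma injective_iff_denseRange_of_isSelfAdjoint {Q : X →L[𝕜] X} (hQ : IsSelfAdjoint Q) :
    Function.Injective Q ↔ DenseRange Q := by
  have h1 : (LinearMap.range (Q : X →ₗ[𝕜] X))ᗮ = LinearMap.ker (Q : X →ₗ[𝕜] X) := by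
    have := Q.orthogonal_range
    rwa [show Q.adjoint = Q from hQ] at this
  have h2 : DenseRange Q ↔ Dense ((LinearMap.range (Q : X →ₗ[𝕜] X) : Submodule 𝕜 X) : Set X) :=
    Iff.rfl
  rw [h2, Submodule.dense_iff_topologicalClosure_eq_top, Submodule.topologicalClosure_eq_top_iff,
    h1]
  exact LinearMap.ker_eq_bot.symm

lemma IsScaleGenerator.injective_boundedInverse {L : X →ₗ.[𝕜] X} (hL : IsScaleGenerator L) :
    Function.Injective (boundedInverse L) := by
  rw [injective_iff_denseRange_of_isSelfAdjoint hL.isPositive_boundedInverse.isSelfAdjoint]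
  refine hL.dense.mono ?_
  intro x hx
  exact ⟨L ⟨x, hx⟩, hL.boundedInverse_apply ⟨x, hx⟩⟩

section Powers

variable {P : X →L[𝕜] X} {r s : ℝ}

lemma posPow_zero (hP : P.IsPositive) : posPow P 0 = 1 := by
  rw [posPow, ← fc_one hP]
  simp only [Real.rpow_zero]

lemma posPow_add_apply (hP : P.IsPositive) (hr : 0 ≤ r) (hs : 0 ≤ s) (x : X) :
    posPow P (r + s) x = posPow P r (posPow P s x) := by
  rw [posPow, posPow, posPow, ← fc_mul_apply hP (continuousOn_rpow hr _) (continuousOn_rpow hs _)]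
  refine congrArg (fun T : X →L[𝕜] X => T x) (fc_congr fun t ht => ?_)
  exact Real.rpow_add_of_nonneg ht.1 hr hs

lemma isSelfAdjoint_posPow (hP : P.IsPositive) : IsSelfAdjoint (posPow P r) :=
  isSelfAdjoint_fc hP _

/-- For an integer n ≥ r, the injective operator P^n factors as P^(n-r) P^r. -/
lemma injective_posPow (hP : P.IsPositive) (hi : Function.Injective P) (hr : 0 ≤ r) :
    Function.Injective (posPow P r) := by
  obtain ⟨n, hn⟩ := exists_nat_ge r
  have h1 : ∀ x, (P ^ n) x = posPow P (n - r) (posPow P r x) := fun x => by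
    rw [← posPow_add_apply hP (sub_nonneg.2 hn) hr, sub_add_cancel, posPow, ← fc_pow hP]
    simp only [Real.rpow_natCast]
  have h2 : Function.Injective (P ^ n) := by
    clear hn h1
    induction n with
    | zero => exact Function.injective_id
    | succ n ih => rw [pow_succ]; exact ih.comp hi
  intro x y hxy
  refine h2 ?_
  rw [h1, h1, hxy]

lemma denseRange_posPow (hP : P.IsPositive) (hi : Function.Injective P) (hr : 0 ≤ r) :
    DenseRange (posPow P r) :=
  (injective_iff_denseRange_of_isSelfAdjoint (isSelfAdjoint_posPow hP)).1 (injective_posPow hP hi hr)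

end Powers

section InverseOfInjective

variable {Q : X →L[𝕜] X}

lemma ker_toPMap_top (hQ : Function.Injective Q) :
    LinearMap.ker (Q.toLinearMap.toPMap ⊤).toFun = ⊥ := by
  rw [LinearMap.ker_eq_bot]
  intro x y h
  exact Subtype.ext (hQ h)

lemma mem_inverse_domain (x : X) : Q x ∈ (Q.toLinearMap.toPMap ⊤).inverse.domain := by
  rw [LinearPMap.inverse_domain]
  exact ⟨⟨x, trivial⟩, rfl⟩

lemma exists_of_mem_inverse_domain {y : X} (hy : y ∈ (Q.toLinearMap.toPMap ⊤).inverse.domain) :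
    ∃ x, Q x = y := by
  rw [LinearPMap.inverse_domain] at hy
  obtain ⟨x, hx⟩ := hy
  exact ⟨x, hx⟩

lemma inverse_apply_apply (hQ : Function.Injective Q) {x y : X} (hxy : Q x = y)
    (hy : y ∈ (Q.toLinearMap.toPMap ⊤).inverse.domain) :
    (Q.toLinearMap.toPMap ⊤).inverse ⟨y, hy⟩ = x :=
  LinearPMap.inverse_apply_eq (ker_toPMap_top hQ) (x := ⟨x, trivial⟩) hxy

lemma compNormLE_inverse_iff (hQ : Function.Injective Q) {V : Y →L[𝕜] X} {c : ℝ} :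
    CompNormLE (Q.toLinearMap.toPMap ⊤).inverse V c ↔
      ∀ y, ∃ x, V y = Q x ∧ ‖x‖ ≤ c * ‖y‖ := by
  refine forall_congr' fun y => ?_
  constructor
  · rintro ⟨hy, h⟩
    obtain ⟨x, hx⟩ := exists_of_mem_inverse_domain hy
    exact ⟨x, hx.symm, by rwa [inverse_apply_apply hQ hx] at h⟩
  · rintro ⟨x, hx, h⟩
    have hy : V y ∈ (Q.toLinearMap.toPMap ⊤).inverse.domain := hx ▸ mem_inverse_domain x
    exact ⟨hy, by rwa [inverse_apply_apply hQ hx.symm]⟩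

/-- Douglas' range inclusion lemma. -/
lemma exists_eq_apply_of_norm_adjoint_le (hQs : IsSelfAdjoint Q) (hQ : Function.Injective Q)
    {V : Y →L[𝕜] X} {c : ℝ} (hc : 0 ≤ c) (h : ∀ x, ‖V.adjoint x‖ ≤ c * ‖Q x‖) (y : Y) :
    ∃ x, V y = Q x ∧ ‖x‖ ≤ c * ‖y‖ := by
  have hd : DenseRange Q := (injective_iff_denseRange_of_isSelfAdjoint hQs).1 hQ
  -- Z is defined by Z Q = V* on the dense range of Q; taking adjoints gives V = Q Z*.
  set Z : X →L[𝕜] Y := V.adjoint.toLinearMap.extendOfNorm Q.toLinearMap with hZ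
  have hZQ : ∀ x, Z (Q x) = V.adjoint x := fun x =>
    LinearMap.extendOfNorm_eq (f := V.adjoint.toLinearMap) (e := Q.toLinearMap) hd ⟨c, h⟩ x
  have hZn : ∀ x, ‖Z x‖ ≤ c * ‖x‖ := fun x =>
    LinearMap.norm_extendOfNorm_apply_le (f := V.adjoint.toLinearMap) (e := Q.toLinearMap) hd c h x
  refine ⟨Z.adjoint y, ?_, norm_adjoint_apply_le hc hZn y⟩
  refine ext_inner_right 𝕜 fun x => ?_
  have hQx : inner 𝕜 (Q (Z.adjoint y)) x = inner 𝕜 (Z.adjoint y) (Q x) := hQs.isSymmetric _ _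
  rw [hQx, ContinuousLinearMap.adjoint_inner_left, hZQ, ContinuousLinearMap.adjoint_inner_right]

end InverseOfInjective

lemma compNormLE_opPow_of_nonneg {P : X →L[𝕜] X} {V : Y →L[𝕜] X} {r c : ℝ} (hr : 0 ≤ r) :
    CompNormLE (opPow P r) V c ↔ ∀ y, ‖posPow P r (V y)‖ ≤ c * ‖y‖ := by
  rw [opPow, if_pos hr]
  exact ⟨fun h y => (h y).2, fun h y => ⟨trivial, h y⟩⟩

lemma compNormLE_opPow_of_neg {P : X →L[𝕜] X} (hP : P.IsPositive) (hi : Function.Injective P)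
    {V : Y →L[𝕜] X} {r c : ℝ} (hr : r < 0) :
    CompNormLE (opPow P r) V c ↔ ∀ y, ∃ x, V y = posPow P (-r) x ∧ ‖x‖ ≤ c * ‖y‖ := by
  rw [opPow, if_neg (not_le.2 hr)]
  exact compNormLE_inverse_iff (injective_posPow hP hi (neg_nonneg.2 hr.le))

/-- Duality: write (T₁* - T₂*) y = L^{-b} k and test with y = (T₁ - T₂) x, so that ‖y‖² = ⟨k, L^{-b}
x⟩. -/
lemma norm_sub_apply_le_of_compNormLE {L : X →ₗ.[𝕜] X} (hL : IsScaleGenerator L) {b K : ℝ}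
    (hb : 0 ≤ b) (hK : 0 ≤ K) {T₁ T₂ : X →L[𝕜] Y}
    (h : CompNormLE (scalePow L b) (T₁.adjoint - T₂.adjoint) K) (x : X) :
    ‖T₁ x - T₂ x‖ ≤ K * ‖posPow (boundedInverse L) b x‖ := by
  have hP := hL.isPositive_boundedInverse
  have hi := hL.injective_boundedInverse
  have hex : ∀ y, ∃ k, (T₁.adjoint - T₂.adjoint) y = posPow (boundedInverse L) b k ∧
      ‖k‖ ≤ K * ‖y‖ := by
    rcases hb.eq_or_lt with rfl | hb'
    · rw [scalePow, neg_zero, compNormLE_opPow_of_nonneg le_rfl, posPow_zero hP] at h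
      intro y
      rw [posPow_zero hP]
      exact ⟨_, rfl, h y⟩
    · rwa [scalePow, compNormLE_opPow_of_neg hP hi (neg_lt_zero.2 hb'), neg_neg] at h
  obtain ⟨k, hk, hkn⟩ := hex (T₁ x - T₂ x)
  set y := T₁ x - T₂ x
  have h1 : inner 𝕜 y y = inner 𝕜 k (posPow (boundedInverse L) b x) := by
    have h2 : inner 𝕜 ((T₁.adjoint - T₂.adjoint) y) x = inner 𝕜 y (T₁ x - T₂ x) := by
      rw [sub_apply, inner_sub_left, ContinuousLinearMap.adjoint_inner_left,
        ContinuousLinearMap.adjoint_inner_left, ← inner_sub_right]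
    rw [← h2, hk]
    exact (isSelfAdjoint_posPow hP).isSymmetric _ _
  have h2 : ‖y‖ * ‖y‖ ≤ (K * ‖posPow (boundedInverse L) b x‖) * ‖y‖ := by
    rw [← sq, ← inner_self_eq_norm_sq (𝕜 := 𝕜), h1]
    calc _ ≤ ‖k‖ * ‖posPow (boundedInverse L) b x‖ := re_inner_le_norm _ _
      _ ≤ K * ‖y‖ * ‖posPow (boundedInverse L) b x‖ := by gcongr
      _ = _ := by ring
  rcases (norm_nonneg y).eq_or_lt with h0 | h0
  · rw [← h0]; positivity
  · exact le_of_mul_le_mul_right h2 h0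

section ScaledOperator

variable {L : X →ₗ.[𝕜] X} {T : X →L[𝕜] Y} {a s m M : ℝ}

/-- `T L ^ (-s) L ^ (-s₋) = T L ^ (-s₊)` for the positive and negative part of `s`. -/
lemma scaledOperator_posPow_apply (hL : IsScaleGenerator L) (ha : 0 ≤ a) (hs : -a < s) (hM : 0 ≤ M)
    (hT : ∀ h, ‖T h‖ ≤ M * ‖scaleNegPow L a h‖) (x : X) :
    scaledOperator L s T (posPow (boundedInverse L) (max (-s) 0) x) =
      T (posPow (boundedInverse L) (max s 0) x) := by
  have hP := hL.isPositive_boundedInverse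
  have hi := hL.injective_boundedInverse
  rcases le_or_gt 0 s with h | h
  · rw [max_eq_right (by linarith), max_eq_left h, posPow_zero hP]
    have hpow : scalePow L (-s) = (posPow (boundedInverse L) s).toLinearMap.toPMap ⊤ := by
      rw [scalePow, neg_neg, opPow, if_pos h]
    rw [scaledOperator, hpow]
    have hd : DenseRange ((posPow (boundedInverse L) s).toLinearMap.toPMap ⊤).domain.subtype := by
      intro y
      exact subset_closure ⟨⟨y, trivial⟩, rfl⟩
    refine LinearMap.extendOfNorm_eq hd ⟨‖T ∘L posPow (boundedInverse L) s‖, fun y => ?_⟩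
      (⟨x, trivial⟩ : ((posPow (boundedInverse L) s).toLinearMap.toPMap ⊤).domain)
    exact (T ∘L posPow (boundedInverse L) s).le_opNorm y
  · rw [max_eq_left (by linarith), max_eq_right h.le, posPow_zero hP]
    have hs0 : 0 ≤ -s := by linarith
    have hinj := injective_posPow hP hi hs0
    have hpow : scalePow L (-s)
        = ((posPow (boundedInverse L) (-s)).toLinearMap.toPMap ⊤).inverse := by
      rw [scalePow, neg_neg, opPow, if_neg (not_le.2 h)]
    rw [scaledOperator, hpow]
    set Q := posPow (boundedInverse L) (-s) with hQ
    have hd : DenseRange (Q.toLinearMap.toPMap ⊤).inverse.domain.subtype := by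
      have h1 := denseRange_posPow hP hi hs0
      refine Dense.mono ?_ h1
      rintro _ ⟨y, rfl⟩
      exact ⟨⟨_, mem_inverse_domain y⟩, rfl⟩
    have happ : ∀ y, (Q.toLinearMap.toPMap ⊤).inverse ⟨Q y, mem_inverse_domain y⟩ = y := fun y =>
      inverse_apply_apply hinj rfl _
    -- For s < 0 the extension exists because a + s > 0: on vectors Qz the map is bounded by
    -- M‖L^{-(a+s)}‖ ‖Qz‖.
    have key := LinearMap.extendOfNorm_eq
      (f := T.toLinearMap ∘ₗ (Q.toLinearMap.toPMap ⊤).inverse.toFun) hd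
      ⟨M * ‖posPow (boundedInverse L) (a + s)‖, fun y => ?_⟩ ⟨Q x, mem_inverse_domain x⟩
    · refine key.trans ?_
      change T ((Q.toLinearMap.toPMap ⊤).inverse ⟨Q x, mem_inverse_domain x⟩) = T x
      rw [happ]
    · obtain ⟨y, hy⟩ := y
      obtain ⟨z, rfl⟩ := exists_of_mem_inverse_domain hy
      change ‖T ((Q.toLinearMap.toPMap ⊤).inverse ⟨Q z, mem_inverse_domain z⟩)‖ ≤ _ * ‖Q z‖
      rw [happ]
      refine (hT z).trans ?_
      have e : scaleNegPow L a z = posPow (boundedInverse L) (a + s) (Q z) := by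
        rw [hQ, ← posPow_add_apply hP (by linarith) hs0, scaleNegPow]
        congr 2
        ring
      rw [e, mul_assoc]
      gcongr
      exact ContinuousLinearMap.le_opNorm _ _

/-- By continuity it suffices to check the dense range of L^{-s₋}, where the claim is the bound on T
together with a + s₊ = (a + s) + s₋. -/
lemma norm_scaledOperator_apply_le (hL : IsScaleGenerator L) (ha : 0 ≤ a) (hs : -a < s)
    (hM : 0 ≤ M) (hT : ∀ h, ‖T h‖ ≤ M * ‖scaleNegPow L a h‖) (x : X) :
    ‖scaledOperator L s T x‖ ≤ M * ‖posPow (boundedInverse L) (a + s) x‖ := by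
  have hP := hL.isPositive_boundedInverse
  have hi := hL.injective_boundedInverse
  have hd := denseRange_posPow hP hi (le_max_right (-s) 0)
  refine hd.induction_on (p := fun x => ‖scaledOperator L s T x‖ ≤
    M * ‖posPow (boundedInverse L) (a + s) x‖) x (isClosed_le (by fun_prop) (by fun_prop))
    fun y => ?_
  rw [scaledOperator_posPow_apply hL ha hs hM hT, ← posPow_add_apply hP (by linarith)
    (le_max_right _ _)]
  refine (hT _).trans_eq ?_
  rw [scaleNegPow, ← posPow_add_apply hP ha (le_max_right _ _)]
  congr 4
  rcases le_total 0 s with h | h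
  · rw [max_eq_left h, max_eq_right (by linarith)]; ring
  · rw [max_eq_right h, max_eq_left (by linarith)]; ring

lemma le_norm_scaledOperator_apply (hL : IsScaleGenerator L) (ha : 0 ≤ a) (hs : -a < s)
    (hM : 0 ≤ M) (hT : ∀ h, ‖T h‖ ≤ M * ‖scaleNegPow L a h‖)
    (hT' : ∀ h, m * ‖scaleNegPow L a h‖ ≤ ‖T h‖) (x : X) :
    m * ‖posPow (boundedInverse L) (a + s) x‖ ≤ ‖scaledOperator L s T x‖ := by
  have hP := hL.isPositive_boundedInverse
  have hi := hL.injective_boundedInverse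
  have hd := denseRange_posPow hP hi (le_max_right (-s) 0)
  refine hd.induction_on (p := fun x => m * ‖posPow (boundedInverse L) (a + s) x‖ ≤
    ‖scaledOperator L s T x‖) x (isClosed_le (by fun_prop) (by fun_prop))
    fun y => ?_
  rw [scaledOperator_posPow_apply hL ha hs hM hT, ← posPow_add_apply hP (by linarith)
    (le_max_right _ _)]
  refine Eq.trans_le ?_ (hT' _)
  rw [scaleNegPow, ← posPow_add_apply hP ha (le_max_right _ _)]
  congr 4
  rcases le_total 0 s with h | h
  · rw [max_eq_left h, max_eq_right (by linarith)]; ring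
  · rw [max_eq_right h, max_eq_left (by linarith)]; ring

variable {T₁ T₂ : X →L[𝕜] Y} {b K : ℝ}

lemma norm_scaledOperator_sub_apply_le (hL : IsScaleGenerator L) (ha : 0 ≤ a) (hs : -a < s)
    (hM : 0 ≤ M) (hT₁ : ∀ h, ‖T₁ h‖ ≤ M * ‖scaleNegPow L a h‖)
    (hT₂ : ∀ h, ‖T₂ h‖ ≤ M * ‖scaleNegPow L a h‖) (hb : 0 ≤ b) (hbs : 0 ≤ b + s)
    (h : ∀ x, ‖T₁ x - T₂ x‖ ≤ K * ‖posPow (boundedInverse L) b x‖) (x : X) :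
    ‖(scaledOperator L s T₁ - scaledOperator L s T₂) x‖ ≤
      K * ‖posPow (boundedInverse L) (b + s) x‖ := by
  have hP := hL.isPositive_boundedInverse
  have hi := hL.injective_boundedInverse
  have hd := denseRange_posPow hP hi (le_max_right (-s) 0)
  refine hd.induction_on (p := fun x => ‖(scaledOperator L s T₁ - scaledOperator L s T₂) x‖ ≤
    K * ‖posPow (boundedInverse L) (b + s) x‖) x (isClosed_le (by fun_prop) (by fun_prop))
    fun y => ?_
  rw [sub_apply, scaledOperator_posPow_apply hL ha hs hM hT₁,
    scaledOperator_posPow_apply hL ha hs hM hT₂, ← posPow_add_apply hP hbs (le_max_right _ _)]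
  refine (h _).trans_eq ?_
  rw [← posPow_add_apply hP hb (le_max_right _ _)]
  congr 4
  rcases le_total 0 s with h | h
  · rw [max_eq_left h, max_eq_right (by linarith)]; ring
  · rw [max_eq_right h, max_eq_left (by linarith)]; ring

/-- If b + s < 0, then s < 0 and the power L^{b+s} is bounded. Applied to L^{-b} y it gives L^s y,
on which the scaled difference is just (T₁ - T₂) y. -/
lemma norm_scaledOperator_sub_posPow_apply_le (hL : IsScaleGenerator L) (ha : 0 ≤ a) (hs : -a < s)
    (hM : 0 ≤ M) (hT₁ : ∀ h, ‖T₁ h‖ ≤ M * ‖scaleNegPow L a h‖)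
    (hT₂ : ∀ h, ‖T₂ h‖ ≤ M * ‖scaleNegPow L a h‖) (hb : 0 ≤ b) (hbs : b + s < 0)
    (h : ∀ x, ‖T₁ x - T₂ x‖ ≤ K * ‖posPow (boundedInverse L) b x‖) (x : X) :
    ‖(scaledOperator L s T₁ - scaledOperator L s T₂) (posPow (boundedInverse L) (-(b + s)) x)‖ ≤
      K * ‖x‖ := by
  have hP := hL.isPositive_boundedInverse
  have hi := hL.injective_boundedInverse
  have hd := denseRange_posPow hP hi hb
  refine hd.induction_on (p := fun x => ‖(scaledOperator L s T₁ - scaledOperator L s T₂)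
    (posPow (boundedInverse L) (-(b + s)) x)‖ ≤ K * ‖x‖) x (isClosed_le (by fun_prop) (by fun_prop))
    fun y => ?_
  have e : -(b + s) + b = max (-s) 0 := by
    rw [max_eq_left (by linarith)]; ring
  rw [← posPow_add_apply hP (by linarith) hb, e, sub_apply,
    scaledOperator_posPow_apply hL ha hs hM hT₁, scaledOperator_posPow_apply hL ha hs hM hT₂,
    max_eq_right (by linarith : s ≤ 0), posPow_zero hP]
  exact h y

/-- The difference of two scaled operators in terms of `S ^ μ`, `S = (T L ^ (-s))* (T L ^ (-s))`. -/
lemma weightedBound_scaledOperator_sub (hL : IsScaleGenerator L) (ha : 0 ≤ a) (hs : -a < s)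
    (hm : 0 < m) (hM : 0 < M) (hT : ∀ h, ‖T h‖ ≤ M * ‖scaleNegPow L a h‖)
    (hT' : ∀ h, m * ‖scaleNegPow L a h‖ ≤ ‖T h‖)
    (hT₁ : ∀ h, ‖T₁ h‖ ≤ M * ‖scaleNegPow L a h‖)
    (hT₂ : ∀ h, ‖T₂ h‖ ≤ M * ‖scaleNegPow L a h‖) (hb : 0 ≤ b) (hba : b ≤ a) (hK : 0 ≤ K)
    (h : ∀ x, ‖T₁ x - T₂ x‖ ≤ K * ‖posPow (boundedInverse L) b x‖) {μ : ℝ}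
    (hμ : μ = (b + s) / (2 * (a + s))) (hμ' : -(1 / 2) ≤ μ) :
    WeightedBound ((scaledOperator L s T).adjoint ∘L scaledOperator L s T)
      (scaledOperator L s T₁ - scaledOperator L s T₂) μ
      (K * (m ^ (-(2 * μ)) + M ^ (-(2 * μ)))) := by
  have hP := hL.isPositive_boundedInverse
  have has : 0 < a + s := by linarith
  have hμe : 2 * μ * (a + s) = b + s := by rw [hμ]; field_simp
  -- Löwner-Heinz needs exponents in [0, 1]: 2μ ≤ 1 comes from b ≤ a, and -2μ ≤ 1 is `hμ'`.
  have hμ1 : 2 * μ ≤ 1 := by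
    have : 2 * μ = (b + s) / (a + s) := by rw [← hμe]; field_simp
    rw [this, div_le_one has]; linarith
  set A := scaledOperator L s T with hA
  have hS := isPositive_adjoint_comp_self A
  have hu := norm_scaledOperator_apply_le hL ha hs hM.le hT
  have hl := le_norm_scaledOperator_apply hL ha hs hM.le hT hT'
  have hcS : ContinuousOn (fun t => √t) (Icc 0 ‖A.adjoint ∘L A‖) :=
    Real.continuous_sqrt.continuousOn
  have hsqrt : ∀ p : ℝ, EqOn (fun t => √t ^ (2 * p)) (fun t => t ^ p) (Icc 0 ‖A.adjoint ∘L A‖) := by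
    intro p t ht
    change √t ^ (2 * p) = t ^ p
    rw [Real.sqrt_eq_rpow, ← Real.rpow_mul ht.1]
    congr 1; ring
  have hcP : ∀ c : ℝ, ContinuousOn (fun t => c * t ^ (a + s)) (Icc 0 ‖boundedInverse L‖) :=
    fun c => continuousOn_const.mul (continuousOn_rpow has.le _)
  have hPn : ∀ c : ℝ, 0 ≤ c → ∀ x, ‖fc (boundedInverse L) (fun t => c * t ^ (a + s)) x‖
      = c * ‖posPow (boundedInverse L) (a + s) x‖ := fun c hc x => by
    rw [fc_const_mul hP c (continuousOn_rpow has.le _), smul_apply, norm_smul, RCLike.norm_ofReal,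
      abs_of_nonneg hc]
    rfl
  have hPp : ∀ c : ℝ, 0 ≤ c → ∀ p : ℝ, 0 ≤ p → ∀ x,
      ‖fc (boundedInverse L) (fun t => (c * t ^ (a + s)) ^ p) x‖
        = c ^ p * ‖posPow (boundedInverse L) (p * (a + s)) x‖ := fun c hc p hp x => by
    have e : EqOn (fun t => (c * t ^ (a + s)) ^ p) (fun t => c ^ p * t ^ (p * (a + s)))
        (Icc 0 ‖boundedInverse L‖) := fun t ht => by
      change (c * t ^ (a + s)) ^ p = c ^ p * t ^ (p * (a + s))
      rw [Real.mul_rpow hc (Real.rpow_nonneg ht.1 _), ← Real.rpow_mul ht.1, mul_comm (a + s)]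
    rw [fc_congr e, fc_const_mul hP _ (continuousOn_rpow (by positivity) _), smul_apply, norm_smul,
      RCLike.norm_ofReal, abs_of_nonneg (by positivity)]
    rfl
  have hmp : 0 < m ^ (-(2 * μ)) := Real.rpow_pos_of_pos hm _
  have hMp : 0 < M ^ (-(2 * μ)) := Real.rpow_pos_of_pos hM _
  constructor
  · intro hμ0 x
    have hbs : 0 ≤ b + s := by rw [← hμe]; positivity
    have h1 := norm_scaledOperator_sub_apply_le hL ha hs hM.le hT₁ hT₂ hb hbs h x
    -- For μ ≥ 0 the lower bound m L^{-(a+s)} ≤ S^{1/2}, in the sense of norms, is raised to the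
    -- power 2μ.
    have h2 := norm_fc_rpow_le hP hS (hcP m) hcS
      (fun t ht => mul_nonneg hm.le (Real.rpow_nonneg ht.1 _)) (fun t _ => Real.sqrt_nonneg t)
      (fun x => by rw [hPn m hm.le, norm_fc_sqrt_apply]; exact hl x) (p := 2 * μ)
      ⟨by positivity, hμ1⟩ x
    rw [hPp m hm.le _ (by positivity), fc_congr (hsqrt μ), hμe] at h2
    refine h1.trans ?_
    rw [mul_assoc]
    gcongr
    calc ‖posPow (boundedInverse L) (b + s) x‖
        = m ^ (-(2 * μ)) * (m ^ (2 * μ) * ‖posPow (boundedInverse L) (b + s) x‖) := by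
          rw [← mul_assoc, ← Real.rpow_add hm, neg_add_cancel, Real.rpow_zero, one_mul]
      _ ≤ m ^ (-(2 * μ)) * ‖fc (A.adjoint ∘L A) (fun t => t ^ μ) x‖ := by gcongr
      _ ≤ _ := by gcongr; linarith
  · intro hμ0 y
    have hbs : b + s < 0 := by rw [← hμe]; nlinarith
    set D := scaledOperator L s T₁ - scaledOperator L s T₂ with hD
    have h1 : ‖posPow (boundedInverse L) (-(b + s)) (D.adjoint y)‖ ≤ K * ‖y‖ := by
      have h3 := norm_adjoint_apply_le (V := D ∘L posPow (boundedInverse L) (-(b + s))) hK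
        (norm_scaledOperator_sub_posPow_apply_le hL ha hs hM.le hT₁ hT₂ hb hbs h) y
      rw [ContinuousLinearMap.adjoint_comp] at h3
      rwa [show (posPow (boundedInverse L) (-(b + s))).adjoint = _ from isSelfAdjoint_posPow hP]
        at h3
    -- For μ < 0 the upper bound with M is raised to the power -2μ. The sum in the final constant
    -- covers both signs.
    have h2 := norm_fc_rpow_le hS hP hcS (hcP M) (fun t _ => Real.sqrt_nonneg t)
      (fun t ht => mul_nonneg hM.le (Real.rpow_nonneg ht.1 _))
      (fun x => by rw [hPn M hM.le, norm_fc_sqrt_apply]; exact hu x) (p := 2 * -μ)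
      ⟨by linarith, by linarith⟩ (D.adjoint y)
    rw [hPp M hM.le _ (by linarith), fc_congr (hsqrt (-μ)),
      show 2 * -μ * (a + s) = -(b + s) by linarith, show 2 * -μ = -(2 * μ) by ring] at h2
    calc _ ≤ M ^ (-(2 * μ)) * (K * ‖y‖) := h2.trans (by gcongr)
      _ ≤ (m ^ (-(2 * μ)) + M ^ (-(2 * μ))) * (K * ‖y‖) := by gcongr; linarith
      _ = _ := by ring

end ScaledOperator

end Scale

/-! ### Decay of the residual products and assembly of the estimate. -/

section FilterProduct

variable {𝕜 X Y : Type*} [RCLike 𝕜] [NormedAddCommGroup X] [InnerProductSpace 𝕜 X]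
  [CompleteSpace X] [NormedAddCommGroup Y] [InnerProductSpace 𝕜 Y] [CompleteSpace Y]

/-- The larger of α⁻¹ and S is at least half their sum. If it is S, the decay of R is used; if it is
α⁻¹, the decay of t^θ/(α + t). The factor 2 bounds 2^θ. -/
lemma rpow_mul_mul_inv_add_le {α S t R θ : ℝ} (hα : 0 < α) (hS : 0 ≤ S) (ht : 0 ≤ t)
    (hθ : θ ∈ Icc (0 : ℝ) 1) (hR0 : 0 ≤ R) (hR1 : R ≤ 1) (hR : 0 < S → t ^ θ * R ≤ S ^ (-θ)) :
    t ^ θ * R * (α + t)⁻¹ ≤ 2 * α⁻¹ * (α⁻¹ + S) ^ (-θ) := by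
  have hαi : 0 < α⁻¹ := inv_pos.2 hα
  have hinv : (α + t)⁻¹ ≤ α⁻¹ := inv_anti₀ hα (by linarith)
  have hhalf : ∀ τ : ℝ, 0 < τ → α⁻¹ + S ≤ 2 * τ → τ ^ (-θ) ≤ 2 * (α⁻¹ + S) ^ (-θ) := by
    intro τ hτ h
    have h1 : (2 * τ) ^ (-θ) ≤ (α⁻¹ + S) ^ (-θ) :=
      Real.rpow_le_rpow_of_nonpos (by positivity) h (by linarith [hθ.1])
    rw [Real.mul_rpow zero_le_two hτ.le] at h1
    have h2 : (2 : ℝ)⁻¹ ≤ 2 ^ (-θ) := by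
      rw [← Real.rpow_neg_one]
      exact Real.rpow_le_rpow_of_exponent_le one_le_two (by linarith [hθ.2])
    have h3 : 0 < τ ^ (-θ) := Real.rpow_pos_of_pos hτ _
    nlinarith
  rcases le_total α⁻¹ S with h | h
  · have hS' : 0 < S := hαi.trans_le h
    calc t ^ θ * R * (α + t)⁻¹ ≤ S ^ (-θ) * α⁻¹ :=
          mul_le_mul (hR hS') hinv (by positivity) (by positivity)
      _ ≤ 2 * (α⁻¹ + S) ^ (-θ) * α⁻¹ := by gcongr; exact hhalf S hS' (by linarith)
      _ = _ := by ring
  · calc t ^ θ * R * (α + t)⁻¹ ≤ t ^ θ * 1 * (α + t)⁻¹ := by gcongr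
      _ = t ^ θ * (α + t)⁻¹ := by ring
      _ ≤ α ^ (θ - 1) := rpow_mul_inv_add_le ht hα hθ
      _ = α⁻¹ ^ (-θ) * α⁻¹ := by
          rw [Real.inv_rpow hα.le, Real.rpow_neg hα.le, inv_inv, Real.rpow_sub_one hα.ne',
            div_eq_mul_inv]
      _ ≤ 2 * (α⁻¹ + S) ^ (-θ) * α⁻¹ := by gcongr; exact hhalf _ hαi (by linarith)
      _ = _ := by ring

lemma stepSum_sub_eq {α : ℕ → ℝ} (j n : ℕ) :
    stepSum α (n + 1) - stepSum α j = (α j)⁻¹ + (stepSum α (n + 1) - stepSum α (j + 1)) := by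
  simp only [stepSum, Finset.sum_range_succ _ j]
  ring

lemma stepSum_mono {α : ℕ → ℝ} (hα : ∀ k, 0 < α k) : Monotone (stepSum α) :=
  monotone_nat_of_le_succ fun n => by
    have : 0 < 1 / α n := one_div_pos.2 (hα n)
    simp only [stepSum, Finset.sum_range_succ]
    linarith

/-- The product `∏_{k=j+1}^n r_{α_k}`. -/
noncomputable def residualFun (g : ℝ → ℝ → ℝ) (α : ℕ → ℝ) (j n : ℕ) (t : ℝ) : ℝ :=
  ∏ k ∈ Finset.Icc (j + 1) n, residual g (α k) t

section ResidualFun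

variable {g : ℝ → ℝ → ℝ} {α : ℕ → ℝ} {j n : ℕ} {b₂ : ℝ}

lemma FilterDecay.residualFun_mem (h : FilterDecay g α b₂) {t : ℝ} (ht : t ∈ Icc (0 : ℝ) 1) :
    residualFun g α j n t ∈ Icc (0 : ℝ) 1 := by
  rcases le_or_gt (j + 1) n with hn | hn
  · have := (h n (j + 1) hn 0 ⟨le_rfl, zero_le_one⟩ t ht).1
    simpa [residualFun] using this
  · rw [residualFun, Finset.Icc_eq_empty (by omega), Finset.prod_empty]
    exact ⟨zero_le_one, le_rfl⟩

/-- The product starts at j + 1 and so only decays with s_n - s_j; the resolvent factor supplies the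
missing 1/α_j. For n = j the product is empty and s_n - s_j = 0, so no decay of R is required. -/
lemma FilterDecay.residualFun_le (h : FilterDecay g α b₂) (hα : ∀ k, 0 < α k) (hjn : j ≤ n) {θ t : ℝ}
    (hθ : θ ∈ Icc (0 : ℝ) 1) (ht : t ∈ Icc (0 : ℝ) 1) :
    t ^ θ * residualFun g α j n t * (α j + t)⁻¹ ≤
      2 * (α j)⁻¹ * (stepSum α (n + 1) - stepSum α j) ^ (-θ) := by
  rw [stepSum_sub_eq]
  have hmem := h.residualFun_mem (j := j) (n := n) ht
  refine rpow_mul_mul_inv_add_le (hα j) (sub_nonneg.2 (stepSum_mono hα (by omega))) ht.1 hθ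
    hmem.1 hmem.2 fun hpos => ?_
  have hn : j + 1 ≤ n := by
    by_contra! hlt
    have : n = j := by omega
    rw [this, sub_self] at hpos
    exact lt_irrefl _ hpos
  exact (h n (j + 1) hn θ hθ t ht).1.2

lemma continuousOn_residualFun (hg : ∀ k, ContinuousOn (g (α k)) (Icc 0 1)) :
    ContinuousOn (residualFun g α j n) (Icc 0 1) :=
  continuousOn_finsetProd _ fun k _ => continuousOn_const.sub (continuousOn_id.mul (hg k))

lemma residualProd_eq_fc {P : X →L[𝕜] X} (hP : P.IsPositive)
    (hg : ∀ k, ContinuousOn (g (α k)) (Icc 0 ‖P‖)) :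
    residualProd g α j n P = fc P (residualFun g α j n) := by
  have hr : ∀ k, ContinuousOn (residual g (α k)) (Icc 0 ‖P‖) := fun k =>
    continuousOn_const.sub (continuousOn_id.mul (hg k))
  have hlist : ∀ l : List ℕ,
      ContinuousOn (fun t => (l.map fun k => residual g (α k) t).prod) (Icc 0 ‖P‖) ∧
      (l.map fun k => fc P (residual g (α k))).prod
        = fc P (fun t => (l.map fun k => residual g (α k) t).prod) := by
    intro l
    induction l with
    | nil => exact ⟨continuousOn_const, by simp [fc_one hP]⟩
    | cons k l ih =>
      simp only [List.map_cons, List.prod_cons]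
      exact ⟨(hr k).mul ih.1, by rw [ih.2, fc_mul hP (hr k) ih.1]⟩
  rw [residualProd, (hlist _).2]
  rfl

end ResidualFun

lemma AnalyticFilter.continuousOn {g : ℝ → ℝ → ℝ} {c₁ b₀ b₁ α : ℝ}
    (h : AnalyticFilter g c₁ b₀ b₁) (hα : 0 < α) : ContinuousOn (g α) (Icc 0 1) := by
  obtain ⟨D, Φ, γ, -, -, hID, hΦ, hΦg, -⟩ := h α hα
  have h1 : ContinuousOn (fun l : ℝ => (Φ (l : ℂ)).re) (Icc 0 1) :=
    Complex.continuous_re.comp_continuousOn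
      (hΦ.continuousOn.comp Complex.continuous_ofReal.continuousOn hID)
  have h2 : ContinuousOn (fun l : ℝ => 1 / (α + l)) (Icc 0 1) :=
    continuousOn_const.div (continuousOn_const.add continuousOn_id) fun l hl => by
      have : 0 < α + l := by linarith [hl.1]
      exact this.ne'
  refine (h1.add h2).congr fun l hl => ?_
  change g α l = (Φ (l : ℂ)).re + 1 / (α + l)
  rw [hΦg l hl, Complex.ofReal_re]
  ring

/-- For ν ≥ 0 the hypothesis bounds the adjoint of S^ν V. For ν < 0 it is the premise of Douglas'
lemma, which puts the range of V into the domain of S^ν. -/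
lemma compNormLE_opPow_of_norm_adjoint_le {S : X →L[𝕜] X} (hS : S.IsPositive)
    (hi : Function.Injective S) {V : Y →L[𝕜] X} {ν c : ℝ} (hc : 0 ≤ c)
    (h : ∀ x, ‖V.adjoint (fc S (fun t => t ^ max ν 0) x)‖ ≤
      c * ‖fc S (fun t => t ^ max (-ν) 0) x‖) : CompNormLE (opPow S ν) V c := by
  rcases le_or_gt 0 ν with hν | hν
  · rw [max_eq_left hν, max_eq_right (neg_nonpos.2 hν)] at h
    simp only [Real.rpow_zero, fc_one hS] at h
    rw [compNormLE_opPow_of_nonneg hν]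
    intro y
    have h1 := norm_adjoint_apply_le (V := V.adjoint ∘L posPow S ν) hc h y
    rw [ContinuousLinearMap.adjoint_comp, ContinuousLinearMap.adjoint_adjoint] at h1
    rwa [show (posPow S ν).adjoint = _ from isSelfAdjoint_posPow hS] at h1
  · rw [max_eq_right hν.le, max_eq_left (neg_nonneg.2 hν.le)] at h
    simp only [Real.rpow_zero, fc_one hS] at h
    rw [compNormLE_opPow_of_neg hS hi hν]
    exact exists_eq_apply_of_norm_adjoint_le (isSelfAdjoint_posPow hS)
      (injective_posPow hS hi (neg_nonneg.2 hν.le)) hc h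

lemma compNormLE_perturbation {A B : X →L[𝕜] Y} {g : ℝ → ℝ → ℝ} {α : ℕ → ℝ}
    {c₁ b₀ b₁ b₂ μ ν κ : ℝ} (hA : ‖A‖ ≤ 1) (hB : ‖B‖ ≤ 1)
    (hAi : Function.Injective A) (hα : ∀ k, 0 < α k ∧ α k ≤ c₁) (hg : AnalyticFilter g c₁ b₀ b₁)
    (hd : FilterDecay g α b₂) (hκ : 0 ≤ κ) (hμ : μ ∈ Icc (-(1 / 2) : ℝ) (1 / 2))
    (hν : ν ∈ Icc (-μ) (1 / 2)) (hDA : WeightedBound (A.adjoint ∘L A) (A - B) μ κ)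
    (hDB : WeightedBound (B.adjoint ∘L B) (A - B) μ κ) {j n : ℕ} (hjn : j ≤ n) :
    CompNormLE (opPow (A.adjoint ∘L A) ν) (perturbation g α j n A B)
      ((32 + 64 * b₀ ^ 2 * |b₁|) *
        (κ * (α j)⁻¹ * (stepSum α (n + 1) - stepSum α j) ^ (-(ν + μ)))) := by
  have hS := isPositive_adjoint_comp_self A
  have hSB := isPositive_adjoint_comp_self B
  have hsA := Icc_zero_norm_subset hA
  have hα0 : ∀ k, 0 < α k := fun k => (hα k).1
  have hgc : ∀ k, ContinuousOn (g (α k)) (Icc 0 1) := fun k => hg.continuousOn (hα0 k)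
  have hRc := continuousOn_residualFun (j := j) (n := n) hgc
  have hσ : (α j)⁻¹ ≤ stepSum α (n + 1) - stepSum α j := by
    rw [stepSum_sub_eq]
    linarith [stepSum_mono hα0 (show j + 1 ≤ n + 1 by omega)]
  have hσ0 : 0 < stepSum α (n + 1) - stepSum α j := (inv_pos.2 (hα0 j)).trans_le hσ
  have hSi : Function.Injective (A.adjoint ∘L A) := by
    rw [injective_iff_map_eq_zero]
    intro x hx
    refine (injective_iff_map_eq_zero A).1 hAi x ?_
    rw [← inner_self_eq_zero (𝕜 := 𝕜), ← ContinuousLinearMap.adjoint_inner_right]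
    change inner 𝕜 x ((A.adjoint ∘L A) x) = 0
    rw [hx, inner_zero_right]
  -- Taking adjoints turns g(B*B) B* into B g(B*B) = g(BB*) B, the form treated by the resolvent
  -- estimates.
  have hadj : (perturbation g α j n A B).adjoint =
      (A ∘L fc (A.adjoint ∘L A) (g (α j)) - fc (B ∘L B.adjoint) (g (α j)) ∘L B) ∘L
        fc (A.adjoint ∘L A) (residualFun g α j n) := by
    rw [perturbation, residualProd_eq_fc hS fun k => (hgc k).mono hsA,
      ContinuousLinearMap.adjoint_comp, adjoint_fc hS, map_sub, ContinuousLinearMap.adjoint_comp,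
      ContinuousLinearMap.adjoint_comp, adjoint_fc hS, adjoint_fc hSB,
      ContinuousLinearMap.adjoint_adjoint, ContinuousLinearMap.adjoint_adjoint,
      comp_fc_adjoint_comp_self B ((hgc j).mono (Icc_zero_sq_subset hB))]
  have hc : 0 ≤ κ * (α j)⁻¹ * (stepSum α (n + 1) - stepSum α j) ^ (-(ν + μ)) :=
    mul_nonneg (mul_nonneg hκ (inv_pos.2 (hα0 j)).le) (Real.rpow_nonneg hσ0.le _)
  refine compNormLE_opPow_of_norm_adjoint_le hS hSi (mul_nonneg (by positivity) hc) fun x => ?_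
  obtain ⟨D, Φ, γ, hD, -, hID, hΦ, hΦg, hγ, hγD, hw1, hw0, hγb, hint⟩ := hg (α j) (hα0 j)
  have key := norm_filter_difference_le hA hB (hα0 j) hσ hκ hμ hν hDA hDB hRc
    (fun t ht => (hd.residualFun_mem ht).1)
    (fun θ hθ t ht => hd.residualFun_le hα0 hjn hθ ht) hγ hD hΦ hγD hw0 hID hw1 hΦg hγb
    ((hint (hα j).2).trans (le_abs_self b₁)) x
  dsimp only at key
  rw [fc_mul_apply hS (hRc.mono hsA) (continuousOn_rpow (le_max_right _ _) _)] at key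
  rw [hadj]
  refine key.trans_eq ?_
  ring

end FilterProduct

end InexactNewton

/-! ### The main estimate. -/

theorem lemma2 (a b s m M b₀ b₁ b₂ : ℝ) (ha : 0 ≤ a) (hs : -a < s) (hb : 0 ≤ b) (hba : b ≤ a)
    (hm : 0 < m) (hmM : m ≤ M) :
    ∃ C : ℝ, 0 < C ∧
      ∀ (𝕜 X Y : Type*) [RCLike 𝕜]
        [NormedAddCommGroup X] [InnerProductSpace 𝕜 X] [CompleteSpace X]
        [NormedAddCommGroup Y] [InnerProductSpace 𝕜 Y] [CompleteSpace Y]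
        (L : X →ₗ.[𝕜] X) (F : X → Y) (xd : X) (ρ β K₀ c₁ : ℝ)
        (g : ℝ → ℝ → ℝ) (α : ℕ → ℝ),
        InexactNewton.IsScaleGenerator L →
        0 < β → β ≤ 1 → 0 ≤ K₀ →
        (∀ k, 0 < α k ∧ α k ≤ c₁) →
        InexactNewton.AnalyticFilter g c₁ b₀ b₁ →
        InexactNewton.FilterDecay g α b₂ →
        InexactNewton.OperatorCondition L F xd ρ a b s m M β K₀ (α 0) →
        ∀ ν : ℝ, -((b + s) / (2 * (a + s))) ≤ ν → ν ≤ 1 / 2 →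
        ∀ x ∈ Metric.ball xd ρ, ∀ n j : ℕ, j ≤ n →
          InexactNewton.CompNormLE
            (InexactNewton.opPow
              ((InexactNewton.scaledOperator L s (fderiv 𝕜 F xd)).adjoint ∘L
                InexactNewton.scaledOperator L s (fderiv 𝕜 F xd)) ν)
            (InexactNewton.perturbation g α j n
              (InexactNewton.scaledOperator L s (fderiv 𝕜 F xd))
              (InexactNewton.scaledOperator L s (fderiv 𝕜 F x)))
            (C * (1 / α j * (InexactNewton.stepSum α (n + 1) - InexactNewton.stepSum α j)
                ^ (-ν - (b + s) / (2 * (a + s))) * (K₀ * ‖x - xd‖ ^ β))) := by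
  set μ := (b + s) / (2 * (a + s)) with hμ
  have hM : 0 < M := hm.trans_le hmM
  have has : 0 < a + s := by linarith
  have hmp : 0 < m ^ (-(2 * μ)) := Real.rpow_pos_of_pos hm _
  have hMp : 0 < M ^ (-(2 * μ)) := Real.rpow_pos_of_pos hM _
  -- The filter constant times the Löwner-Heinz constant; |b₁| keeps it positive before b₁ ≥ 0 is
  -- known.
  refine ⟨(32 + 64 * b₀ ^ 2 * |b₁|) * (m ^ (-(2 * μ)) + M ^ (-(2 * μ))), by positivity, ?_⟩
  intro 𝕜 X Y _ _ _ _ _ _ _ L F xd ρ β K₀ c₁ g α hL _ _ hK₀ hα hg hd hF ν hν₁ hν₂ x hx n j hjn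
  have hxd : xd ∈ Metric.ball xd ρ := Metric.mem_ball_self (Metric.pos_of_mem_ball hx)
  have hK : 0 ≤ K₀ * ‖x - xd‖ ^ β := by positivity
  have hμ1 : μ ≤ 1 / 2 := by
    rw [hμ, div_le_iff₀ (by positivity)]; linarith
  -- If μ < -1/2, no ν satisfies -μ ≤ ν ≤ 1/2; the existence of ν supplies this bound.
  have hμ0 : -(1 / 2) ≤ μ := by linarith
  have hdiff : ∀ h, ‖fderiv 𝕜 F xd h - fderiv 𝕜 F x h‖ ≤
      K₀ * ‖x - xd‖ ^ β * ‖InexactNewton.posPow (InexactNewton.boundedInverse L) b h‖ := fun h => by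
    rw [norm_sub_rev]
    exact InexactNewton.norm_sub_apply_le_of_compNormLE hL hb hK (hF.holder x hx) h
  -- The same difference A - A_x is measured against A_z*A_z, needed for both z = x† and z = x.
  have hW : ∀ z ∈ Metric.ball xd ρ, _ := fun z hz =>
    InexactNewton.weightedBound_scaledOperator_sub hL ha hs hm hM (hF.upper z hz) (hF.lower z hz)
      (hF.upper xd hxd) (hF.upper x hx) hb hba hK hdiff hμ hμ0
  have hinj : Function.Injective (InexactNewton.scaledOperator L s (fderiv 𝕜 F xd)) := by
    rw [injective_iff_map_eq_zero]
    intro h hh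
    have h1 := InexactNewton.le_norm_scaledOperator_apply hL ha hs hM.le (hF.upper xd hxd)
      (hF.lower xd hxd) h
    rw [hh, norm_zero] at h1
    have h2 : InexactNewton.posPow (InexactNewton.boundedInverse L) (a + s) h = 0 :=
      norm_le_zero_iff.1 (nonpos_of_mul_nonpos_right h1 hm)
    exact (injective_iff_map_eq_zero _).1 (InexactNewton.injective_posPow
      hL.isPositive_boundedInverse hL.injective_boundedInverse has.le) h h2
  have key := InexactNewton.compNormLE_perturbation
    ((hF.scaled xd hxd).trans (min_le_left _ _)) ((hF.scaled x hx).trans (min_le_left _ _))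
    hinj hα hg hd (mul_nonneg hK (by positivity)) ⟨hμ0, hμ1⟩ ⟨by linarith, hν₂⟩ (hW xd hxd) (hW x hx)
    hjn
  intro y
  obtain ⟨hy, hle⟩ := key y
  refine ⟨hy, hle.trans_eq ?_⟩
  rw [neg_add', one_div]
  ring
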